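/- **Theorem (global well-posedness, $N$-particle).** Let $N\in\mathbb N$, $N>1$, $\overline N:=N^3$, $\mathbb T:=\mathbb R^3/N\mathbb Z^3$, $\overline{\mathbb T}:=\mathbb T^{\overline N}$, $\Gamma:=\mathbb Z^3/N\mathbb Z^3$. Let $e,Z,M>0$ and let $\sigma\in C^2(\mathbb T)$ be real-valued with $\int_{\mathbb T}\sigma(x)\,dx=eZ$. Let $\mathcal F$ be the Hilbert space of antisymmetric functions $\psi\in H^1(\overline{\mathbb T};\mathbb C)$ with norm $\|\psi\|_{\mathcal F}^2=\|\nabla\psi\|_{L^2}^2+\|\psi\|_{L^2}^2$. Let $\mathcal V:=\mathcal F\times\mathbb T^{\Gamma}\times(\mathbb R^{3})^{\Gamma}$ be the manifold of states $X=(\psi,q,p)$ with the metric $\|\psi-\psi'\|_{\mathcal F}+|q-q'|+|p-p'|$, and let $\mathcal W:=\mathcal F\oplus(\mathbb R^{3})^{\Gamma}\oplus(\mathbb R^{3})^{\Gamma}$ be its tangent space. For $X\in\mathcal V$ put $$\rho(x):=\sum_{n\in\Gamma}\sigma(x-n-q(n))-e\sum_{j=1}^{\overline N}\int_{\mathbb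 T^{\overline N-1}}|\psi(\overline y)|^2\Big|_{y_j=x}\prod_{i\ne j}dy_i,\qquad x\in\mathbb T,$$ $$E(X):=\frac12\int_{\overline{\mathbb T}}|\nabla\psi|^2\,d\overline x+\frac12\int_{\mathbb T}\rho\,G\rho\,dx+\sum_{n\in\Gamma}\frac{|p(n)|^2}{2M},\qquad Q(X):=\int_{\overline{\mathbb T}}|\psi|^2\,d\overline x,$$ where $G=(-\Delta)^{-1}$ is given by $G\rho(x)=\sum_{\xi\in\frac{2\pi}N\mathbb Z^3\setminus0}|\xi|^{-2}\hat\rho(\xi)e^{i\xi x}$ for $\rho(x)=\sum_{\xi}\hat\rho(\xi)e^{i\xi x}$. Let $\mathcal M:=\{X\in\mathcal V: Q(X)=Z\}$. Consider the $N$-particle Schrödinger–Poisson–Newton system with the potential $\phi=G\rho$ eliminated, that is, the Hamiltonian system $$\dot X(t)=J\,E'(X(t)),\qquad t\in\mathbb R,\qquad J(\psi_1,\psi_2,\varkappa,\pi)=(\tfrac12\psi_2,-\tfrac12\psi_1,\pi,-\varkappa),\quad \psi=\psi_1+i\psi_2 .$$ A solution in $C(\mathbb R,\mathcal V)$ is a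 continuous $X:\mathbb R\to\mathcal V$ such that, for every $t$, the derivative $E'(X(t))\in\mathcal W^*$ of $E$ along $\mathcal W$ exists and $\frac{d}{dt}\langle X(t),Y\rangle=-\langle E'(X(t)),JY\rangle$ for all $Y\in\mathcal W$, where $\langle\cdot,\cdot\rangle$ is the real scalar product of $L^2(\overline{\mathbb T})\oplus(\mathbb R^{3})^{\Gamma}\oplus(\mathbb R^{3})^{\Gamma}$ and $q$ is lifted locally in time from $\mathbb T^\Gamma$ to $(\mathbb R^3)^\Gamma$. Then for every $X_0\in\mathcal M$: i) there exists a unique solution $X\in C(\mathbb R,\mathcal V)$ of this system with $X(0)=X_0$; ii) $E(X(t))=E(X(0))$ and $Q(X(t))=Q(X(0))$ for all $t\in\mathbb R$. -/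

import Mathlib

open MeasureTheory Filter Topology
open scoped ContDiff

noncomputable section

namespace Crystal

/-! ## The torus, the lattice and the configuration torus -/

instance factPosOfNeZero (N : ℕ) [NeZero N] : Fact (0 < (N : ℝ)) :=
  ⟨by exact_mod_cast Nat.pos_of_ne_zero (NeZero.ne N)⟩

/-- Euclidean space `ℝ³`. -/
abbrev Space := EuclideanSpace ℝ (Fin 3)

/-- The torus `𝕋 = ℝ³ / Nℤ³`; its measure `volume` is Lebesgue measure, of total mass `N³`. -/
abbrev Torus (N : ℕ) := Fin 3 → AddCircle (N : ℝ)

/-- The configuration torus `𝕋^{N̄}` of `N̄ = N³` electrons. -/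
abbrev Config (N : ℕ) := Fin (N ^ 3) → Torus N

/-- The lattice `Γ = ℤ³ / Nℤ³` of the reference positions of the ions. -/
abbrev Lattice (N : ℕ) := Fin 3 → ZMod N

/-- The projection `ℝ³ → 𝕋`. -/
def toTorus (N : ℕ) (y : Fin 3 → ℝ) : Torus N := fun a => (y a : AddCircle (N : ℝ))

/-- The projection of `(ℝ³)^{N̄}` onto the configuration torus. -/
def toConfig (N : ℕ) (y : Fin (N ^ 3) → Fin 3 → ℝ) : Config N := fun j => toTorus N (y j)

/-- A lattice point as a point of `𝕋`. -/
def latticePoint (N : ℕ) (n : Lattice N) : Torus N := toTorus N fun a => ((n a).val : ℝ)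

/-! ## Weak derivatives on the configuration torus -/

/-- Smooth complex functions on the configuration torus. -/
def IsSmooth (N : ℕ) (η : Config N → ℂ) : Prop :=
  ContDiff ℝ ∞ fun y => η (toConfig N y)

/-- The point `x` with its coordinate `x_j^a` replaced by `x_j^a + s`. -/
def shift {N : ℕ} (x : Config N) (j : Fin (N ^ 3)) (a : Fin 3) (s : ℝ) : Config N :=
  Function.update x j (Function.update (x j) a (x j a + (s : AddCircle (N : ℝ))))

/-- The classical partial derivative `∂η/∂x_j^a`. -/
def partialDeriv {N : ℕ} (j : Fin (N ^ 3)) (a : Fin 3) (η : Config N → ℂ) (x : Config N) : ℂ :=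
  deriv (fun s : ℝ => η (shift x j a s)) 0

/-- `L²(𝕋^{N̄}; ℂ)`. -/
abbrev L2 (N : ℕ) [NeZero N] := Lp ℂ 2 (volume : Measure (Config N))

/-- `g` is the weak (distributional) derivative of `ψ` with respect to `x_j^a`. -/
def IsWeakPartial {N : ℕ} [NeZero N] (j : Fin (N ^ 3)) (a : Fin 3) (ψ g : L2 N) : Prop :=
  ∀ η : Config N → ℂ, IsSmooth N η →
    ∫ x, ψ x * partialDeriv j a η x = -∫ x, g x * η x

/-- `ψ(x_{π(1)}, …, x_{π(N̄)}) = sign(π) ψ(x_1, …, x_{N̄})` for every permutation `π`. -/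
def IsAntisymmetric {N : ℕ} [NeZero N] (ψ : L2 N) : Prop :=
  ∀ π : Equiv.Perm (Fin (N ^ 3)),
    ∀ᵐ x : Config N, ψ (fun j => x (π j)) = ((Equiv.Perm.sign π : ℤ) : ℂ) * ψ x

/-! ### Facts needed to see that the fermionic space is a linear space -/

lemma toConfig_surj (N : ℕ) : Function.Surjective (toConfig N) := by
  intro x
  choose y hy using fun j a => QuotientAddGroup.mk_surjective (x j a)
  exact ⟨y, by funext j a; exact hy j a⟩

lemma isQuotientMap_toConfig (N : ℕ) : IsQuotientMap (toConfig N) := by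
  have h : IsOpenQuotientMap (fun t : ℝ => (t : AddCircle (N : ℝ))) :=
    QuotientAddGroup.isOpenQuotientMap_mk
  exact (IsOpenQuotientMap.piMap fun _ : Fin (N ^ 3) =>
    IsOpenQuotientMap.piMap fun _ : Fin 3 => h).isQuotientMap

lemma IsSmooth.continuous {N : ℕ} {η : Config N → ℂ} (h : IsSmooth N η) : Continuous η :=
  (isQuotientMap_toConfig N).continuous_iff.2 (ContDiff.continuous h)

lemma partialDeriv_toConfig {N : ℕ} {η : Config N → ℂ} (h : IsSmooth N η) (j : Fin (N ^ 3))
    (a : Fin 3) (y : Fin (N ^ 3) → Fin 3 → ℝ) :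
    partialDeriv j a η (toConfig N y) =
      fderiv ℝ (fun y => η (toConfig N y)) y (Pi.single j (Pi.single a 1)) := by
  have hs : ∀ s : ℝ, shift (toConfig N y) j a s =
      toConfig N (y + s • (Pi.single j (Pi.single a 1) : Fin (N ^ 3) → Fin 3 → ℝ)) := by
    intro s
    funext i b
    by_cases hi : i = j
    · subst hi
      by_cases hb : b = a
      · subst hb
        simp [shift, toConfig, toTorus]
      · simp [shift, toConfig, toTorus, hb]
    · simp [shift, toConfig, toTorus, hi]
  simp only [partialDeriv, hs]
  have hd : DifferentiableAt ℝ (fun y => η (toConfig N y)) y :=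
    (ContDiff.differentiable h (by simp)) y
  exact hd.hasFDerivAt.hasLineDerivAt _ |>.lineDeriv

lemma IsSmooth.continuous_partialDeriv {N : ℕ} {η : Config N → ℂ} (h : IsSmooth N η)
    (j : Fin (N ^ 3)) (a : Fin 3) : Continuous (partialDeriv j a η) := by
  refine (isQuotientMap_toConfig N).continuous_iff.2 ?_
  have : partialDeriv j a η ∘ toConfig N = fun y =>
      fderiv ℝ (fun y => η (toConfig N y)) y (Pi.single j (Pi.single a 1)) :=
    funext fun y => partialDeriv_toConfig h j a y
  rw [this]
  exact (ContDiff.continuous_fderiv h (by simp)).clm_apply continuous_const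

lemma integrable_mul_continuous {N : ℕ} [NeZero N] (ψ : L2 N) {η : Config N → ℂ}
    (h : Continuous η) : Integrable fun x => ψ x * η x :=
  have hη : MemLp η 2 (volume : Measure (Config N)) :=
    h.memLp_of_hasCompactSupport (HasCompactSupport.of_compactSpace η)
  (Lp.memLp ψ).integrable_mul hη

lemma IsWeakPartial.zero {N : ℕ} [NeZero N] (j : Fin (N ^ 3)) (a : Fin 3) :
    IsWeakPartial j a (0 : L2 N) 0 := by
  intro η _
  have h0 := Lp.coeFn_zero ℂ 2 (volume : Measure (Config N))
  have h : ∀ ζ : Config N → ℂ, ∫ x, (0 : L2 N) x * ζ x = 0 := fun ζ => by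
    rw [integral_congr_ae (g := fun _ => 0) (by filter_upwards [h0] with x hx; rw [hx]; simp)]
    simp
  rw [h, h, neg_zero]

lemma IsWeakPartial.add {N : ℕ} [NeZero N] {j : Fin (N ^ 3)} {a : Fin 3} {ψ ψ' g g' : L2 N}
    (h : IsWeakPartial j a ψ g) (h' : IsWeakPartial j a ψ' g') :
    IsWeakPartial j a (ψ + ψ') (g + g') := by
  intro η hη
  have key : ∀ (u v : L2 N) {ζ : Config N → ℂ}, Continuous ζ →
      ∫ x, (u + v : L2 N) x * ζ x = (∫ x, u x * ζ x) + ∫ x, v x * ζ x := by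
    intro u v ζ hζ
    rw [← integral_add (integrable_mul_continuous u hζ) (integrable_mul_continuous v hζ)]
    refine integral_congr_ae ?_
    filter_upwards [Lp.coeFn_add u v] with x hx
    rw [hx, Pi.add_apply, add_mul]
  rw [key ψ ψ' (hη.continuous_partialDeriv j a), key g g' hη.continuous, h η hη, h' η hη]
  ring

lemma IsWeakPartial.smul {N : ℕ} [NeZero N] {j : Fin (N ^ 3)} {a : Fin 3} {ψ g : L2 N} (c : ℂ)
    (h : IsWeakPartial j a ψ g) : IsWeakPartial j a (c • ψ) (c • g) := by
  intro η hη
  have key : ∀ (u : L2 N) (ζ : Config N → ℂ),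
      ∫ x, (c • u : L2 N) x * ζ x = c * ∫ x, u x * ζ x := by
    intro u ζ
    rw [← integral_const_mul]
    refine integral_congr_ae ?_
    filter_upwards [Lp.coeFn_smul c u] with x hx
    rw [hx, Pi.smul_apply, smul_eq_mul, mul_assoc]
  rw [key, key, h η hη]
  ring

lemma measurePreserving_perm (N : ℕ) [NeZero N] (π : Equiv.Perm (Fin (N ^ 3))) :
    MeasurePreserving (fun (x : Config N) j => x (π j)) := by
  have h := volume_measurePreserving_piCongrLeft (fun _ : Fin (N ^ 3) => Torus N) π.symm
  have he : ⇑(MeasurableEquiv.piCongrLeft (fun _ : Fin (N ^ 3) => Torus N) π.symm) =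
      fun (x : Config N) j => x (π j) := by
    funext x j
    have := MeasurableEquiv.piCongrLeft_apply_apply (β := fun _ => Torus N) π.symm x (π j)
    simpa using this
  rw [← he]
  exact h

lemma IsAntisymmetric.zero {N : ℕ} [NeZero N] : IsAntisymmetric (0 : L2 N) := by
  intro π
  have h0 := Lp.coeFn_zero ℂ 2 (volume : Measure (Config N))
  filter_upwards [h0, (measurePreserving_perm N π).quasiMeasurePreserving.ae h0] with x hx hx'
  rw [hx, hx']
  simp

lemma IsAntisymmetric.add {N : ℕ} [NeZero N] {ψ ψ' : L2 N} (h : IsAntisymmetric ψ)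
    (h' : IsAntisymmetric ψ') : IsAntisymmetric (ψ + ψ') := by
  intro π
  have h0 := Lp.coeFn_add ψ ψ'
  filter_upwards [h0, (measurePreserving_perm N π).quasiMeasurePreserving.ae h0, h π, h' π]
    with x hx hx' h1 h2
  rw [hx, hx', Pi.add_apply, Pi.add_apply, h1, h2, mul_add]

lemma IsAntisymmetric.smul {N : ℕ} [NeZero N] {ψ : L2 N} (c : ℂ) (h : IsAntisymmetric ψ) :
    IsAntisymmetric (c • ψ) := by
  intro π
  have h0 := Lp.coeFn_smul c ψ
  filter_upwards [h0, (measurePreserving_perm N π).quasiMeasurePreserving.ae h0, h π]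
    with x hx hx' h1
  rw [hx, hx', Pi.smul_apply, Pi.smul_apply, h1, smul_eq_mul, smul_eq_mul]
  ring

/-! ## The fermionic space and the phase space -/

/-- The Hilbert space `ℱ` of antisymmetric functions `ψ ∈ H¹(𝕋^{N̄}; ℂ)`. An element is stored as
the pair of `ψ ∈ L²` and its weak gradient in `L²` (which `ψ` determines), so that the norm
inherited from the surrounding Hilbert sum satisfies `‖ψ‖_ℱ² = ‖ψ‖²_{L²} + ‖∇ψ‖²_{L²}`. -/
def Fermion (N : ℕ) [NeZero N] :
    Submodule ℂ (WithLp 2 (L2 N × PiLp 2 fun _ : Fin (N ^ 3) × Fin 3 => L2 N)) where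
  carrier := {u | IsAntisymmetric u.fst ∧ ∀ j a, IsWeakPartial j a u.fst (u.snd (j, a))}
  zero_mem' := ⟨IsAntisymmetric.zero, fun j a => IsWeakPartial.zero j a⟩
  add_mem' h h' := ⟨h.1.add h'.1, fun j a => (h.2 j a).add (h'.2 j a)⟩
  smul_mem' c _ h := ⟨h.1.smul c, fun j a => (h.2 j a).smul c⟩

/-- The underlying function in `L²` of an element of `ℱ`. -/
def waveFn {N : ℕ} [NeZero N] (ψ : Fermion N) : L2 N := ψ.1.fst

/-- The weak gradient of an element of `ℱ`. -/
def weakGrad {N : ℕ} [NeZero N] (ψ : Fermion N) (j : Fin (N ^ 3)) (a : Fin 3) : L2 N :=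
  ψ.1.snd (j, a)

/-- The manifold `𝒱 = ℱ × 𝕋^Γ × (ℝ³)^Γ` of the states `X = (ψ, q, p)`. Its product topology is the
topology of the metric `‖ψ - ψ'‖_ℱ + |q - q'| + |p - p'|`. -/
abbrev State (N : ℕ) [NeZero N] := Fermion N × (Lattice N → Torus N) × (Lattice N → Space)

/-- The tangent space `𝒲 = ℱ ⊕ (ℝ³)^Γ ⊕ (ℝ³)^Γ`, with a norm equivalent to its Hilbert norm. -/
abbrev Tangent (N : ℕ) [NeZero N] := Fermion N × (Lattice N → Space) × (Lattice N → Space)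

/-- The point of `𝒱` reached from `X` by the displacement `Y`. -/
def displace {N : ℕ} [NeZero N] (X : State N) (Y : Tangent N) : State N :=
  (X.1 + Y.1, fun n => X.2.1 n + toTorus N (Y.2.1 n), X.2.2 + Y.2.2)

/-! ## Charge densities, the operator `G = (-Δ)⁻¹`, charge and energy -/

/-- The charge density `ρⁱ(x) = ∑_n σ(x - n - q(n))` of the ions. -/
def ionDensity {N : ℕ} [NeZero N] (σ : Torus N → ℝ) (q : Lattice N → Torus N) (x : Torus N) : ℝ :=
  ∑ n, σ (x - latticePoint N n - q n)

/-- The charge density of the electrons,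
`ρᵉ(x) = -e ∑_j ∫ |ψ(y_1, …, y_{j-1}, x, y_{j+1}, …, y_{N̄})|² ∏_{i ≠ j} dy_i`. -/
def electronDensity {N : ℕ} [NeZero N] (e : ℝ) (ψ : L2 N) (x : Torus N) : ℝ :=
  -e * ∑ j : Fin (N ^ 3), ∫ y : ({i : Fin (N ^ 3) // i ≠ j} → Torus N),
    ‖ψ (fun i => if h : i = j then x else y ⟨i, h⟩)‖ ^ 2

/-- The total charge density `ρ = ρⁱ + ρᵉ`. -/
def density {N : ℕ} [NeZero N] (e : ℝ) (σ : Torus N → ℝ) (X : State N) (x : Torus N) : ℝ :=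
  ionDensity σ X.2.1 x + electronDensity e (waveFn X.1) x

/-- The character `x ↦ e^{iξx}` of `𝕋` with `ξ = 2πk/N`. -/
def character (N : ℕ) (k : Fin 3 → ℤ) (x : Torus N) : ℂ := ∏ a, fourier (k a) (x a)

/-- The Fourier coefficient `N⁻³ ∫ f(x) e^{-iξx} dx`, `ξ = 2πk/N`. -/
def fourierCoefficient {N : ℕ} [NeZero N] (f : Torus N → ℝ) (k : Fin 3 → ℤ) : ℂ :=
  ((N : ℂ) ^ 3)⁻¹ * ∫ x, (f x : ℂ) * character N (-k) x

/-- `|ξ|²` for `ξ = 2πk/N`. -/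
def freqSq (N : ℕ) (k : Fin 3 → ℤ) : ℝ := ∑ a, (2 * Real.pi * (k a : ℝ) / (N : ℝ)) ^ 2

/-- The operator `G = (-Δ)⁻¹` on real functions on `𝕋`:
`(G f)(x) = ∑_{ξ ≠ 0} |ξ|⁻² f̂(ξ) e^{iξx}`, a real number since `f` is real. -/
def greenOp {N : ℕ} [NeZero N] (f : Torus N → ℝ) (x : Torus N) : ℝ :=
  (∑' k : {k : Fin 3 → ℤ // k ≠ 0},
    fourierCoefficient f k / (freqSq N k : ℂ) * character N k x).re

/-- The charge `Q(X) = ∫ |ψ|²`. -/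
def charge {N : ℕ} [NeZero N] (X : State N) : ℝ := ∫ x, ‖waveFn X.1 x‖ ^ 2

/-- The energy `E(X) = ½ ∫ |∇ψ|² + ½ (ρ, Gρ) + ∑_n |p(n)|² / (2M)`. -/
def energy {N : ℕ} [NeZero N] (e M : ℝ) (σ : Torus N → ℝ) (X : State N) : ℝ :=
  (1 / 2) * (∑ j, ∑ a, ∫ x, ‖weakGrad X.1 j a x‖ ^ 2)
    + (1 / 2) * (∫ x, density e σ X x * greenOp (density e σ X) x)
    + ∑ n, ‖X.2.2 n‖ ^ 2 / (2 * M)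

/-! ## The Hamiltonian system `Ẋ = J E'(X)` -/

/-- The matrix `J`: in the coordinates `(ψ₁, ψ₂, ϰ, π)`, where `ψ = ψ₁ + iψ₂`, it acts by
`J (ψ₁, ψ₂, ϰ, π) = (ψ₂ / 2, -ψ₁ / 2, π, -ϰ)`, and `ψ₂ / 2 - iψ₁ / 2 = -(i / 2) ψ`. -/
def sympl {N : ℕ} [NeZero N] (Y : Tangent N) : Tangent N :=
  (-(Complex.I / 2) • Y.1, Y.2.2, -Y.2.1)

/-- The scalar product of `𝒳 = L² ⊕ (ℝ³)^Γ ⊕ (ℝ³)^Γ`, with the real scalar product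
`Re ∫ ψ φ̄` on `L²`. -/
def pairing {N : ℕ} [NeZero N] (ψ : L2 N) (u v : Lattice N → Space) (Y : Tangent N) : ℝ :=
  (∫ x, ψ x * (starRingEnd ℂ) (waveFn Y.1 x)).re + ∑ n, inner ℝ (u n) (Y.2.1 n)
    + ∑ n, inner ℝ (v n) (Y.2.2 n)

/-- `Ẋ(t) = ℓ` in the dual of `𝒲`: the derivative at `t` of `⟨X(·), Y⟩` exists and is `ℓ(Y)` for
every `Y ∈ 𝒲`. Since `q` takes values in the torus, it is lifted to `(ℝ³)^Γ` near `t`. -/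
def HasVelocityAt {N : ℕ} [NeZero N] (X : ℝ → State N) (ℓ : Tangent N → ℝ) (t : ℝ) : Prop :=
  ∃ r : ℝ → Lattice N → Space,
    (∀ᶠ s in 𝓝 t, ∀ n, (X s).2.1 n = toTorus N (r s n)) ∧
    ∀ Y : Tangent N,
      HasDerivAt (fun s => pairing (waveFn (X s).1) (r s) (X s).2.2 Y) (ℓ Y) t

/-- `X ∈ C(ℝ, 𝒱)` solves `Ẋ = J E'(X)`: at every time `t` the energy has a (Fréchet) derivative
`E'(X(t)) ∈ 𝒲*`, and `⟨Ẋ(t), Y⟩ = ⟨J E'(X(t)), Y⟩ = -⟨E'(X(t)), J Y⟩` for every `Y ∈ 𝒲`. -/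
def IsSolution {N : ℕ} [NeZero N] (e M : ℝ) (σ : Torus N → ℝ) (X : ℝ → State N) : Prop :=
  Continuous X ∧ ∀ t, ∃ dE : Tangent N →L[ℝ] ℝ,
    HasFDerivAt (fun Y => energy e M σ (displace (X t) Y)) dE 0 ∧
    HasVelocityAt X (fun Y => -dE (sympl Y)) t

end Crystal

end

open MeasureTheory Filter Topology
open scoped ContDiff

noncomputable section

namespace Crystal

/-! ## Fourier series on the configuration torus -/

/-! Everything is read on the Fourier side. The characters form a Hilbert basis of L² of the
configuration torus. Weak derivatives become multiplication by iξ and antisymmetry of ψ becomes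
antisymmetry of its coefficients, so ℱ is the antisymmetric part of an ℓ² space with weight 1 +
|ξ|². The positions q are lifted from the torus to (ℝ³)^Γ, which turns the phase space into a Banach
space.

The system is ψ' = (i/2)Δψ + ieΦψ with Φ = ∑_j (Gρ)(x_j), q' = p/M, p' = force. Apart from Δ its
terms are tame, for three reasons. In dimension three ∑ (1 + |ξ|²)⁻² converges, so the one-particle
densities of ψ ∈ H¹ lie in L² and come from a bounded sesquilinear map (`tsum_corr_sq_le`). The
operator G gains two derivatives, so multiplication by Φ maps ℱ to itself
(`tsum_weight_potCoef_le`). Since σ is C², the ion density is differentiable in q with a Lipschitz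
derivative, as a map into ℓ² (`norm_translateSeq_taylor_le`, `norm_translateSeqDeriv_sub_le`). Hence
E is Fréchet differentiable with the explicit derivative `energyDeriv`. In the interaction picture
v(t) = e^{-itΔ/2}ψ(t) the system becomes an ODE whose field is bounded and Lipschitz on balls,
uniformly in time (`lipOnBalls_field`).

Existence. Picard–Lindelöf together with an a priori bound gives a global solution
(`exists_global_solution`). The bound comes from the conservation laws: the Coulomb energy is
nonnegative, so charge and energy control ψ in H¹ and p, and then q grows at most linearly.
Conservation of energy needs care because ψ is differentiable in time only weakly. The free flow
preserves the kinetic form, so that part can be differentiated along v. In the interaction energy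
the increment of ψ is tested only against a potential times ψ(s) + ψ(t), which lies in ℱ and
converges there (`hasDerivWithinAt_half_interaction`).

Uniqueness and conservation for arbitrary solutions. A solution satisfies the equations only in the
weak sense, so it is shown to come from the ODE (`IsSolution.exists_lift`). Integrating p/M gives a
global lift of q. Duhamel's formula gives a strongly differentiable v for which e^{itΔ/2}v solves
the same weak linear equation as ψ. The two coincide because the L² norm of their difference is
constant, by a chain rule for quadratic forms along weakly differentiable paths
(`hasDerivAt_half_form_of_weak`). Uniqueness for the ODE and conservation along its solutions then
carry over. -/

/-- The dual lattice of the configuration torus. -/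
abbrev Freq (N : ℕ) := Fin (N ^ 3) → Fin 3 → ℤ

/-- The characters of the configuration torus. -/
def chi {N : ℕ} (K : Freq N) (x : Config N) : ℂ := ∏ j, character N (K j) (x j)

/-- The frequency `2πm/N`. -/
def xi (N : ℕ) (m : ℤ) : ℝ := 2 * Real.pi * (m : ℝ) / (N : ℝ)

/-! ### Characters and classical partial derivatives -/

section Characters

variable {N : ℕ}

lemma character_add_freq (k l : Fin 3 → ℤ) (x : Torus N) :
    character N (k + l) x = character N k x * character N l x := by
  simp [character, Finset.prod_mul_distrib]

lemma character_add (k : Fin 3 → ℤ) (x y : Torus N) :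
    character N k (x + y) = character N k x * character N k y := by
  simp [character, Finset.prod_mul_distrib, fourier_apply, smul_add, AddCircle.toCircle_add]

lemma character_neg (k : Fin 3 → ℤ) (x : Torus N) :
    character N (-k) x = starRingEnd ℂ (character N k x) := by
  simp [character]

@[simp] lemma character_zero (x : Torus N) : character N 0 x = 1 := by simp [character]

@[simp] lemma norm_character (k : Fin 3 → ℤ) (x : Torus N) : ‖character N k x‖ = 1 := by
  rw [character, norm_prod]
  exact Finset.prod_eq_one fun a _ => by rw [fourier_apply]; exact Circle.norm_coe _

lemma continuous_character (k : Fin 3 → ℤ) : Continuous (character N k) := by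
  unfold character; fun_prop

lemma character_toTorus (k : Fin 3 → ℤ) (y : Fin 3 → ℝ) :
    character N k (toTorus N y) = Complex.exp (Complex.I * ∑ a, (xi N (k a) * y a : ℝ)) := by
  simp only [character, toTorus, fourier_coe_apply, xi]
  rw [← Complex.exp_sum, Complex.ofReal_sum, Finset.mul_sum]
  congr 1
  refine Finset.sum_congr rfl fun a _ => ?_
  push_cast; ring

lemma chi_add (K L : Freq N) (x : Config N) : chi (K + L) x = chi K x * chi L x := by
  simp [chi, Finset.prod_mul_distrib, character_add_freq]

lemma chi_neg (K : Freq N) (x : Config N) : chi (-K) x = starRingEnd ℂ (chi K x) := by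
  simp [chi, character_neg]

@[simp] lemma chi_zero (x : Config N) : chi 0 x = 1 := by simp [chi]

@[simp] lemma norm_chi (K : Freq N) (x : Config N) : ‖chi K x‖ = 1 := by
  simp [chi, norm_prod]

lemma continuous_chi (K : Freq N) : Continuous (chi K) := by
  unfold chi
  exact continuous_finsetProd _ fun j _ => (continuous_character _).comp (continuous_apply j)

lemma chi_single (j : Fin (N ^ 3)) (k : Fin 3 → ℤ) (x : Config N) :
    chi (Pi.single j k) x = character N k (x j) := by
  rw [chi, Finset.prod_eq_single j]
  · simp
  · intro i _ hi; simp [hi]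
  · simp

lemma chi_toConfig (K : Freq N) (y : Fin (N ^ 3) → Fin 3 → ℝ) :
    chi K (toConfig N y) =
      Complex.exp (Complex.I * ∑ j, ∑ a, (xi N (K j a) * y j a : ℝ)) := by
  simp only [chi, toConfig, character_toTorus]
  rw [← Complex.exp_sum, Complex.ofReal_sum, Finset.mul_sum]

lemma isSmooth_chi (K : Freq N) : IsSmooth N (chi K) := by
  simp only [IsSmooth, chi_toConfig]
  push_cast
  refine Complex.contDiff_exp.comp (contDiff_const.mul ?_)
  refine ContDiff.sum fun j _ => ContDiff.sum fun a _ => contDiff_const.mul ?_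
  exact Complex.ofRealCLM.contDiff.comp (contDiff_apply_apply ℝ ℝ j a)

lemma shift_toConfig (y : Fin (N ^ 3) → Fin 3 → ℝ) (j : Fin (N ^ 3)) (a : Fin 3) (s : ℝ) :
    shift (toConfig N y) j a s =
      toConfig N (y + s • (Pi.single j (Pi.single a 1) : Fin (N ^ 3) → Fin 3 → ℝ)) := by
  funext i b
  by_cases hi : i = j
  · subst hi
    by_cases hb : b = a
    · subst hb
      simp [shift, toConfig, toTorus]
    · simp [shift, toConfig, toTorus, hb]
  · simp [shift, toConfig, toTorus, hi]

lemma shift_eq_add (x : Config N) (j : Fin (N ^ 3)) (a : Fin 3) (s : ℝ) :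
    shift x j a s = x + Pi.single j (Pi.single a (s : AddCircle (N : ℝ))) := by
  funext i b
  by_cases hi : i = j
  · subst hi
    by_cases hb : b = a
    · subst hb; simp [shift]
    · simp [shift, hb]
  · simp [shift, hi]

lemma hasDerivAt_shift {η : Config N → ℂ} (h : ContDiff ℝ 1 fun y => η (toConfig N y))
    (j : Fin (N ^ 3)) (a : Fin 3) (y : Fin (N ^ 3) → Fin 3 → ℝ) (s : ℝ) :
    HasDerivAt (fun s : ℝ => η (shift (toConfig N y) j a s))
      (fderiv ℝ (fun y => η (toConfig N y)) (y + s • (Pi.single j (Pi.single a 1) : Fin (N ^ 3) → Fin 3 → ℝ))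
        (Pi.single j (Pi.single a 1))) s := by
  simp only [shift_toConfig]
  have hd : DifferentiableAt ℝ (fun y => η (toConfig N y))
    (y + s • (Pi.single j (Pi.single a 1) : Fin (N ^ 3) → Fin 3 → ℝ)) :=
    (h.differentiable (by simp)) _
  have h2 : HasDerivAt (fun s : ℝ => y + s • (Pi.single j (Pi.single a 1) :
      Fin (N ^ 3) → Fin 3 → ℝ)) (Pi.single j (Pi.single a 1)) s := by
    simpa using ((hasDerivAt_id s).smul_const
      (Pi.single j (Pi.single a 1) : Fin (N ^ 3) → Fin 3 → ℝ)).const_add y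
  exact hd.hasFDerivAt.comp_hasDerivAt s h2

lemma partialDeriv_eq_fderiv {η : Config N → ℂ} (h : ContDiff ℝ 1 fun y => η (toConfig N y))
    (j : Fin (N ^ 3)) (a : Fin 3) (y : Fin (N ^ 3) → Fin 3 → ℝ) :
    partialDeriv j a η (toConfig N y) =
      fderiv ℝ (fun y => η (toConfig N y)) y (Pi.single j (Pi.single a 1)) := by
  have := (hasDerivAt_shift h j a y 0).deriv
  simpa [partialDeriv] using this

lemma hasDerivAt_shift_partialDeriv {η : Config N → ℂ}
    (h : ContDiff ℝ 1 fun y => η (toConfig N y)) (j : Fin (N ^ 3)) (a : Fin 3) (x : Config N)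
    (s : ℝ) :
    HasDerivAt (fun s : ℝ => η (shift x j a s)) (partialDeriv j a η (shift x j a s)) s := by
  obtain ⟨y, rfl⟩ := toConfig_surj N x
  rw [shift_toConfig, partialDeriv_eq_fderiv h]
  exact hasDerivAt_shift h j a y s

lemma continuous_of_contDiff {η : Config N → ℂ} (h : ContDiff ℝ 1 fun y => η (toConfig N y)) :
    Continuous η :=
  (isQuotientMap_toConfig N).continuous_iff.2 h.continuous

lemma continuous_partialDeriv_of_contDiff {η : Config N → ℂ}
    (h : ContDiff ℝ 1 fun y => η (toConfig N y)) (j : Fin (N ^ 3)) (a : Fin 3) :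
    Continuous (partialDeriv j a η) := by
  refine (isQuotientMap_toConfig N).continuous_iff.2 ?_
  have : partialDeriv j a η ∘ toConfig N = fun y =>
      fderiv ℝ (fun y => η (toConfig N y)) y (Pi.single j (Pi.single a 1)) :=
    funext fun y => partialDeriv_eq_fderiv h j a y
  rw [this]
  exact (h.continuous_fderiv (by simp)).clm_apply continuous_const

lemma IsSmooth.contDiff_one {η : Config N → ℂ} (h : IsSmooth N η) :
    ContDiff ℝ 1 fun y => η (toConfig N y) :=
  ContDiff.of_le h (by exact_mod_cast le_top)

@[simp] lemma shift_zero (x : Config N) (j : Fin (N ^ 3)) (a : Fin 3) : shift x j a 0 = x := by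
  simp [shift]

lemma partialDeriv_chi (K : Freq N) (j : Fin (N ^ 3)) (a : Fin 3) (x : Config N) :
    partialDeriv j a (chi K) x = Complex.I * xi N (K j a) * chi K x := by
  have hs : ∀ s : ℝ, chi K (shift x j a s) =
      chi K x * Complex.exp (Complex.I * (xi N (K j a) * s)) := by
    intro s
    obtain ⟨y, rfl⟩ := toConfig_surj N x
    rw [shift_toConfig, chi_toConfig, chi_toConfig, ← Complex.exp_add, ← mul_add]
    congr 2
    have : ∑ i, ∑ b, xi N (K i b) *
        (y + s • (Pi.single j (Pi.single a 1) : Fin (N ^ 3) → Fin 3 → ℝ)) i b =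
        (∑ i, ∑ b, xi N (K i b) * y i b) + xi N (K j a) * s := by
      simp only [Pi.add_apply, Pi.smul_apply, mul_add, Finset.sum_add_distrib, smul_eq_mul]
      congr 1
      rw [Finset.sum_eq_single j, Finset.sum_eq_single a]
      · simp
      · intro b _ hb; simp [hb]
      · simp
      · intro i _ hi; simp [hi]
      · simp
    rw [← Complex.ofReal_mul]
    exact_mod_cast this
  simp only [partialDeriv, hs]
  have h1 : HasDerivAt (fun s : ℝ => Complex.I * (xi N (K j a) * (s : ℂ)))
      (Complex.I * (xi N (K j a) * 1)) 0 :=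
    ((hasDerivAt_id (0 : ℝ)).ofReal_comp.const_mul _).const_mul _
  have h2 := (h1.cexp.const_mul (chi K x)).deriv
  rw [h2]
  simp
  ring

end Characters

/-! ### Integration by parts on the configuration torus -/

section Integration

variable {N : ℕ} [NeZero N]

lemma integral_shift (f : Config N → ℂ) (j : Fin (N ^ 3)) (a : Fin 3) (s : ℝ) :
    ∫ x, f (shift x j a s) = ∫ x, f x := by
  simp only [shift_eq_add, add_comm _ (Pi.single j _)]
  exact integral_add_left_eq_self f _

/-- By translation invariance the integral of the shifted function does not depend on the shift.
Differentiating it under the integral sign gives zero; the continuous derivative is bounded on the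
compact torus, so constants dominate. -/
lemma integral_partialDeriv {f : Config N → ℂ} (h : ContDiff ℝ 1 fun y => f (toConfig N y))
    (j : Fin (N ^ 3)) (a : Fin 3) : ∫ x, partialDeriv j a f x = 0 := by
  have hc := continuous_partialDeriv_of_contDiff h j a
  obtain ⟨C, hC⟩ := isCompact_univ.exists_bound_of_continuousOn hc.continuousOn
  have hsh : ∀ s, Continuous fun x : Config N => shift x j a s := fun s => by
    simp only [shift_eq_add]; fun_prop
  have hf := continuous_of_contDiff h
  have hint : ∀ {g : Config N → ℂ}, Continuous g → Integrable g := fun hg =>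
    hg.integrable_of_hasCompactSupport (HasCompactSupport.of_compactSpace _)
  have key := (hasDerivAt_integral_of_dominated_loc_of_deriv_le
    (μ := (volume : Measure (Config N))) (F := fun s x => f (shift x j a s))
    (F' := fun s x => partialDeriv j a f (shift x j a s)) (x₀ := (0 : ℝ)) (s := Set.univ)
    (bound := fun _ => C) univ_mem
    (Eventually.of_forall fun s => (hf.comp (hsh s)).aestronglyMeasurable)
    (hint (hf.comp (hsh 0))) (hc.comp (hsh 0)).aestronglyMeasurable
    (Eventually.of_forall fun x s _ => hC _ (Set.mem_univ _)) (integrable_const C)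
    (Eventually.of_forall fun x s _ => hasDerivAt_shift_partialDeriv h j a x s)).2
  simp only [integral_shift, shift_zero] at key
  exact key.unique (hasDerivAt_const 0 _)

lemma integral_mul_partialDeriv {f g : Config N → ℂ}
    (hf : ContDiff ℝ 1 fun y => f (toConfig N y)) (hg : ContDiff ℝ 1 fun y => g (toConfig N y))
    (j : Fin (N ^ 3)) (a : Fin 3) :
    ∫ x, f x * partialDeriv j a g x = -∫ x, partialDeriv j a f x * g x := by
  have hint : ∀ {g : Config N → ℂ}, Continuous g → Integrable g := fun hg =>
    hg.integrable_of_hasCompactSupport (HasCompactSupport.of_compactSpace _)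
  have h0 := integral_partialDeriv (f := fun x => f x * g x) (hf.mul hg) j a
  have h1 : ∀ x, partialDeriv j a (fun x => f x * g x) x =
      partialDeriv j a f x * g x + f x * partialDeriv j a g x := by
    intro x
    have h1 := hasDerivAt_shift_partialDeriv hf j a x 0
    have h2 := hasDerivAt_shift_partialDeriv hg j a x 0
    have h3 := (h1.mul h2).deriv
    simp only [shift_zero] at h3
    exact h3
  simp only [h1] at h0
  rw [integral_add] at h0
  · linear_combination h0
  · exact hint ((continuous_partialDeriv_of_contDiff hf j a).mul (continuous_of_contDiff hg))
  · exact hint ((continuous_of_contDiff hf).mul (continuous_partialDeriv_of_contDiff hg j a))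

/-- Derivatives integrate to zero, and a nontrivial character is an eigenfunction of some partial
derivative with nonzero eigenvalue. -/
lemma integral_chi {K : Freq N} (hK : K ≠ 0) : ∫ x, chi K x = 0 := by
  obtain ⟨j, hj⟩ := Function.ne_iff.1 hK
  obtain ⟨a, ha⟩ := Function.ne_iff.1 hj
  have h := integral_partialDeriv (isSmooth_chi K).contDiff_one j a
  simp only [partialDeriv_chi] at h
  rw [integral_const_mul] at h
  have hx : xi N (K j a) ≠ 0 := by
    have : (K j a : ℝ) ≠ 0 := by exact_mod_cast ha
    have hN : (N : ℝ) ≠ 0 := by exact_mod_cast NeZero.ne N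
    have := Real.pi_ne_zero
    unfold xi; positivity
  simpa [hx] using h

/-- The volume of the configuration torus. -/
def vol (N : ℕ) : ℝ := ((N : ℝ) ^ 3) ^ (N ^ 3)

lemma vol_pos : 0 < vol N := by
  have : (0 : ℝ) < N := by exact_mod_cast Nat.pos_of_ne_zero (NeZero.ne N)
  unfold vol; positivity

lemma measureReal_univ_config : (volume : Measure (Config N)).real Set.univ = vol N := by
  have h1 : (volume : Measure (Torus N)) Set.univ = ENNReal.ofReal N ^ 3 := by
    rw [volume_pi, Measure.pi_univ]; simp [AddCircle.measure_univ]
  rw [Measure.real, volume_pi, Measure.pi_univ]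
  simp [h1, vol]

end Integration

/-! ### The Hilbert basis of characters; weak derivatives and antisymmetry in coefficients -/

section Basis

variable {N : ℕ}

/-- A character as a continuous map. -/
def chiMap (K : Freq N) : C(Config N, ℂ) := ⟨chi K, continuous_chi K⟩

@[simp] lemma chiMap_apply (K : Freq N) (x : Config N) : chiMap K x = chi K x := rfl

/-- The star algebra of trigonometric polynomials. -/
def chiAlgebra (N : ℕ) : StarSubalgebra ℂ C(Config N, ℂ) where
  toSubalgebra := Algebra.adjoin ℂ (Set.range chiMap)
  star_mem' := by
    change Algebra.adjoin ℂ (Set.range chiMap) ≤ star (Algebra.adjoin ℂ (Set.range chiMap))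
    refine Algebra.adjoin_le ?_
    rintro _ ⟨K, rfl⟩
    refine Algebra.subset_adjoin ⟨-K, ?_⟩
    ext x
    simp [chi_neg]

lemma chiAlgebra_coe :
    (chiAlgebra N).toSubalgebra.toSubmodule = Submodule.span ℂ (Set.range (chiMap (N := N))) := by
  apply Algebra.adjoin_eq_span_of_subset
  refine .trans (fun x ↦ Submonoid.closure_induction (fun _ ↦ id) ⟨0, ?_⟩ ?_) Submodule.subset_span
  · ext z; simp
  · rintro _ _ _ _ ⟨m, rfl⟩ ⟨n, rfl⟩
    exact ⟨m + n, by ext z; simp [chi_add]⟩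

/-- Stone–Weierstrass. Configurations that differ in one real coordinate are separated by the first
character of that coordinate, which is injective on the circle. -/
lemma span_chiMap_closure [NeZero N] :
    (Submodule.span ℂ (Set.range (chiMap (N := N)))).topologicalClosure = ⊤ := by
  have hsep : (chiAlgebra N).SeparatesPoints := by
    intro x y hxy
    obtain ⟨j, hj⟩ := Function.ne_iff.1 hxy
    obtain ⟨a, ha⟩ := Function.ne_iff.1 hj
    refine ⟨_, ⟨chiMap (Pi.single j (Pi.single a 1)),
      Algebra.subset_adjoin ⟨Pi.single j (Pi.single a 1), rfl⟩, rfl⟩, ?_⟩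
    have key : ∀ z : Config N, chi (Pi.single j (Pi.single a 1)) z = fourier 1 (z j a) := by
      intro z
      rw [chi_single, character, Finset.prod_eq_single a]
      · simp
      · intro b _ hb; simp [hb]
      · simp
    simp only [chiMap, ContinuousMap.coe_mk, key, fourier_one]
    intro h
    have hN : (N : ℝ) ≠ 0 := by exact_mod_cast NeZero.ne N
    exact ha (AddCircle.injective_toCircle hN (Subtype.coe_injective h))
  have h := ContinuousMap.starSubalgebra_topologicalClosure_eq_top_of_separatesPoints _ hsep
  rw [← chiAlgebra_coe]
  exact congr_arg (Subalgebra.toSubmodule <| StarSubalgebra.toSubalgebra ·) h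

variable [NeZero N]

/-- A continuous function as an element of `L²`. -/
def contL2 (f : C(Config N, ℂ)) : L2 N := ContinuousMap.toLp 2 volume ℂ f

lemma coeFn_contL2 (f : C(Config N, ℂ)) : contL2 f =ᵐ[volume] f :=
  ContinuousMap.coeFn_toLp (p := 2) (𝕜 := ℂ) volume f

lemma inner_contL2 (f : C(Config N, ℂ)) (ψ : L2 N) :
    inner ℂ (contL2 f) ψ = ∫ x, ψ x * starRingEnd ℂ (f x) := by
  rw [L2.inner_def]
  refine integral_congr_ae ?_
  filter_upwards [coeFn_contL2 f] with x hx
  rw [hx, RCLike.inner_apply]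

/-- The normalised characters. -/
def chiL2 (K : Freq N) : L2 N := ((Real.sqrt (vol N))⁻¹ : ℂ) • contL2 (chiMap K)

lemma inner_chiL2 (K : Freq N) (ψ : L2 N) :
    inner ℂ (chiL2 K) ψ = ((Real.sqrt (vol N))⁻¹ : ℂ) * ∫ x, ψ x * chi (-K) x := by
  rw [chiL2, inner_smul_left, inner_contL2]
  simp [chi_neg]

lemma sqrt_vol_ne_zero : ((Real.sqrt (vol N) : ℝ) : ℂ) ≠ 0 := by
  exact_mod_cast (Real.sqrt_pos.2 vol_pos).ne'

lemma sqrt_vol_mul_self : ((Real.sqrt (vol N) : ℝ) : ℂ) * (Real.sqrt (vol N) : ℝ) = vol N := by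
  exact_mod_cast Real.mul_self_sqrt vol_pos.le

lemma integral_contL2_mul_chi (f : C(Config N, ℂ)) (K : Freq N) :
    ∫ x, contL2 f x * chi K x = ∫ x, f x * chi K x := by
  refine integral_congr_ae ?_
  filter_upwards [coeFn_contL2 f] with x hx
  rw [hx]

lemma orthonormal_chiL2 : Orthonormal ℂ (chiL2 (N := N)) := by
  classical
  rw [orthonormal_iff_ite]
  intro K L
  rw [chiL2, chiL2, inner_smul_left, inner_smul_right, inner_contL2]
  have h1 : ∫ x, contL2 (chiMap L) x * starRingEnd ℂ (chiMap K x) = ∫ x, chi (L - K) x := by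
    refine integral_congr_ae ?_
    filter_upwards [coeFn_contL2 (chiMap L)] with x hx
    rw [hx, sub_eq_add_neg, chi_add, chi_neg]; rfl
  rw [h1]
  have h0 := sqrt_vol_ne_zero (N := N)
  split_ifs with h
  · subst h
    have : ∫ x : Config N, chi (K - K) x = (vol N : ℂ) := by
      simp [measureReal_univ_config]
    rw [this, ← sqrt_vol_mul_self]
    simp
    field_simp
  · rw [integral_chi (sub_ne_zero.2 (Ne.symm h))]; simp

lemma span_chiL2_closure :
    (Submodule.span ℂ (Set.range (chiL2 (N := N)))).topologicalClosure = ⊤ := by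
  have h : (Submodule.span ℂ (Set.range fun K : Freq N => contL2 (chiMap K))).topologicalClosure
      = ⊤ := by
    have := (ContinuousMap.toLp_denseRange ℂ (volume : Measure (Config N)) ℂ
      (p := 2) (by simp)).topologicalClosure_map_submodule (span_chiMap_closure (N := N))
    rw [Submodule.map_span] at this
    rw [← this, ← Set.range_comp]
    rfl
  rw [← h]
  congr 1
  apply le_antisymm
  · rw [Submodule.span_le]
    rintro _ ⟨K, rfl⟩
    exact Submodule.smul_mem _ _ (Submodule.subset_span ⟨K, rfl⟩)
  · rw [Submodule.span_le]
    rintro _ ⟨K, rfl⟩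
    have : contL2 (chiMap K) = ((Real.sqrt (vol N) : ℝ) : ℂ) • chiL2 K := by
      rw [chiL2, smul_smul, mul_inv_cancel₀ sqrt_vol_ne_zero, one_smul]
    simp only [SetLike.mem_coe]
    rw [this]
    exact Submodule.smul_mem _ _ (Submodule.subset_span ⟨K, rfl⟩)

/-- The Hilbert basis of normalised characters. -/
def chiBasis (N : ℕ) [NeZero N] : HilbertBasis (Freq N) ℂ (L2 N) :=
  HilbertBasis.mk orthonormal_chiL2 span_chiL2_closure.ge

/-- The Fourier coefficients of `ψ ∈ L²`. -/
def coef (ψ : L2 N) (K : Freq N) : ℂ := (chiBasis N).repr ψ K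

lemma coef_eq_inner (ψ : L2 N) (K : Freq N) : coef ψ K = inner ℂ (chiL2 K) ψ := by
  rw [coef, HilbertBasis.repr_apply_apply, chiBasis, HilbertBasis.coe_mk]

lemma coef_eq_integral (ψ : L2 N) (K : Freq N) :
    coef ψ K = ((Real.sqrt (vol N))⁻¹ : ℂ) * ∫ x, ψ x * chi (-K) x := by
  rw [coef_eq_inner, inner_chiL2]

@[simp] lemma coef_add (ψ φ : L2 N) (K : Freq N) : coef (ψ + φ) K = coef ψ K + coef φ K := by
  simp [coef]

@[simp] lemma coef_sub (ψ φ : L2 N) (K : Freq N) : coef (ψ - φ) K = coef ψ K - coef φ K := by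
  simp [coef]

@[simp] lemma coef_smul (c : ℂ) (ψ : L2 N) (K : Freq N) : coef (c • ψ) K = c * coef ψ K := by
  simp [coef]

lemma continuous_coef (K : Freq N) : Continuous fun ψ : L2 N => coef ψ K := by
  simp only [coef_eq_inner]; fun_prop

lemma ext_coef {ψ φ : L2 N} (h : ∀ K, coef ψ K = coef φ K) : ψ = φ :=
  (chiBasis N).repr.injective (lp.ext (funext h))

lemma hasSum_coef_mul (ψ φ : L2 N) :
    HasSum (fun K => starRingEnd ℂ (coef ψ K) * coef φ K) (inner ℂ ψ φ) := by
  refine ((chiBasis N).hasSum_inner_mul_inner ψ φ).congr_fun fun K => ?_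
  rw [coef_eq_inner, coef_eq_inner, chiBasis, HilbertBasis.coe_mk, inner_conj_symm]

lemma hasSum_coef_sq (ψ : L2 N) : HasSum (fun K => ‖coef ψ K‖ ^ 2) (‖ψ‖ ^ 2) := by
  have h := hasSum_coef_mul ψ ψ
  rw [inner_self_eq_norm_sq_to_K] at h
  have h2 := Complex.hasSum_re h
  convert h2 using 1
  · funext K
    rw [← Complex.normSq_eq_conj_mul_self, Complex.ofReal_re, Complex.normSq_eq_norm_sq]
  · norm_cast

lemma exists_coef {c : Freq N → ℂ} (hc : Summable fun K => ‖c K‖ ^ 2) :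
    ∃ ψ : L2 N, ∀ K, coef ψ K = c K := by
  have hm : Memℓp c 2 := by
    refine memℓp_gen ?_
    simpa using hc
  refine ⟨(chiBasis N).repr.symm ⟨c, hm⟩, fun K => ?_⟩
  simp [coef]

/-! ### Weak derivatives -/

omit [NeZero N] in
lemma partialDeriv_conj {η : Config N → ℂ} (hη : IsSmooth N η) (j : Fin (N ^ 3)) (a : Fin 3)
    (x : Config N) :
    partialDeriv j a (fun x => starRingEnd ℂ (η x)) x = starRingEnd ℂ (partialDeriv j a η x) := by
  have h := (Complex.conjCLE.toContinuousLinearMap.hasFDerivAt).comp_hasDerivAt 0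
    (hasDerivAt_shift_partialDeriv hη.contDiff_one j a x 0)
  simpa [partialDeriv, Function.comp_def] using h.deriv

omit [NeZero N] in
lemma IsSmooth.conj {η : Config N → ℂ} (hη : IsSmooth N η) :
    IsSmooth N fun x => starRingEnd ℂ (η x) :=
  Complex.conjCLE.toContinuousLinearMap.contDiff.comp hη

/-- One direction tests with characters. In the other, both sides are L² scalar products with a
smooth function, and Parseval reduces the claim to coefficients; on the smooth side the factor iξ
comes from classical integration by parts. -/
lemma isWeakPartial_iff {j : Fin (N ^ 3)} {a : Fin 3} {ψ g : L2 N} :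
    IsWeakPartial j a ψ g ↔ ∀ K, coef g K = Complex.I * xi N (K j a) * coef ψ K := by
  constructor
  · intro h K
    have h1 := h _ (isSmooth_chi (-K))
    simp only [partialDeriv_chi] at h1
    rw [coef_eq_integral, coef_eq_integral]
    have h2 : ∫ x, ψ x * (Complex.I * xi N ((-K) j a) * chi (-K) x) =
        -(Complex.I * xi N (K j a)) * ∫ x, ψ x * chi (-K) x := by
      rw [← integral_const_mul]
      refine integral_congr_ae (Eventually.of_forall fun x => ?_)
      simp [xi]; ring
    rw [h2] at h1
    linear_combination (((Real.sqrt (vol N))⁻¹ : ℂ)) * h1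
  · intro h η hη
    -- The weak formulation is bilinear but the scalar product is conjugate linear in its first
    -- slot, so the test function enters conjugated.
    set f : C(Config N, ℂ) := ⟨fun x => starRingEnd ℂ (η x), hη.conj.continuous⟩ with hf
    set g' : C(Config N, ℂ) := ⟨partialDeriv j a fun x => starRingEnd ℂ (η x),
      hη.conj.continuous_partialDeriv j a⟩ with hg'
    have e1 : ∫ x, ψ x * partialDeriv j a η x = inner ℂ (contL2 g') ψ := by
      rw [inner_contL2]
      simp [hg', partialDeriv_conj hη]
    have e2 : ∫ x, g x * η x = inner ℂ (contL2 f) g := by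
      rw [inner_contL2]
      simp [hf]
    have hc : ∀ K, coef (contL2 g') K = Complex.I * xi N (K j a) * coef (contL2 f) K := by
      intro K
      rw [coef_eq_integral, coef_eq_integral, integral_contL2_mul_chi, integral_contL2_mul_chi]
      have h1 := integral_mul_partialDeriv (f := fun x => starRingEnd ℂ (η x)) hη.conj.contDiff_one
        (isSmooth_chi (-K)).contDiff_one j a
      have h2 : ∫ x, starRingEnd ℂ (η x) * partialDeriv j a (chi (-K)) x =
          -(Complex.I * xi N (K j a)) * ∫ x, starRingEnd ℂ (η x) * chi (-K) x := by
        rw [← integral_const_mul]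
        refine integral_congr_ae (Eventually.of_forall fun x => ?_)
        simp [partialDeriv_chi, xi]; ring
      rw [h2] at h1
      simp only [hg', hf, ContinuousMap.coe_mk]
      linear_combination (((Real.sqrt (vol N))⁻¹ : ℂ)) * h1
    rw [e1, e2]
    have s1 := hasSum_coef_mul (contL2 g') ψ
    have s2 := (hasSum_coef_mul (contL2 f) g).neg
    refine s1.unique (s2.congr_fun fun K => ?_)
    rw [hc, h]
    simp
    ring

/-! ### Antisymmetry -/

omit [NeZero N] in
lemma chi_perm (K : Freq N) (x : Config N) (π : Equiv.Perm (Fin (N ^ 3))) :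
    chi (fun j => K (π j)) (fun j => x (π j)) = chi K x :=
  Equiv.prod_comp π fun j => character N (K j) (x j)

lemma integral_comp_perm {f : Config N → ℂ} (hf : AEStronglyMeasurable f)
    (π : Equiv.Perm (Fin (N ^ 3))) : ∫ x : Config N, f (fun j => x (π j)) = ∫ x, f x := by
  have hmp := measurePreserving_perm N π
  conv_rhs => rw [← hmp.map_eq]
  exact (integral_map hmp.measurable.aemeasurable (by rwa [hmp.map_eq])).symm

/-- Characters are invariant under a simultaneous permutation of positions and frequencies, so
permuting the variables of ψ permutes its coefficients. -/
lemma isAntisymmetric_iff {ψ : L2 N} :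
    IsAntisymmetric ψ ↔ ∀ (π : Equiv.Perm (Fin (N ^ 3))) (K : Freq N),
      coef ψ (fun j => K (π j)) = ((Equiv.Perm.sign π : ℤ) : ℂ) * coef ψ K := by
  have hco : ∀ (π : Equiv.Perm (Fin (N ^ 3))) (K : Freq N),
      coef (Lp.compMeasurePreserving _ (measurePreserving_perm N π) ψ) K =
        coef ψ (fun j => K (π j)) := by
    intro π K
    rw [coef_eq_integral, coef_eq_integral]
    congr 1
    have hmp := measurePreserving_perm N π
    have h1 := integral_comp_perm (f := fun x => ψ x * chi (-fun j => K (π j)) x)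
      ((Lp.aestronglyMeasurable ψ).mul (continuous_chi _).aestronglyMeasurable) π
    rw [← h1]
    refine integral_congr_ae ?_
    filter_upwards [Lp.coeFn_compMeasurePreserving ψ hmp] with x hx
    rw [hx, ← chi_perm (-K) x π]
    rfl
  constructor
  · intro h π K
    rw [← hco, ← coef_smul]
    congr 1
    refine Lp.ext ?_
    filter_upwards [Lp.coeFn_compMeasurePreserving ψ (measurePreserving_perm N π), h π,
      Lp.coeFn_smul ((Equiv.Perm.sign π : ℤ) : ℂ) ψ] with x h1 h2 h3
    rw [h1, h3]
    exact h2
  · intro h π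
    have he : Lp.compMeasurePreserving _ (measurePreserving_perm N π) ψ =
        ((Equiv.Perm.sign π : ℤ) : ℂ) • ψ := ext_coef fun K => by rw [hco, h, coef_smul]
    filter_upwards [Lp.coeFn_compMeasurePreserving ψ (measurePreserving_perm N π),
      Lp.coeFn_smul ((Equiv.Perm.sign π : ℤ) : ℂ) ψ] with x h1 h3
    rw [he, h3] at h1
    exact h1.symm

end Basis

/-! ### ℱ as an antisymmetric weighted ℓ² space -/

section FermionFourier

variable {N : ℕ}

/-- The Sobolev weight `1 + |ξ_K|²`. -/
def weight (K : Freq N) : ℝ := 1 + ∑ j, freqSq N (K j)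

lemma freqSq_eq (k : Fin 3 → ℤ) : freqSq N k = ∑ a, xi N (k a) ^ 2 := rfl

lemma freqSq_nonneg (k : Fin 3 → ℤ) : 0 ≤ freqSq N k :=
  Finset.sum_nonneg fun _ _ => sq_nonneg _

lemma one_le_weight (K : Freq N) : 1 ≤ weight K := by
  have : 0 ≤ ∑ j, freqSq N (K j) := Finset.sum_nonneg fun _ _ => freqSq_nonneg _
  unfold weight; linarith

lemma weight_pos (K : Freq N) : 0 < weight K := one_pos.trans_le (one_le_weight K)

lemma weight_comp_perm (K : Freq N) (π : Equiv.Perm (Fin (N ^ 3))) :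
    weight (fun j => K (π j)) = weight K := by
  unfold weight
  rw [Equiv.sum_comp π fun j => freqSq N (K j)]

variable [NeZero N]

/-- The inclusion `ℱ → L²` as a continuous linear map. -/
def waveL (N : ℕ) [NeZero N] : Fermion N →L[ℂ] L2 N :=
  (WithLp.fstL 2 ℂ (L2 N) (PiLp 2 fun _ : Fin (N ^ 3) × Fin 3 => L2 N)).comp (Fermion N).subtypeL

/-- The Fourier coefficients of `ψ ∈ ℱ`. -/
def fc (ψ : Fermion N) (K : Freq N) : ℂ := coef (waveFn ψ) K

@[simp] lemma fc_add (ψ φ : Fermion N) (K : Freq N) : fc (ψ + φ) K = fc ψ K + fc φ K :=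
  coef_add _ _ _

@[simp] lemma fc_sub (ψ φ : Fermion N) (K : Freq N) : fc (ψ - φ) K = fc ψ K - fc φ K :=
  coef_sub _ _ _

@[simp] lemma fc_smul (c : ℂ) (ψ : Fermion N) (K : Freq N) : fc (c • ψ) K = c * fc ψ K :=
  coef_smul _ _ _

@[simp] lemma fc_real_smul (c : ℝ) (ψ : Fermion N) (K : Freq N) : fc (c • ψ) K = c * fc ψ K := by
  rw [← fc_smul, ← smul_one_smul ℂ c ψ, Complex.real_smul, mul_one]

lemma coef_weakGrad (ψ : Fermion N) (j : Fin (N ^ 3)) (a : Fin 3) (K : Freq N) :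
    coef (weakGrad ψ j a) K = Complex.I * xi N (K j a) * fc ψ K :=
  isWeakPartial_iff.1 (ψ.2.2 j a) K

lemma fc_perm (ψ : Fermion N) (π : Equiv.Perm (Fin (N ^ 3))) (K : Freq N) :
    fc ψ (fun j => K (π j)) = ((Equiv.Perm.sign π : ℤ) : ℂ) * fc ψ K :=
  isAntisymmetric_iff.1 ψ.2.1 π K

/-- An element of ℱ also stores its gradient, but the coefficients of the gradient are determined by
those of ψ. -/
lemma ext_fc {ψ φ : Fermion N} (h : ∀ K, fc ψ K = fc φ K) : ψ = φ := by
  apply Subtype.ext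
  have h1 : ψ.1.fst = φ.1.fst := ext_coef h
  have h2 : ψ.1.snd = φ.1.snd := by
    ext ja : 1
    refine ext_coef fun K => ?_
    have e1 := coef_weakGrad ψ ja.1 ja.2 K
    have e2 := coef_weakGrad φ ja.1 ja.2 K
    rw [h K, ← e2] at e1
    exact e1
  exact (WithLp.ofLp_injective 2) (Prod.ext h1 h2)

/-- Membership in ℱ is a family of equations between Fourier coefficients, each continuous in the
surrounding Hilbert space, so ℱ is closed. Completeness serves Picard iteration, vector-valued
integrals and Banach–Steinhaus. -/
instance : CompleteSpace (Fermion N) := by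
  have hf : Continuous fun u : WithLp 2 (L2 N × PiLp 2 fun _ : Fin (N ^ 3) × Fin 3 => L2 N) =>
      u.fst := (WithLp.fstL 2 ℂ (L2 N) (PiLp 2 fun _ : Fin (N ^ 3) × Fin 3 => L2 N)).continuous
  have hs : ∀ ja, Continuous fun u : WithLp 2 (L2 N × PiLp 2 fun _ : Fin (N ^ 3) × Fin 3 => L2 N) =>
      u.snd ja := fun ja => (PiLp.continuous_apply 2 _ ja).comp
        (WithLp.sndL 2 ℂ (L2 N) (PiLp 2 fun _ : Fin (N ^ 3) × Fin 3 => L2 N)).continuous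
  suffices h : IsClosed (Fermion N : Set (WithLp 2 (L2 N × PiLp 2 fun _ : Fin (N ^ 3) × Fin 3 => L2 N)))
    from h.completeSpace_coe
  have : (Fermion N : Set (WithLp 2 (L2 N × PiLp 2 fun _ : Fin (N ^ 3) × Fin 3 => L2 N))) =
      {u | (∀ (π : Equiv.Perm (Fin (N ^ 3))) (K : Freq N),
        coef u.fst (fun j => K (π j)) = ((Equiv.Perm.sign π : ℤ) : ℂ) * coef u.fst K) ∧
        ∀ j a K, coef (u.snd (j, a)) K = Complex.I * xi N (K j a) * coef u.fst K} := by
    ext u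
    change (IsAntisymmetric u.fst ∧ ∀ j a, IsWeakPartial j a u.fst (u.snd (j, a))) ↔ _
    simp only [isAntisymmetric_iff, isWeakPartial_iff, Set.mem_ofPred_eq]
  rw [this]
  rw [Set.ofPred_and]
  refine IsClosed.inter ?_ ?_
  · simp only [Set.ofPred_forall]
    exact isClosed_iInter fun π => isClosed_iInter fun K =>
      isClosed_eq ((continuous_coef _).comp hf) (continuous_const.mul ((continuous_coef _).comp hf))
  · simp only [Set.ofPred_forall]
    exact isClosed_iInter fun j => isClosed_iInter fun a => isClosed_iInter fun K =>
      isClosed_eq ((continuous_coef _).comp (hs _))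
        (continuous_const.mul ((continuous_coef _).comp hf))

lemma inner_fermion (ψ φ : Fermion N) :
    inner ℂ ψ φ = inner ℂ (waveFn ψ) (waveFn φ) +
      ∑ j, ∑ a, inner ℂ (weakGrad ψ j a) (weakGrad φ j a) := by
  rw [Submodule.coe_inner, WithLp.prod_inner_apply, PiLp.inner_apply, Fintype.sum_prod_type]
  rfl

lemma sum_inner_weakGrad (ψ φ : Fermion N) :
    ∑ j, ∑ a, inner ℂ (weakGrad ψ j a) (weakGrad φ j a) =
      inner ℂ ψ φ - inner ℂ (waveFn ψ) (waveFn φ) := by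
  rw [inner_fermion]; ring

lemma hasSum_inner_fermion (ψ φ : Fermion N) :
    HasSum (fun K => weight K * (starRingEnd ℂ (fc ψ K) * fc φ K)) (inner ℂ ψ φ) := by
  rw [inner_fermion]
  have h1 := hasSum_coef_mul (waveFn ψ) (waveFn φ)
  have h2 := hasSum_sum (s := Finset.univ) fun j _ => hasSum_sum (s := Finset.univ) fun a _ =>
    hasSum_coef_mul (weakGrad ψ j a) (weakGrad φ j a)
  refine (h1.add h2).congr_fun fun K => ?_
  simp only [coef_weakGrad, weight, freqSq_eq]
  push_cast
  rw [add_mul, one_mul]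
  congr 1
  rw [Finset.sum_mul]
  refine Finset.sum_congr rfl fun j _ => ?_
  rw [Finset.sum_mul]
  refine Finset.sum_congr rfl fun a _ => ?_
  simp
  linear_combination ((xi N (K j a) : ℂ) ^ 2 * (starRingEnd ℂ (fc ψ K) * fc φ K)) * Complex.I_sq

lemma hasSum_fc_sq (ψ : Fermion N) :
    HasSum (fun K => weight K * ‖fc ψ K‖ ^ 2) (‖ψ‖ ^ 2) := by
  have h := hasSum_inner_fermion ψ ψ
  have h0 : inner ℂ ψ ψ = (‖ψ‖ : ℂ) ^ 2 := inner_self_eq_norm_sq_to_K (𝕜 := ℂ) ψ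
  rw [h0] at h
  have h2 := Complex.hasSum_re h
  convert h2 using 1
  · funext K
    rw [← Complex.normSq_eq_conj_mul_self, ← Complex.ofReal_mul, Complex.ofReal_re,
      Complex.normSq_eq_norm_sq]
  · norm_cast

/-- Elements of ℱ are built by prescribing coefficients; both multiplication by a potential and the
free evolution are obtained this way. -/
lemma exists_fermion {c : Freq N → ℂ} (hc : Summable fun K => weight K * ‖c K‖ ^ 2)
    (ha : ∀ (π : Equiv.Perm (Fin (N ^ 3))) (K : Freq N),
      c (fun j => K (π j)) = ((Equiv.Perm.sign π : ℤ) : ℂ) * c K) :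
    ∃ ψ : Fermion N, ∀ K, fc ψ K = c K := by
  have h0 : Summable fun K => ‖c K‖ ^ 2 := hc.of_nonneg_of_le (fun _ => by positivity)
    fun K => le_mul_of_one_le_left (by positivity) (one_le_weight K)
  have h1 : ∀ (j : Fin (N ^ 3)) (a : Fin 3),
      Summable fun K => ‖Complex.I * xi N (K j a) * c K‖ ^ 2 := fun j a => by
    refine hc.of_nonneg_of_le (fun _ => by positivity) fun K => ?_
    rw [norm_mul, norm_mul, Complex.norm_I, one_mul, mul_pow, Complex.norm_real, Real.norm_eq_abs,
      sq_abs]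
    refine mul_le_mul_of_nonneg_right ?_ (by positivity)
    have e1 : xi N (K j a) ^ 2 ≤ freqSq N (K j) :=
      Finset.single_le_sum (f := fun a => xi N (K j a) ^ 2) (fun _ _ => sq_nonneg _)
        (Finset.mem_univ a)
    have e2 : freqSq N (K j) ≤ ∑ j, freqSq N (K j) :=
      Finset.single_le_sum (f := fun j => freqSq N (K j)) (fun _ _ => freqSq_nonneg _)
        (Finset.mem_univ j)
    unfold weight; linarith
  obtain ⟨u, hu⟩ := exists_coef h0
  choose g hg using fun j a => exists_coef (h1 j a)
  refine ⟨⟨WithLp.toLp 2 (u, WithLp.toLp 2 fun ja => g ja.1 ja.2), ?_, fun j a => ?_⟩, hu⟩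
  · exact isAntisymmetric_iff.2 fun π K => by
      change coef u _ = _ * coef u K
      rw [hu, hu, ha]
  · refine isWeakPartial_iff.2 fun K => ?_
    change coef (g j a) K = _ * coef u K
    rw [hu, hg]

lemma norm_waveFn_le (ψ : Fermion N) : ‖waveFn ψ‖ ≤ ‖ψ‖ := by
  have h1 := hasSum_coef_sq (waveFn ψ)
  have h2 := hasSum_fc_sq ψ
  refine le_of_sq_le_sq ?_ (norm_nonneg _)
  exact hasSum_le (fun K => le_mul_of_one_le_left (by positivity) (one_le_weight K)) h1 h2

lemma norm_fermion_le {ψ : Fermion N} {B : ℝ} (hB : 0 ≤ B)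
    (h : ∑' K, ENNReal.ofReal (weight K * ‖fc ψ K‖ ^ 2) ≤ ENNReal.ofReal (B ^ 2)) : ‖ψ‖ ≤ B := by
  have h2 := hasSum_fc_sq ψ
  rw [← ENNReal.ofReal_tsum_of_nonneg (fun K => mul_nonneg (weight_pos K).le (sq_nonneg _))
    h2.summable, h2.tsum_eq] at h
  exact le_of_sq_le_sq ((ENNReal.ofReal_le_ofReal_iff (by positivity)).1 h) hB

end FermionFourier

/-! ## Summation estimates -/

section Sums

open scoped ENNReal

/-- Working in extended nonnegative numbers removes every summability hypothesis. The factor `c`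
carries a weight that does not depend on the summation index. -/
lemma ennreal_cauchy_schwarz {ι : Type*} {c : ℝ≥0∞} {h f g : ι → ℝ≥0∞}
    (H : ∀ i, c * h i ^ 2 ≤ f i * g i) :
    c * (∑' i, h i) ^ 2 ≤ (∑' i, f i) * ∑' i, g i := by
  have h2 : ∀ x : ℝ≥0∞, (x ^ (1 / 2 : ℝ)) ^ (2 : ℝ) = x := fun x => by
    rw [← ENNReal.rpow_mul]; norm_num
  have h3 : ∀ x : ℝ≥0∞, (x ^ 2) ^ (1 / 2 : ℝ) = x := fun x => by
    rw [← ENNReal.rpow_natCast, ← ENNReal.rpow_mul]; norm_num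
  have h4 : ∀ x : ℝ≥0∞, (x ^ (1 / 2 : ℝ)) ^ 2 = x := fun x => by
    rw [← ENNReal.rpow_natCast]; exact h2 x
  have h1 : ∀ i, c ^ (1 / 2 : ℝ) * h i ≤ f i ^ (1 / 2 : ℝ) * g i ^ (1 / 2 : ℝ) := fun i => by
    have := ENNReal.rpow_le_rpow (H i) (z := 1 / 2) (by norm_num)
    rwa [ENNReal.mul_rpow_of_nonneg _ _ (by norm_num), ENNReal.mul_rpow_of_nonneg _ _ (by norm_num),
      h3] at this
  have key : c ^ (1 / 2 : ℝ) * ∑' i, h i ≤ (∑' i, f i) ^ (1 / 2 : ℝ) * (∑' i, g i) ^ (1 / 2 : ℝ) := by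
    rw [← ENNReal.tsum_mul_left, ENNReal.tsum_eq_iSup_sum]
    refine iSup_le fun s => ?_
    calc ∑ i ∈ s, c ^ (1 / 2 : ℝ) * h i
        ≤ ∑ i ∈ s, f i ^ (1 / 2 : ℝ) * g i ^ (1 / 2 : ℝ) := Finset.sum_le_sum fun i _ => h1 i
      _ ≤ (∑ i ∈ s, f i) ^ (1 / 2 : ℝ) * (∑ i ∈ s, g i) ^ (1 / 2 : ℝ) := by
          have := ENNReal.inner_le_Lp_mul_Lq s (fun i => f i ^ (1 / 2 : ℝ))
            (fun i => g i ^ (1 / 2 : ℝ)) Real.HolderConjugate.two_two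
          simpa only [h2] using this
      _ ≤ _ := by
          gcongr <;> exact ENNReal.sum_le_tsum s
  have := pow_le_pow_left₀ (zero_le) key 2
  rwa [mul_pow, mul_pow, h4, h4, h4] at this

/-- The autocorrelation of two `H¹` families on a discrete group lies in `ℓ²`. -/
lemma tsum_correlation_sq_le {Z R : Type*} [AddCommGroup Z] {W : Z → ℝ≥0∞}
    (h0 : ∀ l, W l ≠ 0) (h1 : ∀ l, W l ≠ ⊤) (A B : Z → R → ℝ≥0∞) :
    ∑' k, (∑' l, ∑' r, A l r * B (l - k) r) ^ 2 ≤
      (∑' l, (W l)⁻¹ ^ 2) * ((∑' l, ∑' r, W l * A l r ^ 2) * ∑' l, ∑' r, W l * B l r ^ 2) := by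
  -- The correlation of the inverse weights is bounded uniformly in the shift, by Cauchy–Schwarz and
  -- translation invariance of the sum.
  have hW : ∀ k, ∑' l, (W l)⁻¹ * (W (l - k))⁻¹ ≤ ∑' l, (W l)⁻¹ ^ 2 := by
    intro k
    have e1 := ennreal_cauchy_schwarz (c := 1) (h := fun l => (W l)⁻¹ * (W (l - k))⁻¹)
      (f := fun l => (W l)⁻¹ ^ 2) (g := fun l => (W (l - k))⁻¹ ^ 2)
      (fun l => by rw [one_mul, mul_pow])
    have e2 : ∑' l, (W (l - k))⁻¹ ^ 2 = ∑' l, (W l)⁻¹ ^ 2 :=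
      (Equiv.subRight k).tsum_eq fun l => (W l)⁻¹ ^ 2
    rw [one_mul, e2, ← pow_two] at e1
    exact (ENNReal.pow_le_pow_left_iff (two_ne_zero)).1 e1
  -- Inserting W⁻¹W = 1 at `l` and at `l - k`, Cauchy–Schwarz in `r` and then in `l` separates the
  -- inverse weights from the weighted families.
  have hk : ∀ k, (∑' l, ∑' r, A l r * B (l - k) r) ^ 2 ≤ (∑' l, (W l)⁻¹ ^ 2) *
      ∑' l, (∑' r, W l * A l r ^ 2) * ∑' r, W (l - k) * B (l - k) r ^ 2 := by
    intro k
    have e1 := ennreal_cauchy_schwarz (c := 1) (h := fun l => ∑' r, A l r * B (l - k) r)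
      (f := fun l => (W l)⁻¹ * (W (l - k))⁻¹)
      (g := fun l => (∑' r, W l * A l r ^ 2) * ∑' r, W (l - k) * B (l - k) r ^ 2) (fun l => by
        have e2 := ennreal_cauchy_schwarz (c := 1) (h := fun r => A l r * B (l - k) r)
          (f := fun r => A l r ^ 2) (g := fun r => B (l - k) r ^ 2)
          (fun r => by rw [one_mul, mul_pow])
        refine e2.trans (le_of_eq ?_)
        rw [ENNReal.tsum_mul_left, ENNReal.tsum_mul_left]
        have e3 := ENNReal.inv_mul_cancel (h0 l) (h1 l)
        have e4 := ENNReal.inv_mul_cancel (h0 (l - k)) (h1 (l - k))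
        calc _ = ((W l)⁻¹ * W l) * ((W (l - k))⁻¹ * W (l - k)) *
              ((∑' r, A l r ^ 2) * ∑' r, B (l - k) r ^ 2) := by rw [e3, e4, one_mul, one_mul]
          _ = _ := by ring)
    rw [one_mul] at e1
    exact e1.trans (mul_le_mul_left (hW k) _)
  -- After the sums over `k` and `l` are exchanged, `k` occurs only in the second factor, and the
  -- substitution m = l - k decouples the two.
  refine (ENNReal.tsum_le_tsum hk).trans (le_of_eq ?_)
  rw [ENNReal.tsum_mul_left, ENNReal.tsum_comm]
  congr 1
  simp only [ENNReal.tsum_mul_left]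
  rw [← ENNReal.tsum_mul_right]
  refine tsum_congr fun l => ?_
  congr 1
  exact (Equiv.subLeft l).tsum_eq fun m => W m * ∑' r, B m r ^ 2

end Sums

/-! ### Frequencies and the convergence of ∑ (1 + |ξ|²)⁻² -/

section LatticeSums

variable {N : ℕ}

lemma xi_sq (m : ℤ) : xi N m ^ 2 = (2 * Real.pi / N) ^ 2 * (m : ℝ) ^ 2 := by
  unfold xi; ring

lemma freqSq_eq_mul (k : Fin 3 → ℤ) :
    freqSq N k = (2 * Real.pi / N) ^ 2 * ∑ a, (k a : ℝ) ^ 2 := by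
  rw [freqSq_eq, Finset.mul_sum]
  exact Finset.sum_congr rfl fun a _ => xi_sq _

lemma freqSq_zero : freqSq N 0 = 0 := by simp [freqSq]

lemma one_le_sum_sq {k : Fin 3 → ℤ} (hk : k ≠ 0) : 1 ≤ ∑ a, (k a : ℝ) ^ 2 := by
  obtain ⟨a, ha⟩ := Function.ne_iff.1 hk
  have h1 : (1 : ℤ) ≤ (k a) ^ 2 := by
    have := sq_pos_of_ne_zero (a := k a) ha
    omega
  have h2 : (1 : ℝ) ≤ (k a : ℝ) ^ 2 := by exact_mod_cast h1
  exact h2.trans (Finset.single_le_sum (f := fun a => (k a : ℝ) ^ 2)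
    (fun _ _ => sq_nonneg _) (Finset.mem_univ a))

lemma freqSq_neg (k : Fin 3 → ℤ) : freqSq N (-k) = freqSq N k := by
  simp [freqSq_eq_mul]

variable [NeZero N]

lemma two_pi_div_pos : 0 < (2 * Real.pi / N) ^ 2 := by
  have : (0 : ℝ) < N := by exact_mod_cast Nat.pos_of_ne_zero (NeZero.ne N)
  have := Real.pi_pos
  positivity

lemma freqSq_pos {k : Fin 3 → ℤ} (hk : k ≠ 0) : 0 < freqSq N k := by
  rw [freqSq_eq_mul]
  exact mul_pos two_pi_div_pos (one_pos.trans_le (one_le_sum_sq hk))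

/-- A constant with `|ξ|⁻² ≤ greenConst (1 + |ξ|²)⁻¹` for `ξ ≠ 0`. -/
def greenConst (N : ℕ) : ℝ := 1 + ((2 * Real.pi / N) ^ 2)⁻¹

lemma greenConst_pos : 0 < greenConst N := by
  have := two_pi_div_pos (N := N)
  unfold greenConst; positivity

/-- At `k = 0` the left side is zero by the convention for the inverse of zero, which is exactly the
omission of the zero mode in G. Otherwise |ξ|² is at least (2π/N)². -/
lemma inv_freqSq_le (k : Fin 3 → ℤ) : (freqSq N k)⁻¹ ≤ greenConst N * (1 + freqSq N k)⁻¹ := by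
  by_cases hk : k = 0
  · subst hk
    have := greenConst_pos (N := N)
    simp only [freqSq_zero]; norm_num; exact this.le
  · have h1 := freqSq_pos (N := N) hk
    have h2 : (2 * Real.pi / N) ^ 2 ≤ freqSq N k := by
      rw [freqSq_eq_mul]
      exact le_mul_of_one_le_right two_pi_div_pos.le (one_le_sum_sq hk)
    have h3 := two_pi_div_pos (N := N)
    rw [← div_eq_mul_inv, le_div_iff₀ (by linarith), inv_mul_le_iff₀ h1, greenConst]
    have h4 : 1 ≤ ((2 * Real.pi / N) ^ 2)⁻¹ * freqSq N k := by
      rw [← inv_mul_cancel₀ h3.ne']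
      exact mul_le_mul_of_nonneg_left h2 (by positivity)
    nlinarith

omit [NeZero N] in
lemma inv_freqSq_nonneg (k : Fin 3 → ℤ) : 0 ≤ (freqSq N k)⁻¹ := inv_nonneg.2 (freqSq_nonneg k)

lemma inv_freqSq_le_const (k : Fin 3 → ℤ) : (freqSq N k)⁻¹ ≤ greenConst N := by
  refine (inv_freqSq_le k).trans (mul_le_of_le_one_right greenConst_pos.le ?_)
  have := freqSq_nonneg (N := N) k
  exact inv_le_one_of_one_le₀ (by linarith)

/-- Comparison with ∑ |k|⁻⁴ over a lattice of rank three, convergent because 3 < 4. This is where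
the dimension enters. -/
lemma summable_weight_inv_sq : Summable fun k : Fin 3 → ℤ => ((1 + freqSq N k)⁻¹) ^ 2 := by
  set L := Submodule.span ℤ (Set.range (Pi.basisFun ℝ (Fin 3))) with hL
  have hr : Module.finrank ℤ L < 4 := by
    rw [ZLattice.rank ℝ L]; simp
  have hs := ZLattice.summable_norm_pow_inv L 4 hr
  have hmem : ∀ k : Fin 3 → ℤ, (fun a => (k a : ℝ)) ∈ L := by
    intro k
    have : (fun a => (k a : ℝ)) = ∑ a, k a • Pi.basisFun ℝ (Fin 3) a := by
      funext b; simp [Finset.sum_apply, Pi.single_apply]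
    rw [this]
    exact Submodule.sum_mem _ fun a _ => Submodule.smul_mem _ _ (Submodule.subset_span ⟨a, rfl⟩)
  have hinj : Function.Injective fun k : Fin 3 → ℤ => (⟨fun a => (k a : ℝ), hmem k⟩ : L) := by
    intro k l h
    funext a
    have h' : (k a : ℝ) = l a := congrFun (congrArg Subtype.val h) a
    exact_mod_cast h'
  have hs2 := (hs.comp_injective hinj).mul_left ((((2 * Real.pi / N) ^ 2)⁻¹) ^ 2)
  -- The zero frequency has to be excluded, since the comparison term vanishes there.
  refine hs2.of_norm_bounded_eventually ?_
  have hfin : ({0} : Set (Fin 3 → ℤ)).Finite := Set.finite_singleton 0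
  filter_upwards [hfin.compl_mem_cofinite] with k hk
  have hk0 : k ≠ 0 := hk
  have h3 := two_pi_div_pos (N := N)
  have h1 : ‖(fun a => (k a : ℝ))‖ ^ 2 ≤ ∑ a, (k a : ℝ) ^ 2 := by
    have h0 : 0 ≤ ∑ a, (k a : ℝ) ^ 2 := Finset.sum_nonneg fun _ _ => sq_nonneg _
    rw [← Real.le_sqrt (norm_nonneg _) h0, pi_norm_le_iff_of_nonneg (Real.sqrt_nonneg _)]
    intro a
    refine Real.le_sqrt_of_sq_le ?_
    rw [Real.norm_eq_abs, sq_abs]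
    exact Finset.single_le_sum (f := fun a => (k a : ℝ) ^ 2)
      (fun _ _ => sq_nonneg _) (Finset.mem_univ a)
  have hn : 0 < ‖(fun a => (k a : ℝ))‖ := by
    rw [norm_pos_iff]
    intro h
    refine hk0 (funext fun a => ?_)
    have h' : (k a : ℝ) = 0 := congrFun h a
    exact_mod_cast h'
  have hf := freqSq_nonneg (N := N) k
  rw [Real.norm_of_nonneg (by positivity)]
  simp only [Function.comp_apply, Submodule.coe_norm]
  rw [show ‖(fun a => (k a : ℝ))‖⁻¹ ^ 4 = ((‖(fun a => (k a : ℝ))‖ ^ 2)⁻¹) ^ 2 by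
    rw [← inv_pow, ← pow_mul], ← mul_pow, ← mul_inv]
  refine pow_le_pow_left₀ (by positivity) ?_ 2
  refine inv_anti₀ (by positivity) ?_
  rw [freqSq_eq_mul]
  nlinarith

open scoped ENNReal

/-- The weight `1 + |ξ|²` as an extended nonnegative number. -/
def eweight (N : ℕ) (k : Fin 3 → ℤ) : ℝ≥0∞ := ENNReal.ofReal (1 + freqSq N k)

omit [NeZero N] in
lemma eweight_ne_zero (k : Fin 3 → ℤ) : eweight N k ≠ 0 := by
  have := freqSq_nonneg (N := N) k
  simp only [eweight, ne_eq, ENNReal.ofReal_eq_zero, not_le]; linarith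

omit [NeZero N] in
lemma eweight_ne_top (k : Fin 3 → ℤ) : eweight N k ≠ ⊤ := ENNReal.ofReal_ne_top

/-- The sum `∑ (1 + |ξ|²)⁻²`. -/
def sobolevConst (N : ℕ) : ℝ := ∑' k : Fin 3 → ℤ, ((1 + freqSq N k)⁻¹) ^ 2

lemma tsum_eweight_inv_sq :
    ∑' k, (eweight N k)⁻¹ ^ 2 = ENNReal.ofReal (sobolevConst N) := by
  rw [sobolevConst, ENNReal.ofReal_tsum_of_nonneg (fun _ => by positivity) summable_weight_inv_sq]
  refine tsum_congr fun k => ?_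
  have := freqSq_nonneg (N := N) k
  rw [eweight, ENNReal.ofReal_pow (by positivity), ENNReal.ofReal_inv_of_pos (by linarith)]

omit [NeZero N] in
lemma sobolevConst_nonneg : 0 ≤ sobolevConst N := tsum_nonneg fun _ => by positivity

end LatticeSums

/-! ### Polarised densities and multiplication by a potential: the main estimates -/

section Bilinear

open scoped ENNReal

/-- Square summable families indexed by `ℤ³`: the Fourier side of `L²(𝕋)`. -/
abbrev Seq := lp (fun _ : Fin 3 → ℤ => ℂ) 2

lemma memℓp_two_of_tsum_le {ι : Type*} {f : ι → ℂ} {B : ℝ}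
    (h : ∑' i, ‖f i‖ₑ ^ 2 ≤ ENNReal.ofReal (B ^ 2)) : Summable fun i => ‖f i‖ ^ 2 := by
  have h1 : ∑' i, ENNReal.ofReal (‖f i‖ ^ 2) ≠ ⊤ := by
    refine ne_top_of_le_ne_top (ENNReal.ofReal_ne_top (r := B ^ 2)) (le_of_eq_of_le ?_ h)
    exact tsum_congr fun i => by rw [ENNReal.ofReal_pow (norm_nonneg _), ofReal_norm]
  simpa using (ENNReal.summable_toReal h1).congr fun i => ENNReal.toReal_ofReal (sq_nonneg _)

/-- A square summable family as an element of `ℓ²`. -/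
def seqMk (f : (Fin 3 → ℤ) → ℂ) (h : Summable fun k => ‖f k‖ ^ 2) : Seq :=
  ⟨f, memℓp_gen (by simpa using h)⟩

@[simp] lemma seqMk_apply (f : (Fin 3 → ℤ) → ℂ) (h : Summable fun k => ‖f k‖ ^ 2)
    (k : Fin 3 → ℤ) : seqMk f h k = f k := rfl

lemma seq_smul_apply (c : ℝ) (f : Seq) (k : Fin 3 → ℤ) : (c • f) k = c * f k := by
  rw [lp.coeFn_smul, Pi.smul_apply, Complex.real_smul]

lemma seq_sum_apply {ι : Type*} (s : Finset ι) (f : ι → Seq) (k : Fin 3 → ℤ) :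
    (∑ i ∈ s, f i) k = ∑ i ∈ s, f i k := by
  classical
  induction s using Finset.induction_on with
  | empty => simp
  | insert i s hi ih => rw [Finset.sum_insert hi, Finset.sum_insert hi, lp.coeFn_add, Pi.add_apply, ih]

lemma seq_hasSum_sq (f : Seq) : HasSum (fun k => ‖f k‖ ^ 2) (‖f‖ ^ 2) := by
  have := lp.hasSum_norm (p := 2) (by norm_num) f
  simpa using this

lemma tsum_enorm_sq_eq {ι : Type*} {f : ι → ℂ} {B : ℝ} (h : HasSum (fun i => ‖f i‖ ^ 2) (B ^ 2)) :
    ∑' i, ‖f i‖ₑ ^ 2 = ENNReal.ofReal (B ^ 2) := by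
  rw [← h.tsum_eq, ENNReal.ofReal_tsum_of_nonneg (fun _ => by positivity) h.summable]
  exact tsum_congr fun i => by rw [ENNReal.ofReal_pow (norm_nonneg _), ofReal_norm]

lemma seq_norm_le {f : Seq} {B : ℝ} (hB : 0 ≤ B)
    (h : ∑' k, ‖f k‖ₑ ^ 2 ≤ ENNReal.ofReal (B ^ 2)) : ‖f‖ ≤ B := by
  rw [tsum_enorm_sq_eq (seq_hasSum_sq f), ENNReal.ofReal_le_ofReal_iff (by positivity)] at h
  exact le_of_sq_le_sq h hB

lemma summable_mul_of_sq {ι : Type*} {f g : ι → ℂ} (hf : Summable fun i => ‖f i‖ ^ 2)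
    (hg : Summable fun i => ‖g i‖ ^ 2) : Summable fun i => f i * g i := by
  refine Summable.of_norm_bounded ((hf.add hg).mul_left (1 / 2)) fun i => ?_
  rw [norm_mul]
  nlinarith [sq_nonneg (‖f i‖ - ‖g i‖)]

variable {N : ℕ} [NeZero N]

lemma summable_fc_sq (ψ : Fermion N) : Summable fun K => ‖fc ψ K‖ ^ 2 :=
  (hasSum_coef_sq _).summable

lemma summable_fc_shift_sq (ψ : Fermion N) (L : Freq N) :
    Summable fun K => ‖fc ψ (K - L)‖ ^ 2 :=
  ((Equiv.subRight L).summable_iff (f := fun K => ‖fc ψ K‖ ^ 2)).2 (summable_fc_sq ψ)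

lemma summable_corr (ψ χ : Fermion N) (L : Freq N) :
    Summable fun K => fc ψ K * starRingEnd ℂ (fc χ (K - L)) :=
  summable_mul_of_sq (summable_fc_sq ψ) (by simpa using summable_fc_shift_sq χ L)

/-- The Fourier coefficient `∫ ψ χ̄ e^{-iξx_j}` in terms of those of `ψ` and `χ`. -/
def corr (j : Fin (N ^ 3)) (ψ χ : Fermion N) (k : Fin 3 → ℤ) : ℂ :=
  ∑' K, fc ψ K * starRingEnd ℂ (fc χ (K - Pi.single j k))

lemma tsum_weight_fc (ψ : Fermion N) :
    ∑' K, ENNReal.ofReal (weight K * ‖fc ψ K‖ ^ 2) = ENNReal.ofReal (‖ψ‖ ^ 2) := by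
  have h := hasSum_fc_sq ψ
  rw [← h.tsum_eq, ENNReal.ofReal_tsum_of_nonneg
    (fun K => mul_nonneg (weight_pos K).le (sq_nonneg _)) h.summable]

omit [NeZero N] in
lemma one_add_freqSq_le_weight (K : Freq N) (j : Fin (N ^ 3)) : 1 + freqSq N (K j) ≤ weight K := by
  have e2 : freqSq N (K j) ≤ ∑ j, freqSq N (K j) :=
    Finset.single_le_sum (f := fun j => freqSq N (K j)) (fun _ _ => freqSq_nonneg _)
      (Finset.mem_univ j)
  unfold weight; linarith

lemma tsum_eweight_fc_le (j : Fin (N ^ 3)) (ψ : Fermion N) :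
    ∑' K : Freq N, eweight N (K j) * ‖fc ψ K‖ₑ ^ 2 ≤ ENNReal.ofReal (‖ψ‖ ^ 2) := by
  rw [← tsum_weight_fc]
  refine ENNReal.tsum_le_tsum fun K => ?_
  rw [ENNReal.ofReal_mul (weight_pos K).le, ENNReal.ofReal_pow (norm_nonneg _), ofReal_norm]
  exact mul_le_mul_left (ENNReal.ofReal_le_ofReal (one_add_freqSq_le_weight K j)) _

/-- A frequency splits into its `j`-th component `l` and the remaining components `r`. The shift by
`Pi.single j k` moves only `l`, so this is the autocorrelation estimate `tsum_correlation_sq_le`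
with weight 1 + |ξ_l|². In effect, derivatives in x_j alone place the one-particle density in L². -/
lemma tsum_corr_sq_le (j : Fin (N ^ 3)) (ψ χ : Fermion N) :
    ∑' k, ‖corr j ψ χ k‖ₑ ^ 2 ≤
      ENNReal.ofReal ((Real.sqrt (sobolevConst N) * ‖ψ‖ * ‖χ‖) ^ 2) := by
  set e := Equiv.funSplitAt j (Fin 3 → ℤ) with he
  have hsplit : ∀ g : Freq N → ℝ≥0∞, ∑' l, ∑' r, g (e.symm (l, r)) = ∑' K, g K := by
    intro g
    rw [← e.symm.tsum_eq, ENNReal.tsum_prod']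
  have hj : ∀ l r, e.symm (l, r) j = l := fun l r => by
    simp [he, Equiv.funSplitAt, Equiv.piSplitAt]
  have hs : ∀ l r k, e.symm (l, r) - Pi.single j k = e.symm (l - k, r) := by
    intro l r k
    funext i
    by_cases hi : i = j
    · subst hi; simp [he, Equiv.funSplitAt, Equiv.piSplitAt]
    · simp [he, Equiv.funSplitAt, Equiv.piSplitAt, hi]
  have h1 := tsum_correlation_sq_le (eweight_ne_zero (N := N)) eweight_ne_top
    (fun l r => ‖fc ψ (e.symm (l, r))‖ₑ) (fun l r => ‖fc χ (e.symm (l, r))‖ₑ)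
  have h2 : ∀ ψ : Fermion N, ∑' l, ∑' r, eweight N l * ‖fc ψ (e.symm (l, r))‖ₑ ^ 2 ≤
      ENNReal.ofReal (‖ψ‖ ^ 2) := by
    intro ψ
    refine le_of_eq_of_le ?_ (tsum_eweight_fc_le j ψ)
    rw [← hsplit]
    exact tsum_congr fun l => tsum_congr fun r => by rw [hj]
  calc ∑' k, ‖corr j ψ χ k‖ₑ ^ 2
      ≤ ∑' k, (∑' l, ∑' r, ‖fc ψ (e.symm (l, r))‖ₑ * ‖fc χ (e.symm (l - k, r))‖ₑ) ^ 2 := by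
        refine ENNReal.tsum_le_tsum fun k => pow_le_pow_left₀ zero_le ?_ 2
        refine enorm_tsum_le_tsum_enorm.trans (le_of_eq ?_)
        rw [← hsplit]
        refine tsum_congr fun l => tsum_congr fun r => ?_
        rw [enorm_mul, hs, RCLike.enorm_conj]
    _ ≤ _ := h1
    _ ≤ ENNReal.ofReal (sobolevConst N) *
        (ENNReal.ofReal (‖ψ‖ ^ 2) * ENNReal.ofReal (‖χ‖ ^ 2)) := by
        rw [tsum_eweight_inv_sq]
        gcongr
        · exact h2 ψ
        · exact h2 χ
    _ = _ := by
        rw [← ENNReal.ofReal_mul (by positivity), ← ENNReal.ofReal_mul sobolevConst_nonneg, mul_pow,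
          mul_pow, Real.sq_sqrt sobolevConst_nonneg, mul_assoc]

/-- The sesquilinear map `(ψ, χ) ↦ (∫ ψ χ̄ e^{-iξx_j})_ξ` into `ℓ²`. -/
def corrL (j : Fin (N ^ 3)) : Fermion N →L[ℝ] Fermion N →L[ℝ] Seq :=
  LinearMap.mkContinuous₂
    (LinearMap.mk₂ ℝ
      (fun ψ χ => seqMk (corr j ψ χ) (memℓp_two_of_tsum_le (tsum_corr_sq_le j ψ χ)))
      (fun ψ ψ' χ => by
        ext k
        simp only [seqMk_apply, lp.coeFn_add, Pi.add_apply, corr, fc_add, add_mul]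
        exact (summable_corr ψ χ _).tsum_add (summable_corr ψ' χ _))
      (fun c ψ χ => by
        ext k
        simp only [seqMk_apply, lp.coeFn_smul, Pi.smul_apply, corr, fc_real_smul, mul_assoc,
          Complex.real_smul]
        exact tsum_mul_left)
      (fun ψ χ χ' => by
        ext k
        simp only [seqMk_apply, lp.coeFn_add, Pi.add_apply, corr, fc_add, map_add, mul_add]
        exact (summable_corr ψ χ _).tsum_add (summable_corr ψ χ' _))
      (fun c ψ χ => by
        ext k
        simp only [seqMk_apply, lp.coeFn_smul, Pi.smul_apply, corr, fc_real_smul, map_mul,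
          Complex.conj_ofReal, Complex.real_smul]
        rw [← tsum_mul_left]
        exact tsum_congr fun K => by ring))
    (Real.sqrt (sobolevConst N)) fun ψ χ =>
      seq_norm_le (by positivity) (tsum_corr_sq_le j ψ χ)

@[simp] lemma corrL_apply (j : Fin (N ^ 3)) (ψ χ : Fermion N) (k : Fin 3 → ℤ) :
    corrL j ψ χ k = corr j ψ χ k := rfl

/-- The Fourier coefficients of the polarised density `∑_j ∫ ψ χ̄ ∏_{i ≠ j} dy_i`. -/
def pairDensity (N : ℕ) [NeZero N] : Fermion N →L[ℝ] Fermion N →L[ℝ] Seq :=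
  ((N : ℝ) ^ 3)⁻¹ • (∑ j, corrL j : Fermion N →L[ℝ] Fermion N →L[ℝ] Seq)

lemma pairDensity_apply (ψ χ : Fermion N) (k : Fin 3 → ℤ) :
    pairDensity N ψ χ k = ((N : ℂ) ^ 3)⁻¹ * ∑ j, corr j ψ χ k := by
  have h1 : pairDensity N ψ χ = ((N : ℝ) ^ 3)⁻¹ • ∑ j, corrL j ψ χ := by
    simp only [pairDensity, smul_apply, sum_apply]
  rw [h1, seq_smul_apply, seq_sum_apply]
  simp

/-! ### Multiplication by a potential -/

lemma summable_potential (r : Seq) (ψ : Fermion N) (j : Fin (N ^ 3)) (K : Freq N) :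
    Summable fun k => r k * ((freqSq N k)⁻¹ : ℝ) * fc ψ (K - Pi.single j k) := by
  have h1 : Summable fun k => ‖r k * ((freqSq N k)⁻¹ : ℝ)‖ ^ 2 := by
    refine ((seq_hasSum_sq r).summable.mul_left (greenConst N ^ 2)).of_nonneg_of_le
      (fun _ => by positivity) fun k => ?_
    rw [norm_mul, mul_pow, mul_comm, Complex.norm_real, Real.norm_of_nonneg (inv_freqSq_nonneg k)]
    exact mul_le_mul_of_nonneg_right
      (pow_le_pow_left₀ (inv_freqSq_nonneg k) (inv_freqSq_le_const k) 2) (by positivity)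
  have h2 : Summable fun k => ‖fc ψ (K - Pi.single j k)‖ ^ 2 := by
    have hinj : Function.Injective fun k : Fin 3 → ℤ => K - Pi.single j k := fun k l h =>
      Pi.single_injective j (sub_right_injective h)
    exact (summable_fc_sq ψ).comp_injective hinj
  exact summable_mul_of_sq h1 h2

/-- The Fourier coefficients of `(G r)(x_j) ψ`. -/
def potCoef (r : Seq) (ψ : Fermion N) (j : Fin (N ^ 3)) (K : Freq N) : ℂ :=
  ∑' k, r k * ((freqSq N k)⁻¹ : ℝ) * fc ψ (K - Pi.single j k)

omit [NeZero N] in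
-- The Fourier form of the product rule: a derivative falls on ψ or on the potential. Only the
-- `j`-th component is split, by (a + b)² ≤ 2a² + 2b².
lemma weight_le_add (K : Freq N) (j : Fin (N ^ 3)) (k : Fin 3 → ℤ) :
    weight K ≤ 2 * weight (K - Pi.single j k : Freq N) + 2 * freqSq N k := by
  have h1 : ∀ i, freqSq N (K i) ≤ 2 * freqSq N ((K - Pi.single j k : Freq N) i) +
      if i = j then 2 * freqSq N k else 0 := by
    intro i
    split_ifs with hi
    · subst hi
      simp only [freqSq_eq, Finset.mul_sum, ← Finset.sum_add_distrib, Pi.sub_apply, Pi.single_eq_same]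
      refine Finset.sum_le_sum fun a _ => ?_
      have : xi N (K i a) = xi N (K i a - k a) + xi N (k a) := by unfold xi; push_cast; ring
      rw [this]
      nlinarith [sq_nonneg (xi N (K i a - k a) - xi N (k a))]
    · have h0 := freqSq_nonneg (N := N) (K i)
      simp [hi]; linarith
  have h2 := Finset.sum_le_sum fun i (_ : i ∈ Finset.univ) => h1 i
  rw [Finset.sum_add_distrib, ← Finset.mul_sum] at h2
  simp only [Finset.sum_ite_eq', Finset.mem_univ, if_true] at h2
  unfold weight
  linarith

/-- The constant in the bound for multiplication by a potential. -/
def potConst (N : ℕ) : ℝ := 2 * (greenConst N ^ 2 + greenConst N ^ 2) * sobolevConst N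

omit [NeZero N] in
lemma potConst_nonneg : 0 ≤ potConst N := by
  have := sobolevConst_nonneg (N := N)
  unfold potConst; positivity

lemma tsum_shift_inv_le (l : Fin 3 → ℤ) :
    ∑' k, (eweight N k)⁻¹ * (eweight N (l - k))⁻¹ ≤ ENNReal.ofReal (sobolevConst N) := by
  rw [← tsum_eweight_inv_sq]
  have e1 := ennreal_cauchy_schwarz (c := 1) (h := fun k => (eweight N k)⁻¹ * (eweight N (l - k))⁻¹)
    (f := fun k => (eweight N k)⁻¹ ^ 2) (g := fun k => (eweight N (l - k))⁻¹ ^ 2)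
    (fun k => by rw [one_mul, mul_pow])
  have e2 : ∑' k, (eweight N (l - k))⁻¹ ^ 2 = ∑' k, (eweight N k)⁻¹ ^ 2 :=
    (Equiv.subLeft l).tsum_eq fun k => (eweight N k)⁻¹ ^ 2
  rw [one_mul, e2, ← pow_two] at e1
  exact (ENNReal.pow_le_pow_left_iff (two_ne_zero)).1 e1

omit [NeZero N] in
lemma inv_eweight (k : Fin 3 → ℤ) : (eweight N k)⁻¹ = ENNReal.ofReal (1 + freqSq N k)⁻¹ := by
  have := freqSq_nonneg (N := N) k
  rw [eweight, ENNReal.ofReal_inv_of_pos (by linarith)]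

/-- The scalar inequality behind multiplication by a potential. Here `q` is |ξ_k|², `g` its inverse,
`v` and `v'` are (1 + |ξ|²)⁻¹ at `k` and at `K j - k`, and `u`, `w` are the Sobolev weights at `K`
and at the shifted frequency. A derivative on ψ costs w g². A derivative on the potential costs g² q
≤ g, and there 1 ≤ w v' supplies the decay that is missing. -/
lemma weighted_inv_sq_le {c v v' g w q u : ℝ} (hc1 : c ≤ c ^ 2) (hg0 : 0 ≤ g) (hv0 : 0 ≤ v)
    (hw : 0 ≤ w) (hgq : g ^ 2 * q ≤ g) (hle : g ≤ c * v) (hwv : 1 ≤ w * v')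
    (hu : u ≤ 2 * w + 2 * q) : u * g ^ 2 ≤ 2 * c ^ 2 * (v ^ 2 + v * v') * w := by
  have hg2 : g ^ 2 ≤ c ^ 2 * v ^ 2 := by
    rw [← mul_pow]; exact pow_le_pow_left₀ hg0 hle 2
  calc u * g ^ 2 ≤ (2 * w + 2 * q) * g ^ 2 := mul_le_mul_of_nonneg_right hu (by positivity)
    _ = 2 * w * g ^ 2 + 2 * (g ^ 2 * q) := by ring
    _ ≤ 2 * w * (c ^ 2 * v ^ 2) + 2 * (c ^ 2 * v * (w * v')) := by
        refine add_le_add (mul_le_mul_of_nonneg_left hg2 (by positivity)) ?_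
        refine mul_le_mul_of_nonneg_left ?_ (by norm_num)
        calc g ^ 2 * q ≤ g := hgq
          _ ≤ c * v := hle
          _ ≤ c ^ 2 * v := mul_le_mul_of_nonneg_right hc1 hv0
          _ ≤ c ^ 2 * v * (w * v') := le_mul_of_one_le_right (by positivity) hwv
    _ = _ := by ring

lemma weight_mul_inv_freqSq_sq_le (K : Freq N) (j : Fin (N ^ 3)) (k : Fin 3 → ℤ) :
    weight K * ((freqSq N k)⁻¹) ^ 2 ≤ 2 * greenConst N ^ 2 * (((1 + freqSq N k)⁻¹) ^ 2 +
      (1 + freqSq N k)⁻¹ * (1 + freqSq N (K j - k))⁻¹) * weight (K - Pi.single j k : Freq N) := by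
  have hc := greenConst_pos (N := N)
  have hc1 : greenConst N ≤ greenConst N ^ 2 := by
    have h1 : 1 ≤ greenConst N := by
      have := two_pi_div_pos (N := N)
      have : 0 ≤ ((2 * Real.pi / (N : ℝ)) ^ 2)⁻¹ := by positivity
      unfold greenConst
      linarith
    nlinarith
  have hw1 : 1 + freqSq N (K j - k) ≤ weight (K - Pi.single j k : Freq N) := by
    have := one_add_freqSq_le_weight (K - Pi.single j k : Freq N) j
    rwa [Pi.sub_apply, Pi.single_eq_same] at this
  have hgq : ((freqSq N k)⁻¹) ^ 2 * freqSq N k ≤ (freqSq N k)⁻¹ := by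
    by_cases h0 : freqSq N k = 0
    · rw [h0, mul_zero, inv_zero]
    · rw [pow_two, mul_assoc, inv_mul_cancel₀ h0, mul_one]
  have hq' := freqSq_nonneg (N := N) (K j - k)
  exact weighted_inv_sq_le hc1 (inv_freqSq_nonneg k)
    (inv_nonneg.2 (by linarith [freqSq_nonneg (N := N) k])) (weight_pos _).le hgq
    (inv_freqSq_le k) (by rw [← div_eq_mul_inv, one_le_div (by linarith)]; exact hw1)
    (weight_le_add K j k)

lemma tsum_multiplier_le (l : Fin 3 → ℤ) :
    ∑' k, ENNReal.ofReal (2 * greenConst N ^ 2 * (((1 + freqSq N k)⁻¹) ^ 2 +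
      (1 + freqSq N k)⁻¹ * (1 + freqSq N (l - k))⁻¹)) ≤ ENNReal.ofReal (potConst N) := by
  have h0 : ∀ k : Fin 3 → ℤ, 0 ≤ (1 + freqSq N k)⁻¹ := fun k => by
    have := freqSq_nonneg (N := N) k
    positivity
  have h1 : ∀ k : Fin 3 → ℤ, ENNReal.ofReal (2 * greenConst N ^ 2 * (((1 + freqSq N k)⁻¹) ^ 2 +
      (1 + freqSq N k)⁻¹ * (1 + freqSq N (l - k))⁻¹)) = ENNReal.ofReal (2 * greenConst N ^ 2) *
      ((eweight N k)⁻¹ ^ 2 + (eweight N k)⁻¹ * (eweight N (l - k))⁻¹) := fun k => by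
    rw [inv_eweight, inv_eweight, ENNReal.ofReal_mul (by positivity),
      ENNReal.ofReal_add (pow_nonneg (h0 k) 2) (mul_nonneg (h0 k) (h0 _)),
      ENNReal.ofReal_pow (h0 k), ENNReal.ofReal_mul (h0 k)]
  simp only [h1]
  rw [ENNReal.tsum_mul_left, ENNReal.tsum_add, tsum_eweight_inv_sq]
  calc _ ≤ ENNReal.ofReal (2 * greenConst N ^ 2) *
        (ENNReal.ofReal (sobolevConst N) + ENNReal.ofReal (sobolevConst N)) := by
        gcongr; exact tsum_shift_inv_le l
    _ = _ := by
        rw [← ENNReal.ofReal_add sobolevConst_nonneg sobolevConst_nonneg,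
          ← ENNReal.ofReal_mul (by positivity), potConst]
        congr 1; ring

/-- Cauchy–Schwarz in `k`. One factor is the multiplier of `weight_mul_inv_freqSq_sq_le`, summable
uniformly in `K`; the other is a convolution of |r|² with the weighted |ψ̂|², whose sum over `K` is
a product of norms. -/
lemma weight_mul_potCoef_sq_le (r : Seq) (ψ : Fermion N) (j : Fin (N ^ 3)) (K : Freq N) :
    ENNReal.ofReal (weight K) * ‖potCoef r ψ j K‖ₑ ^ 2 ≤ ENNReal.ofReal (potConst N) *
      ∑' k, ‖r k‖ₑ ^ 2 * ENNReal.ofReal (weight (K - Pi.single j k : Freq N) *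
        ‖fc ψ (K - Pi.single j k)‖ ^ 2) := by
  have hn : ∀ z : ℂ, ‖z‖ₑ ^ 2 = ENNReal.ofReal (‖z‖ ^ 2) := fun z => by
    rw [ENNReal.ofReal_pow (norm_nonneg _), ofReal_norm]
  have hpt : ∀ k, ENNReal.ofReal (weight K) *
      ‖r k * ((freqSq N k)⁻¹ : ℝ) * fc ψ (K - Pi.single j k)‖ₑ ^ 2 ≤
      ENNReal.ofReal (2 * greenConst N ^ 2 * (((1 + freqSq N k)⁻¹) ^ 2 +
      (1 + freqSq N k)⁻¹ * (1 + freqSq N (K j - k))⁻¹)) *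
      (‖r k‖ₑ ^ 2 * ENNReal.ofReal (weight (K - Pi.single j k : Freq N) *
        ‖fc ψ (K - Pi.single j k)‖ ^ 2)) := by
    intro k
    have key := weight_mul_inv_freqSq_sq_le K j k
    have hf0 : 0 ≤ 2 * greenConst N ^ 2 * (((1 + freqSq N k)⁻¹) ^ 2 +
        (1 + freqSq N k)⁻¹ * (1 + freqSq N (K j - k))⁻¹) := by
      have := freqSq_nonneg (N := N) k
      have := freqSq_nonneg (N := N) (K j - k)
      positivity
    rw [hn, hn, ← ENNReal.ofReal_mul (weight_pos K).le, ← ENNReal.ofReal_mul (sq_nonneg ‖r k‖),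
      ← ENNReal.ofReal_mul hf0]
    refine ENNReal.ofReal_le_ofReal ?_
    rw [norm_mul, norm_mul, Complex.norm_real, Real.norm_of_nonneg (inv_freqSq_nonneg k), mul_pow,
      mul_pow]
    calc _ = weight K * ((freqSq N k)⁻¹) ^ 2 *
          (‖r k‖ ^ 2 * ‖fc ψ (K - Pi.single j k)‖ ^ 2) := by ring
      _ ≤ _ := mul_le_mul_of_nonneg_right key (by positivity)
      _ = _ := by ring
  refine le_trans ?_ ((ennreal_cauchy_schwarz hpt).trans
    (mul_le_mul_left (tsum_multiplier_le (K j)) _))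
  gcongr
  exact enorm_tsum_le_tsum_enorm

lemma tsum_weight_potCoef_le (r : Seq) (ψ : Fermion N) (j : Fin (N ^ 3)) :
    ∑' K, ENNReal.ofReal (weight K) * ‖potCoef r ψ j K‖ₑ ^ 2 ≤
      ENNReal.ofReal (potConst N * (‖r‖ ^ 2 * ‖ψ‖ ^ 2)) := by
  refine (ENNReal.tsum_le_tsum fun K => weight_mul_potCoef_sq_le r ψ j K).trans (le_of_eq ?_)
  rw [ENNReal.tsum_mul_left, ENNReal.tsum_comm]
  simp only [ENNReal.tsum_mul_left]
  have hs : ∀ k : Fin 3 → ℤ, ∑' K : Freq N, ENNReal.ofReal (weight (K - Pi.single j k : Freq N) *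
      ‖fc ψ (K - Pi.single j k)‖ ^ 2) = ENNReal.ofReal (‖ψ‖ ^ 2) := fun k => by
    rw [← tsum_weight_fc]
    exact (Equiv.subRight (Pi.single j k)).tsum_eq fun K : Freq N =>
      ENNReal.ofReal (weight K * ‖fc ψ K‖ ^ 2)
  simp only [hs]
  rw [ENNReal.tsum_mul_right, tsum_enorm_sq_eq (seq_hasSum_sq r), ← ENNReal.ofReal_mul (by positivity),
    ← ENNReal.ofReal_mul potConst_nonneg]

end Bilinear

/-! ### The operator of multiplication by ∑_j (Gr)(x_j) on ℱ -/

section Potential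

open scoped ENNReal

variable {N : ℕ} [NeZero N]

/-- The potential of a single electron destroys antisymmetry. Only the sum over all electrons is
invariant under permutations, which merely reindex it. -/
lemma sum_potCoef_perm (r : Seq) (ψ : Fermion N) (π : Equiv.Perm (Fin (N ^ 3))) (K : Freq N) :
    ∑ j, potCoef r ψ j (fun i => K (π i)) =
      ((Equiv.Perm.sign π : ℤ) : ℂ) * ∑ j, potCoef r ψ j K := by
  rw [← Equiv.sum_comp π fun j => potCoef r ψ j K, Finset.mul_sum]
  refine Finset.sum_congr rfl fun j _ => ?_
  rw [potCoef, potCoef, ← tsum_mul_left]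
  refine tsum_congr fun k => ?_
  have h : (fun i => K (π i)) - Pi.single j k =
      fun i => (K - Pi.single (π j) k : Freq N) (π i) := by
    funext i
    simp [Pi.single_apply]
  rw [h, fc_perm]
  ring

lemma tsum_weight_sum_potCoef_le (r : Seq) (ψ : Fermion N) :
    ∑' K, ENNReal.ofReal (weight K * ‖∑ j, potCoef r ψ j K‖ ^ 2) ≤
      ENNReal.ofReal ((((N ^ 3 : ℕ) : ℝ) * Real.sqrt (potConst N) * ‖r‖ * ‖ψ‖) ^ 2) := by
  have h1 : ∀ K : Freq N, ENNReal.ofReal (weight K * ‖∑ j, potCoef r ψ j K‖ ^ 2) ≤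
      ENNReal.ofReal ((N ^ 3 : ℕ) : ℝ) *
        ∑ j, ENNReal.ofReal (weight K) * ‖potCoef r ψ j K‖ₑ ^ 2 := by
    intro K
    have hw := (weight_pos K).le
    have e1 : ∀ j, ENNReal.ofReal (weight K) * ‖potCoef r ψ j K‖ₑ ^ 2 =
        ENNReal.ofReal (weight K * ‖potCoef r ψ j K‖ ^ 2) := fun j => by
      rw [ENNReal.ofReal_mul hw, ENNReal.ofReal_pow (norm_nonneg _), ofReal_norm]
    simp only [e1]
    rw [← ENNReal.ofReal_sum_of_nonneg fun j _ => mul_nonneg hw (sq_nonneg _),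
      ← ENNReal.ofReal_mul (by positivity)]
    refine ENNReal.ofReal_le_ofReal ?_
    rw [← Finset.mul_sum, mul_left_comm]
    refine mul_le_mul_of_nonneg_left ?_ hw
    have h2 := sq_sum_le_card_mul_sum_sq (s := Finset.univ) (f := fun j => ‖potCoef r ψ j K‖)
    rw [Finset.card_univ, Fintype.card_fin] at h2
    exact (pow_le_pow_left₀ (norm_nonneg _) (norm_sum_le _ _) 2).trans h2
  refine (ENNReal.tsum_le_tsum h1).trans ?_
  rw [ENNReal.tsum_mul_left, Summable.tsum_finsetSum fun _ _ => ENNReal.summable]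
  calc _ ≤ ENNReal.ofReal ((N ^ 3 : ℕ) : ℝ) *
        ∑ _j : Fin (N ^ 3), ENNReal.ofReal (potConst N * (‖r‖ ^ 2 * ‖ψ‖ ^ 2)) := by
        gcongr with j
        exact tsum_weight_potCoef_le r ψ j
    _ = _ := by
        have hp := potConst_nonneg (N := N)
        rw [Finset.sum_const, Finset.card_univ, Fintype.card_fin, nsmul_eq_mul,
          ← ENNReal.ofReal_natCast, ← ENNReal.ofReal_mul (by positivity),
          ← ENNReal.ofReal_mul (by positivity)]
        congr 1
        rw [mul_pow, mul_pow, mul_pow, Real.sq_sqrt hp]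
        ring

lemma exists_potential (r : Seq) (ψ : Fermion N) :
    ∃ φ : Fermion N, ∀ K, fc φ K = ∑ j, potCoef r ψ j K := by
  refine exists_fermion ?_ (sum_potCoef_perm r ψ)
  have h := ne_top_of_le_ne_top ENNReal.ofReal_ne_top (tsum_weight_sum_potCoef_le r ψ)
  exact (ENNReal.summable_toReal h).congr fun K =>
    ENNReal.toReal_ofReal (mul_nonneg (weight_pos K).le (sq_nonneg _))

lemma potCoef_add_left (r r' : Seq) (ψ : Fermion N) (j : Fin (N ^ 3)) (K : Freq N) :
    potCoef (r + r') ψ j K = potCoef r ψ j K + potCoef r' ψ j K := by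
  unfold potCoef
  rw [← (summable_potential r ψ j K).tsum_add (summable_potential r' ψ j K)]
  refine tsum_congr fun k => ?_
  rw [lp.coeFn_add, Pi.add_apply, add_mul, add_mul]

lemma potCoef_smul_left (c : ℝ) (r : Seq) (ψ : Fermion N) (j : Fin (N ^ 3)) (K : Freq N) :
    potCoef (c • r) ψ j K = c * potCoef r ψ j K := by
  unfold potCoef
  rw [← tsum_mul_left]
  refine tsum_congr fun k => ?_
  rw [seq_smul_apply, mul_assoc, mul_assoc, mul_assoc]

lemma potCoef_add_right (r : Seq) (ψ ψ' : Fermion N) (j : Fin (N ^ 3)) (K : Freq N) :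
    potCoef r (ψ + ψ') j K = potCoef r ψ j K + potCoef r ψ' j K := by
  unfold potCoef
  rw [← (summable_potential r ψ j K).tsum_add (summable_potential r ψ' j K)]
  refine tsum_congr fun k => ?_
  rw [fc_add, mul_add]

lemma potCoef_smul_right (c : ℝ) (r : Seq) (ψ : Fermion N) (j : Fin (N ^ 3)) (K : Freq N) :
    potCoef r (c • ψ) j K = c * potCoef r ψ j K := by
  unfold potCoef
  rw [← tsum_mul_left]
  refine tsum_congr fun k => ?_
  rw [fc_real_smul, mul_left_comm]

/-- Multiplication by `∑_j (G r)(x_j)` as a function. -/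
def potentialFn (r : Seq) (ψ : Fermion N) : Fermion N := (exists_potential r ψ).choose

lemma fc_potentialFn (r : Seq) (ψ : Fermion N) (K : Freq N) :
    fc (potentialFn r ψ) K = ∑ j, potCoef r ψ j K :=
  (exists_potential r ψ).choose_spec K

lemma norm_potentialFn_le (r : Seq) (ψ : Fermion N) :
    ‖potentialFn r ψ‖ ≤ ((N ^ 3 : ℕ) : ℝ) * Real.sqrt (potConst N) * ‖r‖ * ‖ψ‖ := by
  refine norm_fermion_le (by positivity) ?_
  simp only [fc_potentialFn]
  exact tsum_weight_sum_potCoef_le r ψ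

/-- Multiplication by `∑_j (G r)(x_j)` as a bilinear map. -/
def potentialBilin (N : ℕ) [NeZero N] : Seq →ₗ[ℝ] Fermion N →ₗ[ℝ] Fermion N :=
  LinearMap.mk₂ ℝ potentialFn
    (fun r r' ψ => ext_fc fun K => by
      rw [fc_add, fc_potentialFn, fc_potentialFn, fc_potentialFn, ← Finset.sum_add_distrib]
      exact Finset.sum_congr rfl fun j _ => potCoef_add_left r r' ψ j K)
    (fun c r ψ => ext_fc fun K => by
      rw [fc_real_smul, fc_potentialFn, fc_potentialFn, Finset.mul_sum]
      exact Finset.sum_congr rfl fun j _ => potCoef_smul_left c r ψ j K)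
    (fun r ψ ψ' => ext_fc fun K => by
      rw [fc_add, fc_potentialFn, fc_potentialFn, fc_potentialFn, ← Finset.sum_add_distrib]
      exact Finset.sum_congr rfl fun j _ => potCoef_add_right r ψ ψ' j K)
    (fun c r ψ => ext_fc fun K => by
      rw [fc_real_smul, fc_potentialFn, fc_potentialFn, Finset.mul_sum]
      exact Finset.sum_congr rfl fun j _ => potCoef_smul_right c r ψ j K)

/-- The operator of multiplication by `∑_j (G r)(x_j)` on `ℱ`, where `r` is a charge density given
by its Fourier coefficients. -/
def potential (N : ℕ) [NeZero N] : Seq →L[ℝ] Fermion N →L[ℝ] Fermion N :=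
  (potentialBilin N).mkContinuousOfExistsBound₂
    ⟨((N ^ 3 : ℕ) : ℝ) * Real.sqrt (potConst N), norm_potentialFn_le⟩

lemma fc_potential (r : Seq) (ψ : Fermion N) (K : Freq N) :
    fc (potential N r ψ) K = ∑ j, potCoef r ψ j K :=
  fc_potentialFn r ψ K

omit [NeZero N] in
lemma card_cube_ne_zero [NeZero N] : ((N : ℂ) ^ 3) ≠ 0 :=
  pow_ne_zero 3 (Nat.cast_ne_zero.2 (NeZero.ne N))

lemma summable_inv_freqSq_sq : Summable fun k : Fin 3 → ℤ => ((freqSq N k)⁻¹) ^ 2 := by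
  refine ((summable_weight_inv_sq (N := N)).mul_left (greenConst N ^ 2)).of_nonneg_of_le
    (fun _ => by positivity) fun k => ?_
  rw [← mul_pow]
  exact pow_le_pow_left₀ (inv_freqSq_nonneg k) (inv_freqSq_le k) 2

lemma summable_seq_mul_green (r : Seq) :
    Summable fun k => r k * (((freqSq N k)⁻¹ : ℝ) : ℂ) := by
  refine summable_mul_of_sq (seq_hasSum_sq r).summable ?_
  simpa using summable_inv_freqSq_sq (N := N)

/-- Each fibre over `k` is bounded by half the sum of the two squared ℓ² norms, independently of
`k`, so the absolute summability of `a` suffices. -/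
lemma summable_convolution {Z F : Type*} [AddCommGroup F] (i : Z → F) {a : Z → ℂ} {f g : F → ℂ}
    (ha : Summable fun k => ‖a k‖) (hf : Summable fun K => ‖f K‖ ^ 2)
    (hg : Summable fun K => ‖g K‖ ^ 2) :
    Summable fun p : Z × F => a p.1 * (f p.2 * g (p.2 - i p.1)) := by
  have hgs : ∀ k, Summable fun K => ‖g (K - i k)‖ ^ 2 := fun k =>
    ((Equiv.subRight (i k)).summable_iff (f := fun K => ‖g K‖ ^ 2)).2 hg
  have hk : ∀ k, Summable fun K => ‖f K * g (K - i k)‖ := fun k =>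
    (summable_mul_of_sq hf (hgs k)).norm
  have hB : ∀ k, ∑' K, ‖f K * g (K - i k)‖ ≤
      1 / 2 * (∑' K, ‖f K‖ ^ 2 + ∑' K, ‖g K‖ ^ 2) := by
    intro k
    have e : ∑' K, ‖g (K - i k)‖ ^ 2 = ∑' K, ‖g K‖ ^ 2 :=
      (Equiv.subRight (i k)).tsum_eq fun K => ‖g K‖ ^ 2
    rw [← e, ← hf.tsum_add (hgs k), ← tsum_mul_left]
    refine (hk k).tsum_le_tsum (fun K => ?_) ((hf.add (hgs k)).mul_left _)
    rw [norm_mul]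
    nlinarith [sq_nonneg (‖f K‖ - ‖g (K - i k)‖)]
  refine Summable.of_norm ((summable_prod_of_nonneg fun _ => norm_nonneg _).2 ⟨fun k => ?_, ?_⟩)
  · simp only [norm_mul _ (_ * _)]
    exact (hk k).mul_left _
  · refine (ha.mul_right (1 / 2 * (∑' K, ‖f K‖ ^ 2 + ∑' K, ‖g K‖ ^ 2))).of_nonneg_of_le
      (fun k => tsum_nonneg fun _ => norm_nonneg _) fun k => ?_
    simp only [norm_mul _ (_ * _)]
    rw [tsum_mul_left]
    exact mul_le_mul_of_nonneg_left (hB k) (norm_nonneg _)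

/-- The exchange of sums which says that a potential integrated against a polarised density is a
matrix element of the multiplication operator. -/
lemma hasSum_convolution {Z F : Type*} [AddCommGroup F] (i : Z → F) {a : Z → ℂ} {f g : F → ℂ}
    (ha : Summable fun k => ‖a k‖) (hf : Summable fun K => ‖f K‖ ^ 2)
    (hg : Summable fun K => ‖g K‖ ^ 2) :
    HasSum (fun k => a k * ∑' K, f K * g (K - i k)) (∑' K, f K * ∑' k, a k * g (K - i k)) ∧
      Summable fun K => f K * ∑' k, a k * g (K - i k) := by
  have hs := summable_convolution i ha hf hg
  have e0 : ∀ K, ∑' k, a k * (f K * g (K - i k)) = f K * ∑' k, a k * g (K - i k) := fun K => by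
    rw [← tsum_mul_left]
    exact tsum_congr fun k => by ring
  constructor
  · have e1 : ∑' p : Z × F, a p.1 * (f p.2 * g (p.2 - i p.1)) =
        ∑' K, f K * ∑' k, a k * g (K - i k) := by
      have hc := Summable.tsum_comm (f := fun k K => a k * (f K * g (K - i k))) hs
      rw [hs.tsum_prod, ← hc]
      exact tsum_congr e0
    have h2 := hs.hasSum.prod_fiberwise fun k => (hs.prod_factor k).hasSum
    rw [e1] at h2
    refine h2.congr_fun fun k => ?_
    exact tsum_mul_left.symm
  · have h := hs.prod_symm.prod
    exact h.congr e0

lemma hasSum_corr_mul (r : Seq) (ψ χ : Fermion N) (j : Fin (N ^ 3)) :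
    HasSum (fun k => r k * ((freqSq N k)⁻¹ : ℝ) * starRingEnd ℂ (corr j χ ψ k))
      (∑' K, starRingEnd ℂ (fc χ K) * potCoef r ψ j K) ∧
      Summable fun K => starRingEnd ℂ (fc χ K) * potCoef r ψ j K := by
  have h := hasSum_convolution (fun k : Fin 3 → ℤ => (Pi.single j k : Freq N))
    (a := fun k => r k * (((freqSq N k)⁻¹ : ℝ) : ℂ)) (f := fun K => starRingEnd ℂ (fc χ K))
    (g := fc ψ) (summable_seq_mul_green r).norm (by simpa using summable_fc_sq χ)
    (summable_fc_sq ψ)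
  refine ⟨h.1.congr_fun fun k => ?_, h.2⟩
  rw [corr, Complex.conj_tsum]
  congr 1
  refine tsum_congr fun K => ?_
  rw [map_mul, Complex.conj_conj]

/-- The link between the multiplication operator and the Coulomb form. The factor N³ cancels the
normalisation of `pairDensity`. -/
lemma hasSum_inner_potential (r : Seq) (ψ χ : Fermion N) :
    HasSum (fun k => (N : ℂ) ^ 3 * (r k * ((freqSq N k)⁻¹ : ℝ) *
      starRingEnd ℂ (pairDensity N χ ψ k))) (inner ℂ (waveFn χ) (waveFn (potential N r ψ))) := by
  have h2 := hasSum_sum (s := Finset.univ) fun j _ => (hasSum_corr_mul r ψ χ j).1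
  have h3 : ∑ j, ∑' K, starRingEnd ℂ (fc χ K) * potCoef r ψ j K =
      inner ℂ (waveFn χ) (waveFn (potential N r ψ)) := by
    refine Eq.trans ?_ (hasSum_coef_mul (waveFn χ) (waveFn (potential N r ψ))).tsum_eq
    refine (Summable.tsum_finsetSum fun j _ => (hasSum_corr_mul r ψ χ j).2).symm.trans ?_
    refine tsum_congr fun K => ?_
    change _ = starRingEnd ℂ (fc χ K) * fc (potential N r ψ) K
    rw [fc_potential, Finset.mul_sum]
  rw [h3] at h2
  refine h2.congr_fun fun k => ?_
  rw [pairDensity_apply, map_mul, map_sum, ← Finset.mul_sum]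
  have := card_cube_ne_zero (N := N)
  rw [map_inv₀, map_pow, Complex.conj_natCast, mul_left_comm,
    mul_inv_cancel_left₀ this]

/-! ### Reality -/

/-- The Fourier coefficients of a real function. -/
def IsRealSeq (r : Seq) : Prop := ∀ k, r (-k) = starRingEnd ℂ (r k)

lemma corr_neg (j : Fin (N ^ 3)) (ψ χ : Fermion N) (k : Fin 3 → ℤ) :
    corr j ψ χ (-k) = starRingEnd ℂ (corr j χ ψ k) := by
  rw [corr, corr, Complex.conj_tsum, ← (Equiv.subRight (Pi.single j k)).tsum_eq]
  refine tsum_congr fun K => ?_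
  rw [map_mul, Complex.conj_conj, Equiv.subRight_apply, Pi.single_neg, sub_neg_eq_add,
    sub_add_cancel, mul_comm]

lemma pairDensity_neg (ψ χ : Fermion N) (k : Fin 3 → ℤ) :
    pairDensity N ψ χ (-k) = starRingEnd ℂ (pairDensity N χ ψ k) := by
  simp [pairDensity_apply, corr_neg]

lemma isRealSeq_pairDensity (ψ : Fermion N) : IsRealSeq (pairDensity N ψ ψ) :=
  fun k => pairDensity_neg ψ ψ k

lemma IsRealSeq.add {r s : Seq} (hr : IsRealSeq r) (hs : IsRealSeq s) : IsRealSeq (r + s) := by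
  intro k; simp [hr k, hs k]

lemma IsRealSeq.smul {r : Seq} (c : ℝ) (hr : IsRealSeq r) : IsRealSeq (c • r) := by
  intro k; simp only [seq_smul_apply, hr k, map_mul, Complex.conj_ofReal]

/-- A real charge density has a real potential, and multiplication by a real function is symmetric.
In coefficients this is the substitution k ↦ -k. -/
lemma inner_potential_symm {r : Seq} (hr : IsRealSeq r) (ψ χ : Fermion N) :
    inner ℂ (waveFn χ) (waveFn (potential N r ψ)) =
      inner ℂ (waveFn (potential N r χ)) (waveFn ψ) := by
  refine Eq.trans ?_ (inner_conj_symm (𝕜 := ℂ) (waveFn (potential N r χ)) (waveFn ψ))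
  refine (hasSum_inner_potential r ψ χ).unique ?_
  have h0 := (hasSum_inner_potential r χ ψ).mapL Complex.conjCLE.toContinuousLinearMap
  have h := (Equiv.neg (Fin 3 → ℤ)).hasSum_iff.2 h0
  refine h.congr_fun fun k => ?_
  change _ = starRingEnd ℂ ((N : ℂ) ^ 3 * (r (-k) * ((freqSq N (-k))⁻¹ : ℝ) *
    starRingEnd ℂ (pairDensity N ψ χ (-k))))
  simp only [hr k, freqSq_neg, pairDensity_neg, map_mul, Complex.conj_conj, Complex.conj_ofReal,
    map_pow, Complex.conj_natCast]

end Potential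

/-! ### The Coulomb form -/

section Coulomb

variable {N : ℕ} [NeZero N]

lemma norm_sq_mul_green_le (r : Seq) (k : Fin 3 → ℤ) :
    ‖r k * (((freqSq N k)⁻¹ : ℝ) : ℂ)‖ ^ 2 ≤ greenConst N ^ 2 * ‖r k‖ ^ 2 := by
  rw [norm_mul, mul_pow, mul_comm, Complex.norm_real, Real.norm_of_nonneg (inv_freqSq_nonneg k)]
  exact mul_le_mul_of_nonneg_right
    (pow_le_pow_left₀ (inv_freqSq_nonneg k) (inv_freqSq_le_const k) 2) (by positivity)

lemma summable_mul_green_sq (r : Seq) :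
    Summable fun k => ‖r k * (((freqSq N k)⁻¹ : ℝ) : ℂ)‖ ^ 2 :=
  ((seq_hasSum_sq r).summable.mul_left (greenConst N ^ 2)).of_nonneg_of_le
    (fun _ => by positivity) (norm_sq_mul_green_le r)

/-- The operator `G` on the Fourier side. -/
def greenSeq (N : ℕ) [NeZero N] : Seq →L[ℝ] Seq :=
  LinearMap.mkContinuous
    { toFun := fun r => seqMk _ (summable_mul_green_sq (N := N) r)
      map_add' := fun r s => by
        ext k
        simp only [seqMk_apply, lp.coeFn_add, Pi.add_apply, add_mul]
      map_smul' := fun c r => by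
        ext k
        simp only [RingHom.id_apply, seqMk_apply, seq_smul_apply, mul_assoc] }
    (greenConst N) fun r => by
      have h1 := seq_hasSum_sq (seqMk _ (summable_mul_green_sq (N := N) r))
      have h2 := (seq_hasSum_sq r).mul_left (greenConst N ^ 2)
      rw [← mul_pow] at h2
      exact le_of_sq_le_sq (hasSum_le (norm_sq_mul_green_le r) h1 h2)
        (mul_nonneg greenConst_pos.le (norm_nonneg _))

/-- The Coulomb form `(ρ, Gρ')` on the Fourier side. -/
def coulomb (N : ℕ) [NeZero N] : Seq →L[ℝ] Seq →L[ℝ] ℝ :=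
  ((N : ℝ) ^ 3) • (innerSL ℝ).comp (greenSeq N)

lemma coulomb_eq_inner (r s : Seq) :
    coulomb N r s = (N : ℝ) ^ 3 * inner ℝ (greenSeq N r) s := by
  rw [coulomb, smul_apply, smul_apply, smul_eq_mul]; rfl

lemma hasSum_coulomb (r s : Seq) :
    HasSum (fun k => (N : ℝ) ^ 3 * ((freqSq N k)⁻¹ * (starRingEnd ℂ (r k) * s k).re))
      (coulomb N r s) := by
  rw [coulomb_eq_inner]
  refine ((lp.hasSum_inner (𝕜 := ℝ) (greenSeq N r) s).mul_left ((N : ℝ) ^ 3)).congr_fun fun k => ?_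
  have h : inner ℝ (greenSeq N r k) (s k) =
      (s k * starRingEnd ℂ (r k * (((freqSq N k)⁻¹ : ℝ) : ℂ))).re := Complex.inner _ _
  have h' : s k * starRingEnd ℂ (r k * (((freqSq N k)⁻¹ : ℝ) : ℂ)) =
      (((freqSq N k)⁻¹ : ℝ) : ℂ) * (starRingEnd ℂ (r k) * s k) := by
    rw [map_mul, Complex.conj_ofReal]; ring
  rw [h, h', Complex.re_ofReal_mul]

lemma coulomb_symm (r s : Seq) : coulomb N r s = coulomb N s r := by
  refine (hasSum_coulomb r s).unique ((hasSum_coulomb s r).congr_fun fun k => ?_)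
  congr 2
  simp [mul_comm]

/-- This sign is what lets the total energy bound the kinetic energies in
`norm_psi_le_of_energyL_le` and `norm_mom_le_of_energyL_le`. -/
lemma coulomb_self_nonneg (r : Seq) : 0 ≤ coulomb N r r := by
  refine (hasSum_coulomb r r).nonneg fun k => ?_
  rw [← Complex.normSq_eq_conj_mul_self, Complex.ofReal_re]
  have := inv_freqSq_nonneg (N := N) k
  have := Complex.normSq_nonneg (r k)
  positivity

omit [NeZero N] in
variable (N) in
lemma re_mul_green_mul_conj (g : ℝ) (z w : ℂ) :
    ((N : ℂ) ^ 3 * (z * (g : ℂ) * starRingEnd ℂ w)).re =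
      (N : ℝ) ^ 3 * (g * (starRingEnd ℂ z * w).re) := by
  have : (N : ℂ) ^ 3 * (z * (g : ℂ) * starRingEnd ℂ w) =
      (((N : ℝ) ^ 3 * g : ℝ) : ℂ) * (z * starRingEnd ℂ w) := by
    push_cast; ring
  rw [this, Complex.re_ofReal_mul, mul_assoc]
  congr 2
  simp

lemma re_inner_potential (r : Seq) (ψ χ : Fermion N) :
    (inner ℂ (waveFn χ) (waveFn (potential N r ψ))).re = coulomb N r (pairDensity N χ ψ) := by
  refine (Complex.hasSum_re (hasSum_inner_potential r ψ χ)).unique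
    ((hasSum_coulomb r (pairDensity N χ ψ)).congr_fun fun k => ?_)
  exact (re_mul_green_mul_conj N (freqSq N k)⁻¹ (r k) (pairDensity N χ ψ k))

lemma conj_inner_L2 (u v : L2 N) : starRingEnd ℂ (inner ℂ u v) = inner ℂ v u :=
  inner_conj_symm (𝕜 := ℂ) v u

/-- Exchanging ψ and χ conjugates the polarised density as a function, and a real potential sees
only the real part of its integral. -/
lemma coulomb_pairDensity_symm {r : Seq} (hr : IsRealSeq r) (ψ χ : Fermion N) :
    coulomb N r (pairDensity N χ ψ) = coulomb N r (pairDensity N ψ χ) := by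
  have h1 := re_inner_potential r ψ χ
  have h2 := re_inner_potential r χ ψ
  have h3 := congrArg Complex.re (inner_potential_symm hr ψ χ)
  have h4 := congrArg Complex.re (conj_inner_L2 (waveFn ψ) (waveFn (potential N r χ)))
  exact h1.symm.trans (h3.trans ((h4.symm.trans (Complex.conj_re _)).trans h2))

/-- A symmetric operator has real expectation values. Hence the interaction does not change the
charge. -/
lemma im_inner_potential_self {r : Seq} (hr : IsRealSeq r) (ψ : Fermion N) :
    (inner ℂ (waveFn ψ) (waveFn (potential N r ψ))).im = 0 := by
  have h := conj_inner_L2 (waveFn ψ) (waveFn (potential N r ψ))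
  exact Complex.conj_eq_iff_im.1 (h.trans (inner_potential_symm hr ψ ψ).symm)

end Coulomb

/-! ## The free evolution -/

section Propagator

variable {N : ℕ} [NeZero N]

/-- The kinetic phase `-|ξ_K|² t / 2`. -/
def phase (t : ℝ) (K : Freq N) : ℂ := Complex.exp (((-(t * (weight K - 1) / 2) : ℝ) : ℂ) * Complex.I)

omit [NeZero N] in
@[simp] lemma norm_phase (t : ℝ) (K : Freq N) : ‖phase t K‖ = 1 := Complex.norm_exp_ofReal_mul_I _

omit [NeZero N] in
@[simp] lemma phase_zero (K : Freq N) : phase 0 K = 1 := by simp [phase]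

omit [NeZero N] in
lemma phase_add (s t : ℝ) (K : Freq N) : phase (s + t) K = phase s K * phase t K := by
  rw [phase, phase, phase, ← Complex.exp_add]
  congr 1
  push_cast; ring

omit [NeZero N] in
lemma hasDerivAt_phase (t : ℝ) (K : Freq N) :
    HasDerivAt (fun t => phase t K) (-(Complex.I / 2) * (weight K - 1) * phase t K) t := by
  have h0 : HasDerivAt (fun t : ℝ => -(t * (weight K - 1) / 2)) (-((weight K - 1) / 2)) t := by
    have := (((hasDerivAt_id t).mul_const (weight K - 1)).div_const 2).neg
    rw [one_mul] at this
    exact this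
  have h1 := (h0.ofReal_comp.mul_const Complex.I).cexp
  refine h1.congr_deriv ?_
  rw [phase, mul_comm]
  push_cast
  ring

omit [NeZero N] in
lemma continuous_phase (K : Freq N) : Continuous fun t => phase t K :=
  continuous_iff_continuousAt.2 fun t => (hasDerivAt_phase t K).continuousAt

lemma exists_freeEvol (t : ℝ) (ψ : Fermion N) :
    ∃ φ : Fermion N, ∀ K, fc φ K = phase t K * fc ψ K := by
  refine exists_fermion ?_ fun π K => ?_
  · simpa using (hasSum_fc_sq ψ).summable
  · rw [fc_perm]
    simp only [phase, weight_comp_perm]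
    ring

/-- The free Schrödinger evolution as a function. -/
def freeEvolFn (t : ℝ) (ψ : Fermion N) : Fermion N := (exists_freeEvol t ψ).choose

lemma fc_freeEvolFn (t : ℝ) (ψ : Fermion N) (K : Freq N) :
    fc (freeEvolFn t ψ) K = phase t K * fc ψ K := (exists_freeEvol t ψ).choose_spec K

/-- The free Schrödinger evolution `e^{itΔ/2}` on `ℱ`. -/
def freeEvol (t : ℝ) : Fermion N →ₗᵢ[ℝ] Fermion N where
  toFun := freeEvolFn t
  map_add' ψ φ := ext_fc fun K => by
    rw [fc_add, fc_freeEvolFn, fc_freeEvolFn, fc_freeEvolFn, fc_add, mul_add]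
  map_smul' c ψ := ext_fc fun K => by
    rw [RingHom.id_apply, fc_real_smul, fc_freeEvolFn, fc_freeEvolFn, fc_real_smul, mul_left_comm]
  norm_map' ψ := by
    have h1 := hasSum_fc_sq (freeEvolFn t ψ)
    simp only [fc_freeEvolFn, norm_mul, norm_phase, one_mul] at h1
    have h2 := h1.unique (hasSum_fc_sq ψ)
    exact (sq_eq_sq₀ (norm_nonneg _) (norm_nonneg _)).1 h2

@[simp] lemma fc_freeEvol (t : ℝ) (ψ : Fermion N) (K : Freq N) :
    fc (freeEvol t ψ) K = phase t K * fc ψ K := fc_freeEvolFn t ψ K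

@[simp] lemma freeEvol_zero (ψ : Fermion N) : freeEvol 0 ψ = ψ :=
  ext_fc fun K => by simp

lemma freeEvol_freeEvol (s t : ℝ) (ψ : Fermion N) :
    freeEvol s (freeEvol t ψ) = freeEvol (s + t) ψ :=
  ext_fc fun K => by simp [phase_add, mul_assoc]

@[simp] lemma freeEvol_freeEvol_neg (t : ℝ) (ψ : Fermion N) :
    freeEvol t (freeEvol (-t) ψ) = ψ := by simp [freeEvol_freeEvol]

/-- Strong continuity: every phase is continuous, and since phases differ by at most 2 the norm
series is dominated by 4 times the series of ‖ψ‖². -/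
lemma continuous_freeEvol (ψ : Fermion N) : Continuous fun t => freeEvol t ψ := by
  rw [continuous_iff_continuousAt]
  intro t
  rw [ContinuousAt, tendsto_iff_norm_sub_tendsto_zero]
  have h1 : ∀ s, ‖freeEvol s ψ - freeEvol t ψ‖ ^ 2 =
      ∑' K, weight K * ‖(phase s K - phase t K) * fc ψ K‖ ^ 2 := by
    intro s
    rw [← (hasSum_fc_sq _).tsum_eq]
    exact tsum_congr fun K => by rw [fc_sub, fc_freeEvol, fc_freeEvol, sub_mul]
  have h2 : Continuous fun s => ∑' K, weight K * ‖(phase s K - phase t K) * fc ψ K‖ ^ 2 := by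
    refine continuous_tsum (fun K => ?_) ((hasSum_fc_sq ψ).summable.mul_left 4) fun K s => ?_
    · have := continuous_phase K
      fun_prop
    · rw [Real.norm_of_nonneg (mul_nonneg (weight_pos K).le (sq_nonneg _)), norm_mul, mul_pow]
      have h3 : ‖phase s K - phase t K‖ ≤ 2 := by
        refine (norm_sub_le _ _).trans ?_
        simp only [norm_phase]; norm_num
      have h4 : ‖phase s K - phase t K‖ ^ 2 ≤ 4 := by nlinarith [norm_nonneg (phase s K - phase t K)]
      have h5 : 0 ≤ weight K * ‖fc ψ K‖ ^ 2 := mul_nonneg (weight_pos K).le (sq_nonneg _)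
      nlinarith
  have h3 := h2.tendsto t
  simp only [← h1, sub_self] at h3
  have h4 := h3.sqrt
  simpa using h4

lemma freeEvol_sub (t : ℝ) (ψ φ : Fermion N) :
    freeEvol t (ψ - φ) = freeEvol t ψ - freeEvol t φ :=
  ext_fc fun K => by simp only [fc_freeEvol, fc_sub, mul_sub]

lemma norm_freeEvol (t : ℝ) (ψ : Fermion N) : ‖freeEvol t ψ‖ = ‖ψ‖ :=
  (freeEvol t).norm_map ψ

lemma norm_freeEvol_sub_le (s t : ℝ) (ψ φ : Fermion N) :
    ‖freeEvol s ψ - freeEvol t φ‖ ≤ ‖ψ - φ‖ + ‖freeEvol s φ - freeEvol t φ‖ := by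
  have h2 := norm_sub_le_norm_sub_add_norm_sub (freeEvol s ψ) (freeEvol s φ) (freeEvol t φ)
  have e := congrArg norm (freeEvol_sub s ψ φ)
  have e' := norm_freeEvol s (ψ - φ)
  linarith

/-- Because the evolution is isometric, strong continuity upgrades to joint continuity in time and
state. -/
lemma tendsto_freeEvol {α : Type*} {l : Filter α} {f : α → ℝ} {g : α → Fermion N} {t : ℝ}
    {ψ : Fermion N} (hf : Tendsto f l (𝓝 t)) (hg : Tendsto g l (𝓝 ψ)) :
    Tendsto (fun x => freeEvol (f x) (g x)) l (𝓝 (freeEvol t ψ)) := by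
  rw [tendsto_iff_norm_sub_tendsto_zero]
  have h0 : Tendsto (fun y => freeEvol (f y) ψ) l (𝓝 (freeEvol t ψ)) :=
    ((continuous_freeEvol ψ).tendsto t).comp hf
  have h1 := (tendsto_iff_norm_sub_tendsto_zero.1 hg).add
    (tendsto_iff_norm_sub_tendsto_zero.1 h0)
  rw [add_zero] at h1
  exact squeeze_zero (fun _ => norm_nonneg _) (fun y => norm_freeEvol_sub_le _ _ _ _) h1

lemma continuous_freeEvol_comp {α : Type*} [TopologicalSpace α] {f : α → ℝ} {g : α → Fermion N}
    (hf : Continuous f) (hg : Continuous g) : Continuous fun x => freeEvol (f x) (g x) :=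
  continuous_iff_continuousAt.2 fun x => tendsto_freeEvol (hf.tendsto x) (hg.tendsto x)

end Propagator

/-! ### Differentiability of translations on the Fourier side -/

section Translate

variable {N : ℕ}

lemma seq_summable_of_le {f : (Fin 3 → ℤ) → ℂ} {w : Seq} {B : ℝ}
    (h : ∀ k, ‖f k‖ ≤ B * ‖w k‖) : Summable fun k => ‖f k‖ ^ 2 :=
  ((seq_hasSum_sq w).summable.mul_left (B ^ 2)).of_nonneg_of_le (fun _ => by positivity) fun k => by
    rw [← mul_pow]
    exact pow_le_pow_left₀ (norm_nonneg _) (h k) 2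

lemma seq_norm_le_of_le {f w : Seq} {B : ℝ} (hB : 0 ≤ B) (h : ∀ k, ‖f k‖ ≤ B * ‖w k‖) :
    ‖f‖ ≤ B * ‖w‖ := by
  have h2 := (seq_hasSum_sq w).mul_left (B ^ 2)
  rw [← mul_pow] at h2
  refine le_of_sq_le_sq (hasSum_le (fun k => ?_) (seq_hasSum_sq f) h2)
    (mul_nonneg hB (norm_nonneg _))
  rw [← mul_pow]
  exact pow_le_pow_left₀ (norm_nonneg _) (h k) 2

/-- `ξ · v` for `ξ = 2πk/N`. -/
def freqDot (N : ℕ) (k : Fin 3 → ℤ) (v : Space) : ℝ := ∑ a, xi N (k a) * v a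

lemma freqDot_add (k : Fin 3 → ℤ) (v u : Space) :
    freqDot N k (v + u) = freqDot N k v + freqDot N k u := by
  simp [freqDot, mul_add, Finset.sum_add_distrib]

lemma freqDot_smul (k : Fin 3 → ℤ) (c : ℝ) (v : Space) :
    freqDot N k (c • v) = c * freqDot N k v := by
  simp only [freqDot, Finset.mul_sum, PiLp.smul_apply, smul_eq_mul]
  exact Finset.sum_congr rfl fun a _ => by ring

lemma freqDot_neg_freq (k : Fin 3 → ℤ) (v : Space) : freqDot N (-k) v = -freqDot N k v := by
  simp [freqDot, xi, neg_div]

lemma freqDot_sq_le (k : Fin 3 → ℤ) (v : Space) :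
    freqDot N k v ^ 2 ≤ freqSq N k * ‖v‖ ^ 2 := by
  rw [freqSq_eq, EuclideanSpace.norm_sq_eq, freqDot]
  simpa using Finset.sum_mul_sq_le_sq_mul_sq Finset.univ (fun a => xi N (k a)) (fun a => v a)

lemma abs_freqDot_le (k : Fin 3 → ℤ) (v : Space) :
    |freqDot N k v| ≤ (1 + freqSq N k) * ‖v‖ := by
  have h0 := freqSq_nonneg (N := N) k
  refine abs_le_of_sq_le_sq ((freqDot_sq_le k v).trans ?_) (by positivity)
  rw [mul_pow]
  exact mul_le_mul_of_nonneg_right (by nlinarith) (sq_nonneg _)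

/-- Two powers of ξ cost a single factor 1 + |ξ|². Therefore square summability of w = (1 + |ξ|²)σ̂
already controls second-order differences of translates. -/
lemma abs_freqDot_mul_le (k : Fin 3 → ℤ) (v u : Space) :
    |freqDot N k v| * |freqDot N k u| ≤ (1 + freqSq N k) * (‖v‖ * ‖u‖) := by
  have h0 := freqSq_nonneg (N := N) k
  refine abs_le_of_sq_le_sq' ?_ (by positivity) |>.2
  calc (|freqDot N k v| * |freqDot N k u|) ^ 2
      = freqDot N k v ^ 2 * freqDot N k u ^ 2 := by rw [mul_pow, sq_abs, sq_abs]
    _ ≤ (freqSq N k * ‖v‖ ^ 2) * (freqSq N k * ‖u‖ ^ 2) :=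
        mul_le_mul (freqDot_sq_le k v) (freqDot_sq_le k u) (sq_nonneg _) (by positivity)
    _ = freqSq N k ^ 2 * (‖v‖ * ‖u‖) ^ 2 := by ring
    _ ≤ (1 + freqSq N k) ^ 2 * (‖v‖ * ‖u‖) ^ 2 :=
        mul_le_mul_of_nonneg_right (by nlinarith) (sq_nonneg _)
    _ = _ := by ring

lemma character_neg_toTorus (k : Fin 3 → ℤ) (v : Space) :
    character N (-k) (toTorus N v) = Complex.exp (Complex.I * ((-freqDot N k v : ℝ) : ℂ)) := by
  rw [character_toTorus, ← freqDot_neg_freq]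
  rfl

/-- For |θ| ≤ 1 this is the power series bound. For larger |θ| the terms e^{iθ} - 1 and iθ are each
at most |θ| ≤ |θ|². -/
lemma norm_exp_sub_one_sub_le (θ : ℝ) :
    ‖Complex.exp (Complex.I * θ) - 1 - Complex.I * θ‖ ≤ 2 * |θ| ^ 2 := by
  by_cases h : |θ| ≤ 1
  · have hx : ‖Complex.I * (θ : ℂ)‖ = |θ| := by simp
    have := Complex.norm_exp_sub_one_sub_id_le (x := Complex.I * θ) (hx.le.trans h)
    rw [hx] at this
    nlinarith [sq_nonneg |θ|]
  · have h1 := norm_sub_le (Complex.exp (Complex.I * θ) - 1) (Complex.I * θ)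
    have h2 := Real.norm_exp_I_mul_ofReal_sub_one_le (x := θ)
    have h3 : ‖Complex.I * (θ : ℂ)‖ = |θ| := by simp
    rw [Real.norm_eq_abs] at h2
    nlinarith

/-- The weight `(1 + |ξ|²)⁻¹`. -/
def bessel (N : ℕ) (k : Fin 3 → ℤ) : ℝ := (1 + freqSq N k)⁻¹

lemma bessel_pos (k : Fin 3 → ℤ) : 0 < bessel N k := by
  have h0 := freqSq_nonneg (N := N) k
  unfold bessel; positivity

lemma bessel_mul_le {k : Fin 3 → ℤ} {a b : ℝ} (h : a ≤ (1 + freqSq N k) * b) :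
    bessel N k * a ≤ b := by
  have h0 := freqSq_nonneg (N := N) k
  have := mul_le_mul_of_nonneg_left h (bessel_pos (N := N) k).le
  rwa [← mul_assoc, bessel, inv_mul_cancel₀ (by positivity), one_mul] at this

lemma bessel_le_one (k : Fin 3 → ℤ) : bessel N k ≤ 1 := by
  have h0 := freqSq_nonneg (N := N) k
  have := bessel_mul_le (N := N) (k := k) (a := 1) (b := 1) (by linarith)
  linarith

lemma norm_translate_le (w : Seq) (y : Torus N) (k : Fin 3 → ℤ) :
    ‖(bessel N k : ℂ) * character N (-k) y * w k‖ ≤ 1 * ‖w k‖ := by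
  rw [norm_mul, norm_mul, norm_character, Complex.norm_real, Real.norm_of_nonneg (bessel_pos k).le,
    mul_one]
  exact mul_le_mul_of_nonneg_right (bessel_le_one k) (norm_nonneg _)

/-- The Fourier coefficients of `x ↦ f(x - y)`, where `f` has the coefficients
`(1 + |ξ|²)⁻¹ w`. -/
def translateSeq (w : Seq) (y : Torus N) : Seq :=
  seqMk (fun k => (bessel N k : ℂ) * character N (-k) y * w k)
    (seq_summable_of_le (norm_translate_le w y))

@[simp] lemma translateSeq_apply (w : Seq) (y : Torus N) (k : Fin 3 → ℤ) :
    translateSeq w y k = (bessel N k : ℂ) * character N (-k) y * w k := rfl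

lemma norm_translateDeriv_le (w : Seq) (y : Torus N) (v : Space) (k : Fin 3 → ℤ) :
    ‖-Complex.I * freqDot N k v * ((bessel N k : ℂ) * character N (-k) y * w k)‖ ≤
      ‖v‖ * ‖w k‖ := by
  rw [norm_mul, norm_mul, norm_mul, norm_mul, norm_character, Complex.norm_real, Complex.norm_real,
    Real.norm_of_nonneg (bessel_pos k).le, mul_one, norm_neg, Complex.norm_I, one_mul,
    ← mul_assoc, mul_comm ‖freqDot N k v‖]
  exact mul_le_mul_of_nonneg_right (bessel_mul_le (abs_freqDot_le k v)) (norm_nonneg _)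

/-- The derivative of `translateSeq` with respect to the translation. -/
def translateSeqDeriv (w : Seq) (y : Torus N) : Space →L[ℝ] Seq :=
  LinearMap.mkContinuous
    { toFun := fun v => seqMk
        (fun k => -Complex.I * freqDot N k v * ((bessel N k : ℂ) * character N (-k) y * w k))
        (seq_summable_of_le (norm_translateDeriv_le w y v))
      map_add' := fun u v => by
        ext k
        simp only [seqMk_apply, lp.coeFn_add, Pi.add_apply, freqDot_add, Complex.ofReal_add]
        ring
      map_smul' := fun c v => by
        ext k
        simp only [RingHom.id_apply, seqMk_apply, seq_smul_apply, freqDot_smul, Complex.ofReal_mul]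
        ring }
    ‖w‖ fun v => by
      exact (seq_norm_le_of_le (norm_nonneg _) (norm_translateDeriv_le w y v)).trans_eq
        (mul_comm _ _)

@[simp] lemma translateSeqDeriv_apply (w : Seq) (y : Torus N) (v : Space) (k : Fin 3 → ℤ) :
    translateSeqDeriv w y v k =
      -Complex.I * freqDot N k v * ((bessel N k : ℂ) * character N (-k) y * w k) := rfl

lemma norm_translateSeq_le (w : Seq) (y : Torus N) : ‖translateSeq w y‖ ≤ ‖w‖ := by
  simpa using seq_norm_le_of_le (f := translateSeq w y) zero_le_one (norm_translate_le w y)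

lemma norm_translateSeqDeriv_le (w : Seq) (y : Torus N) : ‖translateSeqDeriv w y‖ ≤ ‖w‖ :=
  LinearMap.mkContinuous_norm_le _ (norm_nonneg _) _

lemma norm_bessel_mul (k : Fin 3 → ℤ) (y : Torus N) (z u : ℂ) :
    ‖z * ((bessel N k : ℂ) * character N (-k) y * u)‖ = bessel N k * ‖z‖ * ‖u‖ := by
  rw [norm_mul, norm_mul, norm_mul, norm_character, Complex.norm_real,
    Real.norm_of_nonneg (bessel_pos k).le]
  ring

lemma norm_translateSeq_sub_le (w : Seq) (y : Torus N) (v : Space) :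
    ‖translateSeq w (y + toTorus N v) - translateSeq w y‖ ≤ ‖v‖ * ‖w‖ := by
  refine seq_norm_le_of_le (norm_nonneg _) fun k => ?_
  have e : (translateSeq w (y + toTorus N v) - translateSeq w y) k =
      (Complex.exp (Complex.I * ((-freqDot N k v : ℝ) : ℂ)) - 1) *
        ((bessel N k : ℂ) * character N (-k) y * w k) := by
    rw [lp.coeFn_sub, Pi.sub_apply, translateSeq_apply, translateSeq_apply, character_add,
      character_neg_toTorus]
    ring
  rw [e, norm_bessel_mul]
  refine mul_le_mul_of_nonneg_right (bessel_mul_le ?_) (norm_nonneg _)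
  refine Real.norm_exp_I_mul_ofReal_sub_one_le.trans ?_
  rw [norm_neg]
  exact abs_freqDot_le k v

/-- One power of ξ comes from the direction of differentiation, the other from the increment of the
phase; the weight `bessel` absorbs both. -/
lemma norm_translateSeqDeriv_sub_le (w : Seq) (y : Torus N) (v : Space) :
    ‖translateSeqDeriv w (y + toTorus N v) - translateSeqDeriv w y‖ ≤ ‖v‖ * ‖w‖ := by
  refine ContinuousLinearMap.opNorm_le_bound _ (by positivity) fun u => ?_
  have h1 : ‖translateSeqDeriv w (y + toTorus N v) u - translateSeqDeriv w y u‖ ≤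
      (‖u‖ * ‖v‖) * ‖w‖ := by
    refine seq_norm_le_of_le (by positivity) fun k => ?_
    have e : (translateSeqDeriv w (y + toTorus N v) u - translateSeqDeriv w y u) k =
        (-Complex.I * freqDot N k u * (Complex.exp (Complex.I * ((-freqDot N k v : ℝ) : ℂ)) - 1)) *
          ((bessel N k : ℂ) * character N (-k) y * w k) := by
      rw [lp.coeFn_sub, Pi.sub_apply, translateSeqDeriv_apply, translateSeqDeriv_apply,
        character_add, character_neg_toTorus]
      ring
    rw [e, norm_bessel_mul]
    refine mul_le_mul_of_nonneg_right (bessel_mul_le ?_) (norm_nonneg _)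
    rw [norm_mul, norm_mul, norm_neg, Complex.norm_I, one_mul, Complex.norm_real]
    refine le_trans ?_ (abs_freqDot_mul_le k u v)
    refine mul_le_mul_of_nonneg_left ?_ (norm_nonneg _)
    refine Real.norm_exp_I_mul_ofReal_sub_one_le.trans ?_
    rw [norm_neg, Real.norm_eq_abs]
  rw [sub_apply]
  linarith

lemma norm_translateSeq_taylor_le (w : Seq) (y : Torus N) (v : Space) :
    ‖translateSeq w (y + toTorus N v) - translateSeq w y - translateSeqDeriv w y v‖ ≤
      2 * ‖v‖ ^ 2 * ‖w‖ := by
  refine seq_norm_le_of_le (by positivity) fun k => ?_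
  have e : (translateSeq w (y + toTorus N v) - translateSeq w y - translateSeqDeriv w y v) k =
      (Complex.exp (Complex.I * ((-freqDot N k v : ℝ) : ℂ)) - 1 -
        Complex.I * ((-freqDot N k v : ℝ) : ℂ)) *
        ((bessel N k : ℂ) * character N (-k) y * w k) := by
    rw [lp.coeFn_sub, Pi.sub_apply, lp.coeFn_sub, Pi.sub_apply, translateSeq_apply,
      translateSeq_apply, translateSeqDeriv_apply, character_add, character_neg_toTorus]
    push_cast
    ring
  rw [e, norm_bessel_mul]
  refine mul_le_mul_of_nonneg_right (bessel_mul_le ?_) (norm_nonneg _)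
  refine (norm_exp_sub_one_sub_le _).trans ?_
  have := abs_freqDot_mul_le (N := N) k v v
  rw [abs_neg]
  nlinarith

lemma toTorus_add (u v : Fin 3 → ℝ) : toTorus N (u + v) = toTorus N u + toTorus N v := by
  funext a; simp [toTorus]

lemma add_toTorus_eq (y : Torus N) (u v : Space) :
    y + toTorus N v = (y + toTorus N u) + toTorus N (v - u : Space) := by
  rw [add_assoc, ← toTorus_add]
  congr 2
  ext a; simp

lemma hasFDerivAt_translateSeq (w : Seq) (y : Torus N) (v : Space) :
    HasFDerivAt (fun v : Space => translateSeq w (y + toTorus N v))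
      (translateSeqDeriv w (y + toTorus N v)) v := by
  have h : (fun u : Space => translateSeq w (y + toTorus N u) - translateSeq w (y + toTorus N v) -
      translateSeqDeriv w (y + toTorus N v) (u - v)) =O[𝓝 v] fun u => ‖u - v‖ ^ 2 := by
    refine Asymptotics.IsBigO.of_bound (2 * ‖w‖) (Eventually.of_forall fun u => ?_)
    have := norm_translateSeq_taylor_le w (y + toTorus N v) (u - v)
    rw [← add_toTorus_eq] at this
    rw [Real.norm_of_nonneg (by positivity)]
    linarith
  have h1 := h.hasFDerivAt (𝕜 := ℝ) one_lt_two
  have h2 : HasFDerivAt (fun u : Space => translateSeqDeriv w (y + toTorus N v) (u - v))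
      (translateSeqDeriv w (y + toTorus N v)) v :=
    (((translateSeqDeriv w (y + toTorus N v)).hasFDerivAt (x := v)).sub_const
      (translateSeqDeriv w (y + toTorus N v) v)).congr_of_eventuallyEq
      (Eventually.of_forall fun u => map_sub (translateSeqDeriv w (y + toTorus N v)) u v)
  have h3 := (h1.add h2).add_const (translateSeq w (y + toTorus N v))
  refine (h3.congr_fderiv ?_).congr_of_eventuallyEq (Eventually.of_forall fun u => ?_)
  · ext; simp
  · simp

end Translate

/-! ### The ion density as a function of the lifted positions -/

section Ions

variable {N : ℕ} [NeZero N]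

/-- The projection of `(ℝ³)^Γ` onto `𝕋^Γ`. -/
def toTorusL (q : Lattice N → Space) : Lattice N → Torus N := fun n => toTorus N (q n)

/-- The Fourier coefficients of the charge density of the ions. -/
def ionSeq (w : Seq) (q : Lattice N → Torus N) : Seq :=
  ∑ n, translateSeq w (latticePoint N n + q n)

/-- The derivative of `ionSeq`. -/
def ionSeqDeriv (w : Seq) (q : Lattice N → Torus N) : (Lattice N → Space) →L[ℝ] Seq :=
  ∑ n, (translateSeqDeriv w (latticePoint N n + q n)).comp (ContinuousLinearMap.proj n)

lemma ionSeqDeriv_apply (w : Seq) (q : Lattice N → Torus N) (v : Lattice N → Space) :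
    ionSeqDeriv w q v = ∑ n, translateSeqDeriv w (latticePoint N n + q n) (v n) := by
  simp [ionSeqDeriv, sum_apply]

/-- A bound of `ionSeq` and of its derivatives. -/
def ionConst (N : ℕ) [NeZero N] (w : Seq) : ℝ := Fintype.card (Lattice N) * ‖w‖

lemma ionConst_nonneg (w : Seq) : 0 ≤ ionConst N w := by unfold ionConst; positivity

lemma norm_ionSeq_le (w : Seq) (q : Lattice N → Torus N) : ‖ionSeq w q‖ ≤ ionConst N w := by
  refine (norm_sum_le _ _).trans ((Finset.sum_le_sum fun n _ => norm_translateSeq_le w _).trans ?_)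
  simp [ionConst]

lemma norm_ionSeqDeriv_apply_le (w : Seq) (q : Lattice N → Torus N) (v : Lattice N → Space) :
    ‖ionSeqDeriv w q v‖ ≤ ionConst N w * ‖v‖ := by
  rw [ionSeqDeriv_apply]
  refine (norm_sum_le _ _).trans ((Finset.sum_le_sum fun n _ => ?_).trans
    (by simp [ionConst, mul_assoc] : ∑ _n : Lattice N, ‖w‖ * ‖v‖ ≤ _))
  exact (ContinuousLinearMap.le_of_opNorm_le _ (norm_translateSeqDeriv_le w _) _).trans
    (mul_le_mul_of_nonneg_left (norm_le_pi_norm v n) (norm_nonneg _))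

lemma norm_ionSeqDeriv_le (w : Seq) (q : Lattice N → Torus N) :
    ‖ionSeqDeriv w q‖ ≤ ionConst N w :=
  ContinuousLinearMap.opNorm_le_bound _ (ionConst_nonneg w) (norm_ionSeqDeriv_apply_le w q)

lemma norm_ionSeq_sub_le (w : Seq) (q q' : Lattice N → Space) :
    ‖ionSeq w (toTorusL q) - ionSeq w (toTorusL q')‖ ≤ ionConst N w * ‖q - q'‖ := by
  rw [ionSeq, ionSeq, ← Finset.sum_sub_distrib]
  refine (norm_sum_le _ _).trans ((Finset.sum_le_sum fun n _ => ?_).trans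
    (by simp [ionConst, mul_assoc] : ∑ _n : Lattice N, ‖w‖ * ‖q - q'‖ ≤ _))
  have := norm_translateSeq_sub_le w (latticePoint N n + toTorus N (q' n)) (q n - q' n)
  rw [← add_toTorus_eq] at this
  rw [mul_comm]
  exact this.trans (mul_le_mul_of_nonneg_right (norm_le_pi_norm (q - q') n) (norm_nonneg _))

lemma norm_ionSeqDeriv_sub_le (w : Seq) (q q' : Lattice N → Space) :
    ‖ionSeqDeriv w (toTorusL q) - ionSeqDeriv w (toTorusL q')‖ ≤ ionConst N w * ‖q - q'‖ := by
  refine ContinuousLinearMap.opNorm_le_bound _ (mul_nonneg (ionConst_nonneg w) (norm_nonneg _))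
    fun v => ?_
  rw [sub_apply, ionSeqDeriv_apply, ionSeqDeriv_apply, ← Finset.sum_sub_distrib]
  refine (norm_sum_le _ _).trans ((Finset.sum_le_sum fun n _ => ?_).trans
    (by simp [ionConst, mul_assoc] : ∑ _n : Lattice N, ‖w‖ * (‖q - q'‖ * ‖v‖) ≤ _))
  have := norm_translateSeqDeriv_sub_le w (latticePoint N n + toTorus N (q' n)) (q n - q' n)
  rw [← add_toTorus_eq] at this
  rw [← sub_apply, ← mul_assoc]
  refine (ContinuousLinearMap.le_of_opNorm_le _ this _).trans ?_
  refine mul_le_mul ?_ (norm_le_pi_norm v n) (norm_nonneg _) (by positivity)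
  rw [mul_comm]
  exact mul_le_mul_of_nonneg_left (norm_le_pi_norm (q - q') n) (norm_nonneg _)

lemma hasFDerivAt_ionSeq (w : Seq) (q : Lattice N → Space) :
    HasFDerivAt (fun q : Lattice N → Space => ionSeq w (toTorusL q))
      (ionSeqDeriv w (toTorusL q)) q := by
  unfold ionSeq ionSeqDeriv
  refine HasFDerivAt.fun_sum fun n _ => ?_
  exact (hasFDerivAt_translateSeq w (latticePoint N n) (q n)).comp q
    (ContinuousLinearMap.proj (R := ℝ) (φ := fun _ : Lattice N => Space) n).hasFDerivAt

lemma isRealSeq_ionSeq {w : Seq} (hw : IsRealSeq w) (q : Lattice N → Torus N) :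
    IsRealSeq (ionSeq w q) := by
  intro k
  rw [ionSeq, seq_sum_apply, seq_sum_apply, map_sum]
  refine Finset.sum_congr rfl fun n _ => ?_
  rw [translateSeq_apply, translateSeq_apply, map_mul, map_mul, Complex.conj_ofReal,
    ← character_neg, hw k, bessel, bessel, freqSq_neg]

end Ions

/-! ### Separating one electron from the others -/

section Fubini

variable {N : ℕ} [NeZero N]

/-- The configuration with `x_j = x` and the other coordinates `y`. -/
def glue (j : Fin (N ^ 3)) (p : Torus N × ({i : Fin (N ^ 3) // i ≠ j} → Torus N)) : Config N :=
  fun i => if h : i = j then p.1 else p.2 ⟨i, h⟩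

/-- `glue` as a measurable equivalence. -/
def glueEquiv (j : Fin (N ^ 3)) :
    Torus N × ({i : Fin (N ^ 3) // i ≠ j} → Torus N) ≃ᵐ Config N :=
  ((MeasurableEquiv.funUnique {i : Fin (N ^ 3) // i = j} (Torus N)).symm.prodCongr
    (MeasurableEquiv.refl _)).trans
    (MeasurableEquiv.piEquivPiSubtypeProd (fun _ : Fin (N ^ 3) => Torus N) (fun i => i = j)).symm

omit [NeZero N] in
lemma glueEquiv_apply (j : Fin (N ^ 3)) (p : Torus N × ({i : Fin (N ^ 3) // i ≠ j} → Torus N)) :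
    glueEquiv j p = glue j p := by
  funext i
  by_cases h : i = j
  · subst h; simp [glue, glueEquiv, MeasurableEquiv.prodCongr, MeasurableEquiv.piEquivPiSubtypeProd, Equiv.piEquivPiSubtypeProd]
  · simp [glue, glueEquiv, MeasurableEquiv.prodCongr, MeasurableEquiv.piEquivPiSubtypeProd, Equiv.piEquivPiSubtypeProd, h]

/-- The product measure is determined by boxes, and the preimage of a box is a box. -/
lemma measurePreserving_glueEquiv (j : Fin (N ^ 3)) : MeasurePreserving (glueEquiv (N := N) j) := by
  refine ⟨(glueEquiv j).measurable, ?_⟩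
  refine (Measure.pi_eq fun s hs => ?_).symm
  rw [(glueEquiv j).map_apply]
  have h : glueEquiv (N := N) j ⁻¹' Set.univ.pi s =
      s j ×ˢ Set.univ.pi fun i : {i : Fin (N ^ 3) // i ≠ j} => s i := by
    ext p
    simp only [Set.mem_preimage, Set.mem_univ_pi, Set.mem_prod, glueEquiv_apply, glue]
    refine ⟨fun h => ⟨by simpa using h j, fun i => by simpa [i.2] using h i⟩, fun h i => ?_⟩
    by_cases hi : i = j
    · subst hi; simpa using h.1
    · simpa [hi] using h.2 ⟨i, hi⟩
  rw [h, Measure.volume_eq_prod, Measure.prod_prod, volume_pi (α := fun _ : {i // i ≠ j} => Torus N),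
    Measure.pi_pi, Fintype.prod_eq_mul_prod_subtype_ne _ j]

lemma integrable_glue {E : Type*} [NormedAddCommGroup E] {F : Config N → E} (hF : Integrable F)
    (j : Fin (N ^ 3)) : Integrable fun p => F (glue j p) := by
  have h := (measurePreserving_glueEquiv j).integrable_comp_of_integrable hF
  exact h.congr (Eventually.of_forall fun p => by simp [glueEquiv_apply])

lemma integral_glue {E : Type*} [NormedAddCommGroup E] [NormedSpace ℝ E] {F : Config N → E}
    (hF : Integrable F) (j : Fin (N ^ 3)) :
    ∫ x, F x = ∫ x : Torus N, ∫ y, F (glue j (x, y)) := by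
  rw [← (measurePreserving_glueEquiv j).integral_comp (glueEquiv j).measurableEmbedding F]
  simp only [glueEquiv_apply]
  exact integral_prod _ (integrable_glue hF j)

lemma integrable_integral_glue {E : Type*} [NormedAddCommGroup E] [NormedSpace ℝ E]
    {F : Config N → E} (hF : Integrable F) (j : Fin (N ^ 3)) :
    Integrable fun x : Torus N => ∫ y, F (glue j (x, y)) :=
  (integrable_glue hF j).integral_prod_left

omit [NeZero N] in
@[simp] lemma glue_self (j : Fin (N ^ 3)) (p : Torus N × ({i : Fin (N ^ 3) // i ≠ j} → Torus N)) :
    glue j p j = p.1 := by simp [glue]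

end Fubini

/-! ### Decay of the Fourier coefficients of a C² charge density -/

section Smooth

variable {N : ℕ} [NeZero N]

omit [NeZero N] in
lemma contDiff_partialDeriv {η : Config N → ℂ} (h : ContDiff ℝ 2 fun y => η (toConfig N y))
    (j : Fin (N ^ 3)) (a : Fin 3) :
    ContDiff ℝ 1 fun y => partialDeriv j a η (toConfig N y) := by
  have : (fun y => partialDeriv j a η (toConfig N y)) = fun y =>
      fderiv ℝ (fun y => η (toConfig N y)) y (Pi.single j (Pi.single a 1)) :=
    funext fun y => partialDeriv_eq_fderiv (h.of_le (by norm_num)) j a y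
  rw [this]
  exact (h.fderiv_right (m := 1) (by norm_num)).clm_apply contDiff_const

lemma integral_partialDeriv_mul_chi {η : Config N → ℂ}
    (h : ContDiff ℝ 1 fun y => η (toConfig N y)) (j : Fin (N ^ 3)) (a : Fin 3) (K : Freq N) :
    ∫ x, partialDeriv j a η x * chi K x = -(Complex.I * xi N (K j a)) * ∫ x, η x * chi K x := by
  have h1 := integral_mul_partialDeriv h (isSmooth_chi K).contDiff_one j a
  rw [eq_comm, neg_eq_iff_eq_neg] at h1
  rw [h1, ← integral_neg, ← integral_const_mul]
  refine integral_congr_ae (Eventually.of_forall fun x => ?_)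
  simp only [partialDeriv_chi]
  ring

lemma integrable_of_continuous {f : Config N → ℂ} (hf : Continuous f) : Integrable f :=
  hf.integrable_of_hasCompactSupport (HasCompactSupport.of_compactSpace _)

/-- `(1 - Δ_j) η`. -/
def oneSubLaplacian (j : Fin (N ^ 3)) (η : Config N → ℂ) (x : Config N) : ℂ :=
  η x - ∑ a, partialDeriv j a (partialDeriv j a η) x

omit [NeZero N] in
lemma continuous_oneSubLaplacian {η : Config N → ℂ}
    (h : ContDiff ℝ 2 fun y => η (toConfig N y)) (j : Fin (N ^ 3)) :
    Continuous (oneSubLaplacian j η) :=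
  (continuous_of_contDiff (h.of_le (by norm_num))).sub <| continuous_finsetSum _ fun a _ =>
    continuous_partialDeriv_of_contDiff (contDiff_partialDeriv h j a) j a

lemma integral_oneSubLaplacian_mul_chi {η : Config N → ℂ}
    (h : ContDiff ℝ 2 fun y => η (toConfig N y)) (j : Fin (N ^ 3)) (K : Freq N) :
    ∫ x, oneSubLaplacian j η x * chi K x = (1 + freqSq N (K j) : ℝ) * ∫ x, η x * chi K x := by
  have hη := continuous_of_contDiff (h.of_le (by norm_num : (1 : ℕ∞ω) ≤ 2))
  have hd := fun a => continuous_partialDeriv_of_contDiff (contDiff_partialDeriv h j a) j a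
  have hchi := continuous_chi K
  have e : ∀ x, oneSubLaplacian j η x * chi K x =
      η x * chi K x - ∑ a, partialDeriv j a (partialDeriv j a η) x * chi K x := fun x => by
    rw [oneSubLaplacian, sub_mul, Finset.sum_mul]
  simp only [e]
  have i1 : Integrable fun x => η x * chi K x := integrable_of_continuous (hη.mul hchi)
  have i2 : ∀ a, Integrable fun x => partialDeriv j a (partialDeriv j a η) x * chi K x :=
    fun a => integrable_of_continuous ((hd a).mul hchi)
  rw [integral_sub i1 (integrable_finsetSum _ fun a _ => i2 a), integral_finsetSum _ fun a _ => i2 a]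
  simp only [integral_partialDeriv_mul_chi (contDiff_partialDeriv h j _),
    integral_partialDeriv_mul_chi (h.of_le (by norm_num : (1 : ℕ∞ω) ≤ 2))]
  rw [freqSq_eq]
  push_cast
  rw [add_mul, one_mul, Finset.sum_mul, sub_eq_add_neg, ← Finset.sum_neg_distrib]
  congr 1
  refine Finset.sum_congr rfl fun a _ => ?_
  linear_combination (-(xi N (K j a) : ℂ) ^ 2 * ∫ x, η x * chi K x) * Complex.I_sq

lemma summable_integral_mul_chi {g : Config N → ℂ} (hg : Continuous g) :
    Summable fun K => ‖∫ x, g x * chi (-K) x‖ ^ 2 := by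
  have h := (hasSum_coef_sq (contL2 ⟨g, hg⟩)).summable.mul_left (vol N)
  refine h.congr fun K => ?_
  rw [coef_eq_integral, integral_contL2_mul_chi, norm_mul, mul_pow, ← mul_assoc]
  have : vol N * ‖((Real.sqrt (vol N))⁻¹ : ℂ)‖ ^ 2 = 1 := by
    rw [norm_inv, Complex.norm_real, Real.norm_of_nonneg (Real.sqrt_nonneg _), inv_pow,
      Real.sq_sqrt vol_pos.le, mul_inv_cancel₀ vol_pos.ne']
  rw [this, one_mul]
  rfl

omit [NeZero N] in
lemma contDiff_comp_apply {σ : Torus N → ℝ} (hσ : ContDiff ℝ 2 fun y => σ (toTorus N y))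
    (j : Fin (N ^ 3)) : ContDiff ℝ 2 fun y => ((σ (toConfig N y j) : ℝ) : ℂ) :=
  Complex.ofRealCLM.contDiff.comp (hσ.comp (contDiff_apply ℝ (Fin 3 → ℝ) j))

omit [NeZero N] in
lemma continuous_of_contDiff_toTorus {σ : Torus N → ℝ}
    (hσ : ContDiff ℝ 2 fun y => σ (toTorus N y)) : Continuous σ := by
  have h : IsOpenQuotientMap (fun t : ℝ => (t : AddCircle (N : ℝ))) :=
    QuotientAddGroup.isOpenQuotientMap_mk
  exact (IsOpenQuotientMap.piMap fun _ : Fin 3 => h).isQuotientMap.continuous_iff.2 hσ.continuous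

lemma integral_comp_mul_chi {σ : Torus N → ℝ} (hσ : Continuous σ) (j : Fin (N ^ 3))
    (k : Fin 3 → ℤ) :
    ∫ x : Config N, (σ (x j) : ℂ) * chi (-Pi.single j k) x =
      ((volume : Measure ({i : Fin (N ^ 3) // i ≠ j} → Torus N)).real Set.univ : ℂ) *
        ∫ x, (σ x : ℂ) * character N (-k) x := by
  have e : ∀ x : Config N, (σ (x j) : ℂ) * chi (-Pi.single j k) x =
      (σ (x j) : ℂ) * character N (-k) (x j) := fun x => by
    rw [← Pi.single_neg, chi_single]
  simp only [e]
  rw [integral_glue _ j]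
  · simp only [glue_self, integral_const, Complex.real_smul]
    rw [integral_const_mul]
  · have := continuous_character (N := N) (-k)
    exact integrable_of_continuous (by fun_prop)

/-- The function σ is regarded as σ(x_j) on the configuration torus, so that the Fourier theory
developed there applies. Since (1 - Δ_j)σ is continuous, it lies in L², and its coefficients at
frequencies supported on `j` are square summable. The other coordinates contribute only the volume
`V`. -/
lemma summable_fourierCoefficient {σ : Torus N → ℝ}
    (hσ : ContDiff ℝ 2 fun y => σ (toTorus N y)) :
    Summable fun k => ‖((1 + freqSq N k : ℝ) : ℂ) * fourierCoefficient σ k‖ ^ 2 := by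
  have hpos : 0 < N ^ 3 := pow_pos (Nat.pos_of_ne_zero (NeZero.ne N)) 3
  let j : Fin (N ^ 3) := ⟨0, hpos⟩
  have hη := contDiff_comp_apply hσ j
  have h1 := summable_integral_mul_chi (continuous_oneSubLaplacian (η := fun x => (σ (x j) : ℂ)) hη j)
  have h2 := h1.comp_injective (Pi.single_injective (M := fun _ : Fin (N ^ 3) => Fin 3 → ℤ) j)
  set V := (volume : Measure ({i : Fin (N ^ 3) // i ≠ j} → Torus N)).real Set.univ with hV
  have hV0 : V ≠ 0 := by
    rw [hV, Measure.real, volume_pi, Measure.pi_univ]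
    have h3 : (volume : Measure (Torus N)) Set.univ = ENNReal.ofReal N ^ 3 := by
      rw [volume_pi, Measure.pi_univ]; simp [AddCircle.measure_univ]
    have h4 : (N : ℝ) ≠ 0 := by exact_mod_cast NeZero.ne N
    simp [h3, h4]
  refine (h2.mul_left (‖((V : ℂ) * (N : ℂ) ^ 3)⁻¹‖ ^ 2)).congr fun k => ?_
  rw [Function.comp_apply, integral_oneSubLaplacian_mul_chi (η := fun x => (σ (x j) : ℂ)) hη,
    integral_comp_mul_chi (continuous_of_contDiff_toTorus hσ), fourierCoefficient, ← mul_pow,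
    ← norm_mul, ← hV]
  have hV1 : (V : ℂ) ≠ 0 := by exact_mod_cast hV0
  congr 2
  rw [Pi.neg_apply, Pi.single_eq_same, freqSq_neg, mul_inv]
  field_simp

lemma fourierCoefficient_neg (f : Torus N → ℝ) (k : Fin 3 → ℤ) :
    fourierCoefficient f (-k) = starRingEnd ℂ (fourierCoefficient f k) := by
  rw [fourierCoefficient, fourierCoefficient, map_mul, ← integral_conj]
  congr 1
  · simp
  · refine integral_congr_ae (Eventually.of_forall fun x => ?_)
    simp [character_neg]

/-- The sequence `(1 + |ξ|²) σ̂`. -/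
def sigmaSeq {σ : Torus N → ℝ} (hσ : ContDiff ℝ 2 fun y => σ (toTorus N y)) : Seq :=
  seqMk _ (summable_fourierCoefficient hσ)

lemma isRealSeq_sigmaSeq {σ : Torus N → ℝ} (hσ : ContDiff ℝ 2 fun y => σ (toTorus N y)) :
    IsRealSeq (sigmaSeq hσ) := by
  intro k
  rw [sigmaSeq, seqMk_apply, seqMk_apply, fourierCoefficient_neg, map_mul, Complex.conj_ofReal,
    freqSq_neg]

lemma bessel_mul_sigmaSeq {σ : Torus N → ℝ} (hσ : ContDiff ℝ 2 fun y => σ (toTorus N y))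
    (k : Fin 3 → ℤ) : (bessel N k : ℂ) * sigmaSeq hσ k = fourierCoefficient σ k := by
  have h0 := freqSq_nonneg (N := N) k
  have h1 : ((1 + freqSq N k : ℝ) : ℂ) ≠ 0 := by
    exact_mod_cast (by positivity : (1 + freqSq N k : ℝ) ≠ 0)
  rw [sigmaSeq, seqMk_apply, bessel, Complex.ofReal_inv, inv_mul_cancel_left₀ h1]

end Smooth

/-! ### Fourier coefficients of the densities and the Coulomb energy -/

section Density

variable {N : ℕ} [NeZero N]

lemma integrable_norm_sq (ψ : L2 N) : Integrable fun x => ‖ψ x‖ ^ 2 := by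
  have := (Lp.memLp ψ).integrable_norm_rpow (by norm_num) (by norm_num)
  simpa using this

lemma memLp_chi_mul (L : Freq N) (ψ : L2 N) :
    MemLp (fun x => chi L x * ψ x) 2 (volume : Measure (Config N)) := by
  refine (Lp.memLp ψ).of_le
    ((continuous_chi L).aestronglyMeasurable.mul (Lp.memLp ψ).aestronglyMeasurable)
    (Eventually.of_forall fun x => ?_)
  rw [norm_mul, norm_chi, one_mul]

/-- With L the frequency of the character, the integrand is ψ times the conjugate of χ_L ψ.
Multiplication by χ_L shifts coefficients by L, and Parseval gives the correlation. -/
lemma integral_norm_sq_mul_chi (j : Fin (N ^ 3)) (ψ : Fermion N) (k : Fin 3 → ℤ) :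
    ∫ x, ((‖waveFn ψ x‖ ^ 2 : ℝ) : ℂ) * chi (-Pi.single j k) x = corr j ψ ψ k := by
  set L : Freq N := Pi.single j k with hL
  set φ : L2 N := (memLp_chi_mul L (waveFn ψ)).toLp with hφ
  have hφx : φ =ᵐ[volume] fun x => chi L x * waveFn ψ x := MemLp.coeFn_toLp _
  have hc : ∀ K, coef φ K = fc ψ (K - L) := by
    intro K
    rw [fc, coef_eq_integral, coef_eq_integral]
    congr 1
    refine integral_congr_ae ?_
    filter_upwards [hφx] with x hx
    rw [hx, neg_sub, sub_eq_add_neg, chi_add]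
    ring
  have h1 := hasSum_coef_mul φ (waveFn ψ)
  have h2 : inner ℂ φ (waveFn ψ) =
      ∫ x, ((‖waveFn ψ x‖ ^ 2 : ℝ) : ℂ) * chi (-L) x := by
    rw [L2.inner_def]
    refine integral_congr_ae ?_
    filter_upwards [hφx] with x hx
    rw [hx, RCLike.inner_apply, map_mul, chi_neg, Complex.ofReal_pow, ← Complex.mul_conj']
    ring
  rw [← h2, ← h1.tsum_eq, corr]
  exact tsum_congr fun K => by rw [hc, mul_comm]; rfl

lemma integrable_ofReal_mul_character {f : Torus N → ℝ} (hf : Integrable f) (k : Fin 3 → ℤ) :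
    Integrable fun x => (f x : ℂ) * character N k x := by
  have h : Integrable fun x => (f x : ℂ) := hf.ofReal
  refine h.norm.mono' (h.aestronglyMeasurable.mul
    (continuous_character k).aestronglyMeasurable) (Eventually.of_forall fun x => ?_)
  rw [norm_mul, norm_character, mul_one]

lemma fourierCoefficient_add {f g : Torus N → ℝ} (hf : Integrable f) (hg : Integrable g)
    (k : Fin 3 → ℤ) :
    fourierCoefficient (fun x => f x + g x) k = fourierCoefficient f k + fourierCoefficient g k := by
  simp only [fourierCoefficient, Complex.ofReal_add, add_mul]
  rw [integral_add (integrable_ofReal_mul_character hf _) (integrable_ofReal_mul_character hg _),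
    mul_add]

lemma fourierCoefficient_sum {ι : Type*} (s : Finset ι) {f : ι → Torus N → ℝ}
    (hf : ∀ i, Integrable (f i)) (k : Fin 3 → ℤ) :
    fourierCoefficient (fun x => ∑ i ∈ s, f i x) k = ∑ i ∈ s, fourierCoefficient (f i) k := by
  simp only [fourierCoefficient, Complex.ofReal_sum, Finset.sum_mul]
  rw [integral_finsetSum _ fun i _ => integrable_ofReal_mul_character (hf i) _, Finset.mul_sum]

lemma fourierCoefficient_const_mul (c : ℝ) (f : Torus N → ℝ) (k : Fin 3 → ℤ) :
    fourierCoefficient (fun x => c * f x) k = c * fourierCoefficient f k := by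
  simp only [fourierCoefficient, Complex.ofReal_mul, mul_assoc]
  rw [integral_const_mul]
  ring

/-- The marginal density of the `j`-th electron. -/
def marginal (ψ : L2 N) (j : Fin (N ^ 3)) (x : Torus N) : ℝ := ∫ y, ‖ψ (glue j (x, y))‖ ^ 2

lemma integrable_marginal (ψ : L2 N) (j : Fin (N ^ 3)) : Integrable (marginal ψ j) :=
  integrable_integral_glue (integrable_norm_sq ψ) j

lemma fourierCoefficient_marginal (j : Fin (N ^ 3)) (ψ : Fermion N) (k : Fin 3 → ℤ) :
    fourierCoefficient (marginal (waveFn ψ) j) k = ((N : ℂ) ^ 3)⁻¹ * corr j ψ ψ k := by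
  rw [fourierCoefficient, ← integral_norm_sq_mul_chi, integral_glue _ j]
  · congr 1
    refine integral_congr_ae (Eventually.of_forall fun x => ?_)
    simp only [marginal]
    rw [← integral_complex_ofReal, ← integral_mul_const]
    refine integral_congr_ae (Eventually.of_forall fun y => ?_)
    simp only [← Pi.single_neg, chi_single, glue_self]
  · have h : Integrable fun x => ((‖waveFn ψ x‖ ^ 2 : ℝ) : ℂ) := (integrable_norm_sq (waveFn ψ)).ofReal
    refine h.norm.mono' (h.aestronglyMeasurable.mul
      (continuous_chi _).aestronglyMeasurable) (Eventually.of_forall fun x => ?_)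
    rw [norm_mul, norm_chi, mul_one]

lemma integrable_electronDensity (e : ℝ) (ψ : L2 N) : Integrable (electronDensity e ψ) :=
  (integrable_finsetSum _ fun j _ => integrable_marginal ψ j).const_mul (-e)

lemma fourierCoefficient_electronDensity (e : ℝ) (ψ : Fermion N) (k : Fin 3 → ℤ) :
    fourierCoefficient (electronDensity e (waveFn ψ)) k = -e * pairDensity N ψ ψ k := by
  have h : electronDensity e (waveFn ψ) = fun x => -e * ∑ j, marginal (waveFn ψ) j x := rfl
  have h2 : ∑ j, fourierCoefficient (marginal (waveFn ψ) j) k =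
      ((N : ℂ) ^ 3)⁻¹ * ∑ j, corr j ψ ψ k := by
    rw [Finset.mul_sum]
    exact Finset.sum_congr rfl fun j _ => fourierCoefficient_marginal j ψ k
  have h3 := h2.trans (pairDensity_apply ψ ψ k).symm
  have h4 : fourierCoefficient (fun x => ∑ j, marginal (waveFn ψ) j x) k =
      ∑ j, fourierCoefficient (marginal (waveFn ψ) j) k :=
    fourierCoefficient_sum Finset.univ (f := marginal (waveFn ψ))
      (integrable_marginal (waveFn ψ)) k
  have h5 := fourierCoefficient_const_mul (-e) (fun x => ∑ j, marginal (waveFn ψ) j x) k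
  rw [h4, h3, Complex.ofReal_neg] at h5
  exact (congrArg (fourierCoefficient · k) h).trans h5

lemma continuous_ionDensity {σ : Torus N → ℝ} (hσ : Continuous σ) (q : Lattice N → Torus N) :
    Continuous (ionDensity σ q) := by
  unfold ionDensity; fun_prop

lemma integrable_of_continuous_torus {f : Torus N → ℝ} (hf : Continuous f) : Integrable f :=
  hf.integrable_of_hasCompactSupport (HasCompactSupport.of_compactSpace _)

lemma fourierCoefficient_translate (σ : Torus N → ℝ) (y : Torus N) (k : Fin 3 → ℤ) :
    fourierCoefficient (fun x => σ (x - y)) k =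
      character N (-k) y * fourierCoefficient σ k := by
  rw [fourierCoefficient, fourierCoefficient]
  have h := integral_sub_right_eq_self (μ := (volume : Measure (Torus N)))
    (fun x => (σ x : ℂ) * character N (-k) (x + y)) y
  simp only [sub_add_cancel] at h
  have h1 : ∫ x, (σ x : ℂ) * character N (-k) (x + y) =
      character N (-k) y * ∫ x, (σ x : ℂ) * character N (-k) x := by
    rw [← integral_const_mul]
    refine integral_congr_ae (Eventually.of_forall fun x => ?_)
    simp only [character_add]
    ring
  rw [h, h1]
  ring

lemma fourierCoefficient_ionDensity {σ : Torus N → ℝ}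
    (hσ : ContDiff ℝ 2 fun y => σ (toTorus N y)) (q : Lattice N → Torus N) (k : Fin 3 → ℤ) :
    fourierCoefficient (ionDensity σ q) k = ionSeq (sigmaSeq hσ) q k := by
  have hc := continuous_of_contDiff_toTorus hσ
  have h : ionDensity σ q = fun x => ∑ n, σ (x - (latticePoint N n + q n)) := by
    funext x
    simp only [ionDensity, sub_sub]
  rw [h, fourierCoefficient_sum, ionSeq, seq_sum_apply]
  · refine Finset.sum_congr rfl fun n _ => ?_
    rw [fourierCoefficient_translate, translateSeq_apply, ← bessel_mul_sigmaSeq hσ]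
    ring
  · exact fun n => integrable_of_continuous_torus (by fun_prop)

omit [NeZero N] in
lemma seq_add_smul_apply (a b : Seq) (c : ℝ) (k : Fin 3 → ℤ) : (a + c • b) k = a k + c * b k := by
  rw [lp.coeFn_add, Pi.add_apply, seq_smul_apply]

/-- The Fourier coefficients of the total charge density. -/
def rhoSeq (e : ℝ) (w : Seq) (ψ : Fermion N) (q : Lattice N → Torus N) : Seq :=
  ionSeq w q + (-e) • pairDensity N ψ ψ

lemma isRealSeq_rhoSeq (e : ℝ) {w : Seq} (hw : IsRealSeq w) (ψ : Fermion N)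
    (q : Lattice N → Torus N) : IsRealSeq (rhoSeq e w ψ q) :=
  (isRealSeq_ionSeq hw q).add ((isRealSeq_pairDensity ψ).smul (-e))

lemma integrable_density (e : ℝ) {σ : Torus N → ℝ} (hσ : Continuous σ) (X : State N) :
    Integrable (density e σ X) :=
  (integrable_of_continuous_torus (continuous_ionDensity hσ X.2.1)).add
    (integrable_electronDensity e (waveFn X.1))

lemma fourierCoefficient_density (e : ℝ) {σ : Torus N → ℝ}
    (hσ : ContDiff ℝ 2 fun y => σ (toTorus N y)) (X : State N) (k : Fin 3 → ℤ) :
    fourierCoefficient (density e σ X) k = rhoSeq e (sigmaSeq hσ) X.1 X.2.1 k := by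
  have hc := continuous_of_contDiff_toTorus hσ
  have h : density e σ X =
      fun x => ionDensity σ X.2.1 x + electronDensity e (waveFn X.1) x := rfl
  rw [h, fourierCoefficient_add (integrable_of_continuous_torus (continuous_ionDensity hc X.2.1))
    (integrable_electronDensity e (waveFn X.1)), fourierCoefficient_ionDensity hσ,
    fourierCoefficient_electronDensity, ← Complex.ofReal_neg]
  exact (seq_add_smul_apply _ _ (-e) k).symm

/-- The density is merely integrable here, but its coefficients and |ξ|⁻² are both square summable.
The series of G f therefore converges absolutely and uniformly and may be integrated against f term
by term. -/
lemma integral_mul_greenOp {f : Torus N → ℝ} (hf : Integrable f) {r : Seq}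
    (hr : ∀ k, fourierCoefficient f k = r k) : ∫ x, f x * greenOp f x = coulomb N r r := by
  have hgreen : ∀ x, greenOp f x =
      (∑' k, r k * (((freqSq N k)⁻¹ : ℝ) : ℂ) * character N k x).re := by
    intro x
    rw [greenOp]
    congr 1
    simp only [hr, div_eq_mul_inv]
    -- Extending the sum to `k = 0` adds nothing, since the inverse of zero is zero.
    refine (tsum_subtype_eq_of_support_subset (s := {k : Fin 3 → ℤ | k ≠ 0})
      (f := fun k => r k * (freqSq N k : ℂ)⁻¹ * character N k x) fun k hk => ?_).trans
      (tsum_congr fun k => by rw [Complex.ofReal_inv])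
    rintro rfl
    simp [freqSq_zero] at hk
  set F : (Fin 3 → ℤ) → Torus N → ℂ := fun k x =>
    r k * (((freqSq N k)⁻¹ : ℝ) : ℂ) * ((f x : ℂ) * character N k x) with hF
  have hsum := summable_seq_mul_green (N := N) r
  have hFi : ∀ k, Integrable (F k) := fun k =>
    (integrable_ofReal_mul_character hf k).const_mul _
  have hFs : Summable fun k => ∫ x, ‖F k x‖ := by
    refine (hsum.norm.mul_right (∫ x, ‖f x‖)).congr fun k => ?_
    rw [← integral_const_mul]
    refine integral_congr_ae (Eventually.of_forall fun x => ?_)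
    simp only [hF, norm_mul, norm_character, mul_one, Complex.norm_real]
  have h1 := hasSum_integral_of_summable_integral_norm hFi hFs
  have h2 : ∀ x, ∑' k, F k x =
      (f x : ℂ) * ∑' k, r k * (((freqSq N k)⁻¹ : ℝ) : ℂ) * character N k x := by
    intro x
    rw [← tsum_mul_left]
    exact tsum_congr fun k => by simp only [hF]; ring
  have h3 : ∫ x, f x * greenOp f x = (∫ x, ∑' k, F k x).re := by
    have hi : Integrable fun x => ∑' k, F k x := by
      simp only [h2]
      have hcont : Continuous fun x : Torus N =>
          ∑' k, r k * (((freqSq N k)⁻¹ : ℝ) : ℂ) * character N k x := by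
        refine continuous_tsum (fun k => ?_) hsum.norm fun k x => ?_
        · exact continuous_const.mul (continuous_character k)
        · rw [norm_mul, norm_character, mul_one]
      obtain ⟨C, hC⟩ := isCompact_univ.exists_bound_of_continuousOn hcont.continuousOn
      exact (hf.ofReal (𝕜 := ℂ)).mul_bdd (c := C) hcont.aestronglyMeasurable
        (Eventually.of_forall fun x => hC x trivial)
    have := integral_re hi
    refine Eq.trans ?_ this
    refine integral_congr_ae (Eventually.of_forall fun x => ?_)
    simp only [h2, hgreen]
    exact (Complex.re_ofReal_mul _ _).symm
  rw [h3]
  refine (Complex.hasSum_re h1).unique ((hasSum_coulomb r r).congr_fun fun k => ?_)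
  -- The integral against the character is N³ times the coefficient at `-k`, which is the conjugate
  -- of the one at `k` because f is real.
  have h4 : ∫ x, F k x = r k * (((freqSq N k)⁻¹ : ℝ) : ℂ) * ((N : ℂ) ^ 3 * starRingEnd ℂ (r k)) := by
    have hN : (N : ℂ) ^ 3 ≠ 0 := pow_ne_zero _ (by exact_mod_cast NeZero.ne N)
    rw [← hr k, ← fourierCoefficient_neg, fourierCoefficient, fourierCoefficient, neg_neg,
      mul_inv_cancel_left₀ hN, ← fourierCoefficient, hr k]
    exact integral_const_mul _ _
  rw [h4, ← re_mul_green_mul_conj]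
  congr 1
  ring

end Density

/-! ### Real scalar products from complex ones -/

section ReInner

variable (E : Type*) [NormedAddCommGroup E] [InnerProductSpace ℂ E] [NormedSpace ℝ E]
  [IsScalarTower ℝ ℂ E]

/-- The real part of a complex scalar product. -/
def reInner : E →L[ℝ] E →L[ℝ] ℝ :=
  LinearMap.mkContinuous₂
    (LinearMap.mk₂ ℝ (fun u v : E => (inner ℂ u v).re)
      (fun u v w => by simp)
      (fun c u v => by
        rw [← smul_one_smul ℂ c u, inner_smul_left]
        simp)
      (fun u v w => by simp)
      (fun c u v => by
        rw [← smul_one_smul ℂ c v, inner_smul_right]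
        simp)) 1 fun u v => by
    rw [one_mul]
    exact (Complex.abs_re_le_norm _).trans (norm_inner_le_norm (𝕜 := ℂ) u v)

variable {E}

lemma reInner_apply (u v : E) : reInner E u v = (inner ℂ u v).re := rfl

lemma reInner_symm (u v : E) : reInner E u v = reInner E v u := by
  rw [reInner_apply, reInner_apply, ← inner_conj_symm (𝕜 := ℂ) v u, Complex.conj_re]

lemma reInner_self (u : E) : reInner E u u = ‖u‖ ^ 2 := by
  have h : inner ℂ u u = (‖u‖ : ℂ) ^ 2 := inner_self_eq_norm_sq_to_K (𝕜 := ℂ) u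
  rw [reInner_apply, h]
  norm_cast

end ReInner

/-! ### The lifted energy and its Fréchet derivative -/

section Energy

variable {N : ℕ} [NeZero N]

lemma integral_norm_sq_L2 (f : L2 N) : ∫ x, ‖f x‖ ^ 2 = ‖f‖ ^ 2 := by
  have h : inner ℂ f f = (‖f‖ : ℂ) ^ 2 := inner_self_eq_norm_sq_to_K (𝕜 := ℂ) f
  rw [L2.inner_def] at h
  have h2 : ∫ x, ((‖f x‖ ^ 2 : ℝ) : ℂ) = (‖f‖ : ℂ) ^ 2 := by
    rw [← h]
    refine integral_congr_ae (Eventually.of_forall fun x => ?_)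
    simp only [RCLike.inner_apply, Complex.mul_conj', Complex.ofReal_pow]
  rw [integral_complex_ofReal] at h2
  exact_mod_cast h2

lemma charge_eq (X : State N) : charge X = ‖waveFn X.1‖ ^ 2 := integral_norm_sq_L2 _

lemma sum_norm_sq_weakGrad (ψ : Fermion N) :
    ∑ j, ∑ a, ∫ x, ‖weakGrad ψ j a x‖ ^ 2 = ‖ψ‖ ^ 2 - ‖waveFn ψ‖ ^ 2 := by
  have h := sum_inner_weakGrad ψ ψ
  have h1 : inner ℂ ψ ψ = (‖ψ‖ : ℂ) ^ 2 := inner_self_eq_norm_sq_to_K (𝕜 := ℂ) ψ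
  have h2 : inner ℂ (waveFn ψ) (waveFn ψ) = (‖waveFn ψ‖ : ℂ) ^ 2 :=
    inner_self_eq_norm_sq_to_K (𝕜 := ℂ) (waveFn ψ)
  have h3 : ∀ j a, inner ℂ (weakGrad ψ j a) (weakGrad ψ j a) = (‖weakGrad ψ j a‖ : ℂ) ^ 2 :=
    fun j a => inner_self_eq_norm_sq_to_K (𝕜 := ℂ) (weakGrad ψ j a)
  simp only [integral_norm_sq_L2]
  rw [h1, h2] at h
  simp only [h3] at h
  exact_mod_cast h

/-- The gradient form `Re ∫ ∇ψ̄ · ∇φ`. -/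
def gradForm (N : ℕ) [NeZero N] : Fermion N →L[ℝ] Fermion N →L[ℝ] ℝ :=
  reInner (Fermion N) -
    (reInner (L2 N)).bilinearComp ((waveL N).restrictScalars ℝ) ((waveL N).restrictScalars ℝ)

lemma gradForm_symm (ψ φ : Fermion N) : gradForm N ψ φ = gradForm N φ ψ := by
  have h1 := reInner_symm ψ φ
  have h2 := reInner_symm (waveFn ψ) (waveFn φ)
  exact congrArg₂ (· - ·) h1 h2

lemma gradForm_self (ψ : Fermion N) : gradForm N ψ ψ = ‖ψ‖ ^ 2 - ‖waveFn ψ‖ ^ 2 :=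
  congrArg₂ (· - ·) (reInner_self ψ) (reInner_self (waveFn ψ))

/-- The wave function component. -/
def psiL (N : ℕ) [NeZero N] : Tangent N →L[ℝ] Fermion N := ContinuousLinearMap.fst ℝ _ _

/-- The position component. -/
def posL (N : ℕ) [NeZero N] : Tangent N →L[ℝ] (Lattice N → Space) :=
  (ContinuousLinearMap.fst ℝ _ _).comp (ContinuousLinearMap.snd ℝ _ _)

/-- The momentum component. -/
def momL (N : ℕ) [NeZero N] : Tangent N →L[ℝ] (Lattice N → Space) :=
  (ContinuousLinearMap.snd ℝ _ _).comp (ContinuousLinearMap.snd ℝ _ _)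

lemma hasFDerivAt_psiL (x : Tangent N) : HasFDerivAt (fun x : Tangent N => x.1) (psiL N) x :=
  hasFDerivAt_fst

lemma hasFDerivAt_posL (x : Tangent N) : HasFDerivAt (fun x : Tangent N => x.2.1) (posL N) x :=
  (posL N).hasFDerivAt

lemma hasFDerivAt_momL (x : Tangent N) : HasFDerivAt (fun x : Tangent N => x.2.2) (momL N) x :=
  (momL N).hasFDerivAt

/-- The charge density on the lifted phase space. -/
def rho (e : ℝ) (w : Seq) (x : Tangent N) : Seq := rhoSeq e w x.1 (toTorusL x.2.1)

/-- The energy on the lifted phase space. -/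
def energyL (e M : ℝ) (w : Seq) (x : Tangent N) : ℝ :=
  (1 / 2) * gradForm N x.1 x.1 + (1 / 2) * coulomb N (rho e w x) (rho e w x) +
    ∑ n, ‖x.2.2 n‖ ^ 2 / (2 * M)

/-- The projection of the lifted phase space onto the phase space. -/
def project (x : Tangent N) : State N := (x.1, toTorusL x.2.1, x.2.2)

lemma energy_project (e M : ℝ) {σ : Torus N → ℝ} (hσ : ContDiff ℝ 2 fun y => σ (toTorus N y))
    (x : Tangent N) : energy e M σ (project x) = energyL e M (sigmaSeq hσ) x := by
  have h1 := sum_norm_sq_weakGrad (project x).1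
  have h2 := integral_mul_greenOp
    (integrable_density e (continuous_of_contDiff_toTorus hσ) (project x))
    (fourierCoefficient_density e hσ (project x))
  have h3 := gradForm_self x.1
  unfold energy energyL
  rw [h1, h2, h3]
  rfl

lemma displace_project (x Y : Tangent N) : displace (project x) Y = project (x + Y) := by
  refine Prod.ext rfl (Prod.ext (funext fun n => ?_) rfl)
  exact (toTorus_add (x.2.1 n) (Y.2.1 n)).symm

lemma exists_project_eq (X : State N) : ∃ x : Tangent N, project x = X := by
  choose y hy using fun n a => QuotientAddGroup.mk_surjective (X.2.1 n a)
  refine ⟨(X.1, fun n => WithLp.toLp 2 (y n), X.2.2), ?_⟩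
  refine Prod.ext rfl (Prod.ext (funext fun n => funext fun a => hy n a) rfl)

/-- The derivative of the charge density. -/
def rhoDeriv (e : ℝ) (w : Seq) (x : Tangent N) : Tangent N →L[ℝ] Seq :=
  (ionSeqDeriv w (toTorusL x.2.1)).comp (posL N) +
    (-e) • ((pairDensity N x.1 + (pairDensity N).flip x.1).comp (psiL N))

lemma hasFDerivAt_bilinear_self {E F : Type*} [NormedAddCommGroup E] [NormedSpace ℝ E]
    [NormedAddCommGroup F] [NormedSpace ℝ F] (B : E →L[ℝ] E →L[ℝ] F) (x : E) :
    HasFDerivAt (fun x => B x x) (B x + B.flip x) x := by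
  have h := B.hasFDerivAt_of_bilinear (hasFDerivAt_id x) (hasFDerivAt_id x)
  refine h.congr_fderiv ?_
  ext y
  simp

lemma hasFDerivAt_bilinear_self_comp {E F G : Type*} [NormedAddCommGroup E] [NormedSpace ℝ E]
    [NormedAddCommGroup F] [NormedSpace ℝ F] [NormedAddCommGroup G] [NormedSpace ℝ G]
    (B : E →L[ℝ] E →L[ℝ] F) {f : G → E} {f' : G →L[ℝ] E} {x : G} (hf : HasFDerivAt f f' x) :
    HasFDerivAt (fun x => B (f x) (f x)) ((B (f x) + B.flip (f x)).comp f') x :=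
  HasFDerivAt.comp (g := fun u => B u u) x (hasFDerivAt_bilinear_self B (f x)) hf

lemma hasFDerivAt_half_bilinear_self_comp {E G : Type*} [NormedAddCommGroup E]
    [NormedSpace ℝ E] [NormedAddCommGroup G] [NormedSpace ℝ G]
    (B : E →L[ℝ] E →L[ℝ] ℝ) (hB : ∀ u v, B u v = B v u) {f : G → E} {f' : G →L[ℝ] E} {x : G}
    (hf : HasFDerivAt f f' x) :
    HasFDerivAt (fun x => (1 / 2) * B (f x) (f x)) ((B (f x)).comp f') x := by
  refine ((hasFDerivAt_bilinear_self_comp B hf).const_mul (1 / 2)).congr_fderiv ?_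
  ext y
  simp only [smul_apply, ContinuousLinearMap.comp_apply, add_apply, ContinuousLinearMap.flip_apply,
    smul_eq_mul]
  rw [hB (f' y)]
  ring

lemma hasFDerivAt_rho (e : ℝ) (w : Seq) (x : Tangent N) :
    HasFDerivAt (rho e w) (rhoDeriv e w x) x := by
  have h1 : HasFDerivAt (fun x : Tangent N => ionSeq w (toTorusL x.2.1))
      ((ionSeqDeriv w (toTorusL x.2.1)).comp (posL N)) x :=
    HasFDerivAt.comp (g := fun q : Lattice N → Space => ionSeq w (toTorusL q)) x
      (hasFDerivAt_ionSeq w x.2.1) (hasFDerivAt_posL x)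
  have h2 := hasFDerivAt_bilinear_self_comp (pairDensity N) (hasFDerivAt_psiL x)
  exact h1.add (h2.const_smul (-e))

/-- The kinetic energy of the ions. -/
def ionKinetic (M : ℝ) (p : Lattice N → Space) : ℝ := ∑ n, ‖p n‖ ^ 2 / (2 * M)

/-- The derivative of the kinetic energy of the ions. -/
def ionKineticDeriv (M : ℝ) (p : Lattice N → Space) : (Lattice N → Space) →L[ℝ] ℝ :=
  ∑ n, M⁻¹ • (innerSL ℝ (p n)).comp (ContinuousLinearMap.proj n)

lemma ionKineticDeriv_apply (M : ℝ) (p u : Lattice N → Space) :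
    ionKineticDeriv M p u = ∑ n, M⁻¹ * inner ℝ (p n) (u n) := by
  simp [ionKineticDeriv, sum_apply]

lemma hasFDerivAt_ionKinetic (M : ℝ) (p : Lattice N → Space) :
    HasFDerivAt (ionKinetic M) (ionKineticDeriv M p) p := by
  refine HasFDerivAt.fun_sum fun n _ => ?_
  have h4 := (ContinuousLinearMap.proj (R := ℝ) (φ := fun _ : Lattice N => Space) n).hasFDerivAt
    (x := p)
  refine ((h4.norm_sq.mul_const (2 * M)⁻¹).congr_fderiv ?_).congr_of_eventuallyEq
    (Eventually.of_forall fun x => div_eq_mul_inv _ _)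
  ext Y
  simp
  ring

/-- The derivative of the energy. -/
def energyDeriv (e M : ℝ) (w : Seq) (x : Tangent N) : Tangent N →L[ℝ] ℝ :=
  (gradForm N x.1).comp (psiL N) + (coulomb N (rho e w x)).comp (rhoDeriv e w x) +
    (ionKineticDeriv M x.2.2).comp (momL N)

lemma energyDeriv_apply (e M : ℝ) (w : Seq) (x Y : Tangent N) :
    energyDeriv e M w x Y = gradForm N x.1 Y.1 + coulomb N (rho e w x) (rhoDeriv e w x Y) +
      ionKineticDeriv M x.2.2 Y.2.2 := rfl

lemma hasFDerivAt_energyL (e M : ℝ) (w : Seq) (x : Tangent N) :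
    HasFDerivAt (energyL e M w) (energyDeriv e M w x) x := by
  have h1 := hasFDerivAt_half_bilinear_self_comp (gradForm N) gradForm_symm (hasFDerivAt_psiL x)
  have h2 := hasFDerivAt_half_bilinear_self_comp (coulomb N) coulomb_symm (hasFDerivAt_rho e w x)
  have h3 := (hasFDerivAt_ionKinetic M x.2.2).comp x (hasFDerivAt_momL x)
  exact (h1.add h2).add h3

/-- Displacing a projected point is projecting a sum, so the derivative along the tangent space is
the ordinary derivative of the lifted energy. -/
lemma hasFDerivAt_energy_displace (e M : ℝ) {σ : Torus N → ℝ}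
    (hσ : ContDiff ℝ 2 fun y => σ (toTorus N y)) (x : Tangent N) :
    HasFDerivAt (fun Y => energy e M σ (displace (project x) Y))
      (energyDeriv e M (sigmaSeq hσ) x) 0 := by
  have h : (fun Y => energy e M σ (displace (project x) Y)) =
      fun Y => energyL e M (sigmaSeq hσ) (x + Y) := by
    funext Y
    rw [displace_project, energy_project e M hσ]
  rw [h]
  have h1 := hasFDerivAt_energyL e M (sigmaSeq hσ) (x + 0)
  rw [add_zero] at h1
  exact (hasFDerivAt_comp_add_left x).2 (by simpa using h1)

end Energy

/-! ## Families of maps that are bounded and Lipschitz on balls -/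

section LipOnBalls

variable {E F G H : Type*} [NormedAddCommGroup E] [NormedAddCommGroup F] [NormedAddCommGroup G]
  [NormedAddCommGroup H]

/-- A family of maps that are bounded and Lipschitz on balls, uniformly in the parameter. -/
def LipOnBalls (f : ℝ → E → F) : Prop :=
  ∀ R, ∃ L, 0 ≤ L ∧ (∀ t x, ‖x‖ ≤ R → ‖f t x‖ ≤ L) ∧
    ∀ t x y, ‖x‖ ≤ R → ‖y‖ ≤ R → ‖f t x - f t y‖ ≤ L * ‖x - y‖

lemma lipOnBalls_clm [NormedSpace ℝ E] [NormedSpace ℝ F] (A : E →L[ℝ] F) : LipOnBalls fun _ x => A x := by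
  intro R
  refine ⟨‖A‖ * (1 + |R|), by positivity, fun t x hx => ?_, fun t x y _ _ => ?_⟩
  · exact (A.le_opNorm x).trans (mul_le_mul_of_nonneg_left
      (by linarith [le_abs_self R]) (norm_nonneg _))
  · rw [← map_sub]
    refine (A.le_opNorm _).trans (mul_le_mul_of_nonneg_right ?_ (norm_nonneg _))
    nlinarith [norm_nonneg A, abs_nonneg R]

lemma LipOnBalls.clm [NormedSpace ℝ F] [NormedSpace ℝ G] {f : ℝ → E → F} (hf : LipOnBalls f) (A : F →L[ℝ] G) :
    LipOnBalls fun t x => A (f t x) := by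
  intro R
  obtain ⟨L, hL, h1, h2⟩ := hf R
  refine ⟨‖A‖ * L, by positivity, fun t x hx => ?_, fun t x y hx hy => ?_⟩
  · exact (A.le_opNorm _).trans (mul_le_mul_of_nonneg_left (h1 t x hx) (norm_nonneg _))
  · rw [← map_sub, mul_assoc]
    exact (A.le_opNorm _).trans (mul_le_mul_of_nonneg_left (h2 t x y hx hy) (norm_nonneg _))

lemma LipOnBalls.bilinear [NormedSpace ℝ F] [NormedSpace ℝ G] [NormedSpace ℝ H]
    {f : ℝ → E → F} {g : ℝ → E → G} (hf : LipOnBalls f) (hg : LipOnBalls g)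
    (B : F →L[ℝ] G →L[ℝ] H) : LipOnBalls fun t x => B (f t x) (g t x) := by
  intro R
  obtain ⟨L, hL, h1, h2⟩ := hf R
  obtain ⟨K, hK, k1, k2⟩ := hg R
  have hB := norm_nonneg B
  refine ⟨‖B‖ * L * K * 2 , by positivity, fun t x hx => ?_, fun t x y hx hy => ?_⟩
  · have := B.le_opNorm₂ (f t x) (g t x)
    have h3 : ‖B‖ * ‖f t x‖ * ‖g t x‖ ≤ ‖B‖ * L * K :=
      mul_le_mul (mul_le_mul_of_nonneg_left (h1 t x hx) hB) (k1 t x hx) (norm_nonneg _)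
        (by positivity)
    have h4 : 0 ≤ ‖B‖ * L * K := by positivity
    linarith
  · have e : B (f t x) (g t x) - B (f t y) (g t y) =
        B (f t x - f t y) (g t x) + B (f t y) (g t x - g t y) := by
      simp only [map_sub, sub_apply]; abel
    rw [e]
    have h3 := B.le_opNorm₂ (f t x - f t y) (g t x)
    have h4 := B.le_opNorm₂ (f t y) (g t x - g t y)
    have h5 : ‖B‖ * ‖f t x - f t y‖ * ‖g t x‖ ≤ ‖B‖ * (L * ‖x - y‖) * K :=
      mul_le_mul (mul_le_mul_of_nonneg_left (h2 t x y hx hy) hB) (k1 t x hx) (norm_nonneg _)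
        (by positivity)
    have h6 : ‖B‖ * ‖f t y‖ * ‖g t x - g t y‖ ≤ ‖B‖ * L * (K * ‖x - y‖) :=
      mul_le_mul (mul_le_mul_of_nonneg_left (h1 t y hy) hB) (k2 t x y hx hy) (norm_nonneg _)
        (by positivity)
    refine (norm_add_le _ _).trans ?_
    linarith

lemma LipOnBalls.add {f g : ℝ → E → F} (hf : LipOnBalls f) (hg : LipOnBalls g) :
    LipOnBalls fun t x => f t x + g t x := by
  intro R
  obtain ⟨L, hL, h1, h2⟩ := hf R
  obtain ⟨K, hK, k1, k2⟩ := hg R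
  refine ⟨L + K, by positivity, fun t x hx => ?_, fun t x y hx hy => ?_⟩
  · exact (norm_add_le _ _).trans (add_le_add (h1 t x hx) (k1 t x hx))
  · rw [add_sub_add_comm, add_mul]
    exact (norm_add_le _ _).trans (add_le_add (h2 t x y hx hy) (k2 t x y hx hy))

lemma LipOnBalls.prodMk {f : ℝ → E → F} {g : ℝ → E → G} (hf : LipOnBalls f) (hg : LipOnBalls g) :
    LipOnBalls fun t x => (f t x, g t x) := by
  intro R
  obtain ⟨L, hL, h1, h2⟩ := hf R
  obtain ⟨K, hK, k1, k2⟩ := hg R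
  refine ⟨max L K, le_max_of_le_left hL, fun t x hx => ?_, fun t x y hx hy => ?_⟩
  · exact max_le_max (h1 t x hx) (k1 t x hx)
  · refine max_le ?_ ?_
    · exact (h2 t x y hx hy).trans (mul_le_mul_of_nonneg_right (le_max_left _ _) (norm_nonneg _))
    · exact (k2 t x y hx hy).trans (mul_le_mul_of_nonneg_right (le_max_right _ _) (norm_nonneg _))

/-- The bounds are uniform in the parameter so that conjugation by the time-dependent free evolution
costs nothing. The map `U t` is not assumed linear, hence the two separate hypotheses. -/
lemma LipOnBalls.isometry {f : ℝ → E → F} (hf : LipOnBalls f) (U : ℝ → F → G)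
    (h0 : ∀ t u, ‖U t u‖ = ‖u‖) (hs : ∀ t u v, ‖U t u - U t v‖ = ‖u - v‖) :
    LipOnBalls fun t x => U t (f t x) := by
  intro R
  obtain ⟨L, hL, h1, h2⟩ := hf R
  exact ⟨L, hL, fun t x hx => (h0 t _).trans_le (h1 t x hx),
    fun t x y hx hy => (hs t _ _).trans_le (h2 t x y hx hy)⟩

lemma lipOnBalls_of_lipschitz {g : E → F} {K : ℝ} (hK : 0 ≤ K) (hb : ∀ x, ‖g x‖ ≤ K)
    (hl : ∀ x y, ‖g x - g y‖ ≤ K * ‖x - y‖) : LipOnBalls fun _ x => g x :=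
  fun _ => ⟨K, hK, fun _ x _ => hb x, fun _ x y _ _ => hl x y⟩

end LipOnBalls

/-! ## The equation of motion in the interaction picture -/

section Field

variable {N : ℕ} [NeZero N]

/-- The linear form `∑ₙ uₙ · vₙ` as a vector `u`. -/
def formVec (N : ℕ) [NeZero N] : ((Lattice N → Space) →L[ℝ] ℝ) →L[ℝ] (Lattice N → Space) :=
  ContinuousLinearMap.pi fun n => ∑ a : Fin 3,
    (ContinuousLinearMap.apply ℝ ℝ
      (Pi.single n (EuclideanSpace.single a 1) : Lattice N → Space)).smulRight
        (EuclideanSpace.single a (1 : ℝ))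

/-- Riesz representation in coordinates: the vector collects the values of the form on the standard
basis. -/
lemma sum_inner_formVec (l : (Lattice N → Space) →L[ℝ] ℝ) (v : Lattice N → Space) :
    ∑ n, inner ℝ (formVec N l n) (v n) = l v := by
  have h1 : ∀ n, inner ℝ (formVec N l n) (v n) = l (Pi.single n (v n)) := by
    intro n
    have h2 : v n = ∑ a, (v n a) • (EuclideanSpace.single a (1 : ℝ) : Space) := by
      ext b; simp [Finset.sum_apply, Pi.single_apply]
    have h3 : (Pi.single n (v n) : Lattice N → Space) =
        ∑ a, (v n a) • Pi.single n (EuclideanSpace.single a (1 : ℝ) : Space) := by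
      conv_lhs => rw [h2]
      exact (map_sum (LinearMap.single ℝ (fun _ : Lattice N => Space) n)
        (fun a => (v n a) • (EuclideanSpace.single a (1 : ℝ) : Space)) Finset.univ).trans
        (Finset.sum_congr rfl fun a _ => Pi.single_smul n (v n a) _)
    rw [h3, map_sum]
    simp only [formVec, ContinuousLinearMap.pi_apply, sum_apply, sum_inner,
      ContinuousLinearMap.smulRight_apply, ContinuousLinearMap.apply_apply, inner_smul_left, map_smul,
      smul_eq_mul]
    refine Finset.sum_congr rfl fun a _ => ?_
    rw [EuclideanSpace.inner_single_left]
    simp [mul_comm]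
  rw [Finset.sum_congr rfl fun n _ => h1 n, ← map_sum, Finset.univ_sum_single]

/-- The force on the ions. -/
def force (e : ℝ) (w : Seq) (x : Tangent N) : Lattice N → Space :=
  -formVec N ((coulomb N (rho e w x)).comp (ionSeqDeriv w (toTorusL x.2.1)))

/-- Multiplication by `ie`. -/
def mulIe (N : ℕ) [NeZero N] (e : ℝ) : Fermion N →L[ℝ] Fermion N :=
  LinearMap.mkContinuous
    { toFun := fun ψ => (Complex.I * e : ℂ) • ψ
      map_add' := fun ψ φ => smul_add _ ψ φ
      map_smul' := fun c ψ => smul_comm _ c ψ } |e| fun ψ => by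
    have h := norm_smul (Complex.I * e : ℂ) ψ
    rw [norm_mul, Complex.norm_I, one_mul, Complex.norm_real, Real.norm_eq_abs] at h
    exact h.le

lemma mulIe_apply (e : ℝ) (ψ : Fermion N) : mulIe N e ψ = (Complex.I * e : ℂ) • ψ := rfl

/-- The interaction part `ieΦψ` of the Schrödinger equation. -/
def interaction (e : ℝ) (w : Seq) (x : Tangent N) : Fermion N :=
  mulIe N e (potential N (rho e w x) x.1)

/-- The phase point with the free evolution undone. -/
def evolve (t : ℝ) (x : Tangent N) : Tangent N := (freeEvol t x.1, x.2.1, x.2.2)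

/-- The vector field in the interaction picture. -/
def field (e M : ℝ) (w : Seq) (t : ℝ) (x : Tangent N) : Tangent N :=
  (freeEvol (-t) (interaction e w (evolve t x)), M⁻¹ • x.2.2, force e w (evolve t x))

lemma evolve_zero (x : Tangent N) : evolve 0 x = x :=
  Prod.ext (freeEvol_zero x.1) rfl

lemma lipOnBalls_psi : LipOnBalls fun t (x : Tangent N) => (evolve t x).1 :=
  (lipOnBalls_clm (psiL N)).isometry (fun t ψ => freeEvol t ψ) norm_freeEvol fun t u v => by
    rw [← freeEvol_sub, norm_freeEvol]

lemma lipOnBalls_comp_posL {F : Type*} [NormedAddCommGroup F] [NormedSpace ℝ F]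
    {g : (Lattice N → Space) → F} {K : ℝ} (hK : 0 ≤ K) (hb : ∀ x, ‖g x‖ ≤ K)
    (hl : ∀ x y, ‖g x - g y‖ ≤ K * ‖x - y‖) : LipOnBalls fun _ (x : Tangent N) => g x.2.1 :=
  lipOnBalls_of_lipschitz hK (fun x => hb x.2.1) fun x y =>
    (hl x.2.1 y.2.1).trans (mul_le_mul_of_nonneg_left
      ((norm_fst_le (x - y).2).trans (norm_snd_le (x - y))) hK)

lemma lipOnBalls_rho (e : ℝ) (w : Seq) :
    LipOnBalls fun t (x : Tangent N) => rho e w (evolve t x) := by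
  have h1 : LipOnBalls fun _ (x : Tangent N) => ionSeq w (toTorusL x.2.1) :=
    lipOnBalls_comp_posL (g := fun q => ionSeq w (toTorusL q)) (ionConst_nonneg w)
      (fun q => norm_ionSeq_le w _) (norm_ionSeq_sub_le w)
  have h2 := (lipOnBalls_psi (N := N)).bilinear lipOnBalls_psi (pairDensity N)
  exact h1.add (h2.clm ((-e) • ContinuousLinearMap.id ℝ Seq))

lemma lipOnBalls_force (e : ℝ) (w : Seq) :
    LipOnBalls fun t (x : Tangent N) => force e w (evolve t x) := by
  have h1 : LipOnBalls fun _ (x : Tangent N) => ionSeqDeriv w (toTorusL x.2.1) :=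
    lipOnBalls_comp_posL (g := fun q => ionSeqDeriv w (toTorusL q)) (ionConst_nonneg w)
      (fun q => norm_ionSeqDeriv_le w _) (norm_ionSeqDeriv_sub_le w)
  have h2 := ((lipOnBalls_rho (N := N) e w).clm (coulomb N)).bilinear h1
    (ContinuousLinearMap.compL ℝ (Lattice N → Space) Seq ℝ)
  exact h2.clm (-formVec N)

lemma lipOnBalls_interaction (e : ℝ) (w : Seq) :
    LipOnBalls fun t (x : Tangent N) => interaction e w (evolve t x) :=
  ((lipOnBalls_rho (N := N) e w).bilinear lipOnBalls_psi (potential N)).clm (mulIe N e)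

/-- The dependence on ψ is through bounded bilinear maps and the dependence on q is bounded and
Lipschitz. The Laplacian is absent from the interaction picture, so no derivative is lost. -/
lemma lipOnBalls_field (e M : ℝ) (w : Seq) : LipOnBalls (field (N := N) e M w) := by
  have h1 := (lipOnBalls_interaction (N := N) e w).isometry (fun t ψ => freeEvol (-t) ψ)
    (fun t => norm_freeEvol (-t)) fun t u v => by rw [← freeEvol_sub, norm_freeEvol]
  have h2 := lipOnBalls_clm (M⁻¹ • momL N)
  exact h1.prodMk (h2.prodMk (lipOnBalls_force e w))

lemma continuous_ionSeqDeriv (w : Seq) :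
    Continuous fun q : Lattice N → Space => ionSeqDeriv w (toTorusL q) :=
  (LipschitzWith.of_dist_le_mul (K := ⟨ionConst N w, ionConst_nonneg w⟩) fun q q' => by
    rw [dist_eq_norm, dist_eq_norm]; exact norm_ionSeqDeriv_sub_le w q q').continuous

lemma continuous_rho (e : ℝ) (w : Seq) : Continuous (rho (N := N) e w) :=
  continuous_iff_continuousAt.2 fun x => (hasFDerivAt_rho e w x).continuousAt

lemma continuous_force (e : ℝ) (w : Seq) : Continuous (force (N := N) e w) := by
  have h1 : Continuous fun x : Tangent N => ionSeqDeriv w (toTorusL x.2.1) :=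
    (continuous_ionSeqDeriv w).comp (posL N).continuous
  have h2 : Continuous fun x : Tangent N => coulomb N (rho e w x) :=
    (coulomb N).continuous.comp (continuous_rho e w)
  exact ((formVec N).continuous.comp (h2.clm_comp h1)).neg

lemma continuous_interaction (e : ℝ) (w : Seq) : Continuous (interaction (N := N) e w) :=
  (mulIe N e).continuous.comp
    (((potential N).continuous.comp (continuous_rho e w)).clm_apply (psiL N).continuous)

lemma continuous_evolve : Continuous fun p : ℝ × Tangent N => evolve p.1 p.2 :=
  (continuous_freeEvol_comp continuous_fst (continuous_fst.comp continuous_snd)).prodMk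
    (continuous_snd.comp continuous_snd)

lemma continuous_field (e M : ℝ) (w : Seq) :
    Continuous fun p : ℝ × Tangent N => field e M w p.1 p.2 := by
  have h1 : Continuous fun p : ℝ × Tangent N =>
      freeEvol (-p.1) (interaction e w (evolve p.1 p.2)) :=
    continuous_freeEvol_comp continuous_fst.neg ((continuous_interaction e w).comp continuous_evolve)
  have h2 : Continuous fun p : ℝ × Tangent N => M⁻¹ • p.2.2.2 :=
    ((momL N).continuous.comp continuous_snd).const_smul M⁻¹
  exact h1.prodMk (h2.prodMk ((continuous_force e w).comp continuous_evolve))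

end Field

/-! ## Global existence for ordinary differential equations with an a priori bound -/

section Ode

variable {E : Type*} [NormedAddCommGroup E] [NormedSpace ℝ E]

/-- The radial projection onto the ball of radius `R`. -/
def radial (R : ℝ) (x : E) : E := (R / max R ‖x‖) • x

lemma norm_radial_le {R : ℝ} (hR : 0 < R) (x : E) : ‖radial R x‖ ≤ R := by
  have h : 0 < max R ‖x‖ := lt_max_of_lt_left hR
  rw [radial, norm_smul, Real.norm_of_nonneg (by positivity), div_mul_eq_mul_div, div_le_iff₀ h]
  exact mul_le_mul_of_nonneg_left (le_max_right _ _) hR.le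

lemma radial_of_le {R : ℝ} (hR : 0 < R) {x : E} (hx : ‖x‖ ≤ R) : radial R x = x := by
  rw [radial, max_eq_left hx, div_self hR.ne', one_smul]

lemma norm_radial_sub_le {R : ℝ} (hR : 0 < R) (x y : E) :
    ‖radial R x - radial R y‖ ≤ 2 * ‖x - y‖ := by
  set a := max R ‖x‖ with ha
  set b := max R ‖y‖ with hb
  have ha0 : 0 < a := lt_max_of_lt_left hR
  have hb0 : 0 < b := lt_max_of_lt_left hR
  have hRa : R ≤ a := le_max_left _ _
  have hyb : ‖y‖ ≤ b := le_max_right _ _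
  have hab : |b - a| ≤ ‖x - y‖ := by
    have h1 := abs_max_sub_max_le_abs ‖y‖ ‖x‖ R
    rw [max_comm, max_comm ‖x‖, ← ha, ← hb] at h1
    refine h1.trans ?_
    rw [norm_sub_rev]
    exact abs_norm_sub_norm_le y x
  -- The difference is the rescaled increment plus the change of the scaling factor. Each part is at
  -- most ‖x - y‖, whence the constant 2.
  have e : radial R x - radial R y = (R / a) • (x - y) + ((R / a) * ((b - a) / b)) • y := by
    rw [radial, radial, ← ha, ← hb, smul_sub, sub_add, ← sub_smul]
    congr 2
    field_simp
    ring
  have h1 : R / a ≤ 1 := (div_le_one ha0).2 hRa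
  have h2 : 0 ≤ R / a := by positivity
  rw [e]
  refine (norm_add_le _ _).trans ?_
  rw [norm_smul, norm_smul, norm_mul, Real.norm_of_nonneg h2, norm_div, Real.norm_of_nonneg hb0.le,
    Real.norm_eq_abs]
  have h3 : |b - a| / b * ‖y‖ ≤ ‖x - y‖ := by
    rw [div_mul_eq_mul_div, div_le_iff₀ hb0]
    exact mul_le_mul hab hyb (norm_nonneg _) (norm_nonneg _)
  have h4 : R / a * ‖x - y‖ ≤ ‖x - y‖ := mul_le_of_le_one_left (norm_nonneg _) h1
  have h5 : R / a * (|b - a| / b) * ‖y‖ ≤ ‖x - y‖ := by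
    rw [mul_assoc]
    refine (mul_le_of_le_one_left (by positivity) h1).trans h3
  linarith

/-- A field bounded by `L` cannot leave the ball of radius `L * T` within time `T`, so
Picard–Lindelöf covers the whole interval without any smallness assumption. -/
lemma exists_solution_of_bounded_lipschitz [CompleteSpace E] {g : ℝ → E → E} {L K : ℝ}
    (hL : 0 ≤ L) (hK : 0 ≤ K) (hg : ∀ x, Continuous fun t => g t x) (hb : ∀ t x, ‖g t x‖ ≤ L)
    (hl : ∀ t x y, ‖g t x - g t y‖ ≤ K * ‖x - y‖) (x₀ : E) {T : ℝ} (hT : 0 ≤ T) :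
    ∃ x : ℝ → E, x 0 = x₀ ∧
      ∀ t ∈ Set.Icc (-T) T, HasDerivWithinAt x (g t (x t)) (Set.Icc (-T) T) t := by
  have h0 : (0 : ℝ) ∈ Set.Icc (-T) T := ⟨by linarith, hT⟩
  have h : IsPicardLindelof g (⟨0, h0⟩ : Set.Icc (-T) T) x₀ ⟨L * T, by positivity⟩ 0 ⟨L, hL⟩
      ⟨K, hK⟩ :=
    { lipschitzOnWith := fun t _ => (LipschitzWith.of_dist_le_mul fun x y => by
        rw [dist_eq_norm, dist_eq_norm]; exact hl t x y).lipschitzOnWith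
      continuousOn := fun x _ => (hg x).continuousOn
      norm_le := fun t _ x _ => hb t x
      mul_max_le := by
        change L * max (T - 0) (0 - -T) ≤ L * T - 0
        simp }
  obtain ⟨x, hx, hx'⟩ := h.exists_eq_forall_mem_Icc_hasDerivWithinAt₀
  exact ⟨x, hx, hx'⟩

lemma eqOn_of_lipOnBalls {f : ℝ → E → E} (hl : LipOnBalls f) {x y : ℝ → E} {T R : ℝ}
    (hT : 0 < T) (hx : ∀ t ∈ Set.Ioo (-T) T, HasDerivAt x (f t (x t)) t ∧ ‖x t‖ ≤ R)
    (hy : ∀ t ∈ Set.Ioo (-T) T, HasDerivAt y (f t (y t)) t ∧ ‖y t‖ ≤ R) (h0 : x 0 = y 0) :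
    Set.EqOn x y (Set.Ioo (-T) T) := by
  obtain ⟨L, hL, -, h2⟩ := hl R
  refine ODE_solution_unique_of_mem_Ioo (v := f) (s := fun _ => {x | ‖x‖ ≤ R}) (K := ⟨L, hL⟩)
    (t₀ := 0) (fun t _ => ?_) ⟨by linarith, hT⟩ hx hy h0
  refine LipschitzOnWith.of_dist_le_mul fun u hu v hv => ?_
  rw [dist_eq_norm, dist_eq_norm]
  exact h2 t u v hu hv

lemma eq_of_hasDerivAt_of_lipOnBalls {f : ℝ → E → E} (hl : LipOnBalls f) {x y : ℝ → E}
    (hx : ∀ t, HasDerivAt x (f t (x t)) t) (hy : ∀ t, HasDerivAt y (f t (y t)) t)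
    (h0 : x 0 = y 0) : x = y := by
  have hxc : Continuous x := continuous_iff_continuousAt.2 fun t => (hx t).continuousAt
  have hyc : Continuous y := continuous_iff_continuousAt.2 fun t => (hy t).continuousAt
  funext t
  set T := |t| + 1 with hT
  obtain ⟨A, hA⟩ := (isCompact_Icc (a := -T) (b := T)).exists_bound_of_continuousOn hxc.continuousOn
  obtain ⟨B, hB⟩ := (isCompact_Icc (a := -T) (b := T)).exists_bound_of_continuousOn hyc.continuousOn
  refine eqOn_of_lipOnBalls hl (T := T) (R := max A B) (by positivity)
    (fun s hs => ⟨hx s, (hA s ⟨hs.1.le, hs.2.le⟩).trans (le_max_left _ _)⟩)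
    (fun s hs => ⟨hy s, (hB s ⟨hs.1.le, hs.2.le⟩).trans (le_max_right _ _)⟩) h0 ?_
  have h1 := neg_abs_le t
  have h2 := le_abs_self t
  exact ⟨by linarith, by linarith⟩

/-- The field is truncated radially at R + 1 and solved globally. A continuity argument then shows
that the truncation is never active, because the a priori bound R lies strictly below R + 1. -/
lemma exists_solution_Icc [CompleteSpace E] {f : ℝ → E → E} (hl : LipOnBalls f)
    (hc : ∀ x, Continuous fun t => f t x) (x₀ : E) {T R : ℝ} (hT : 0 ≤ T)
    (hap : ∀ s ∈ Set.Icc 0 T, ∀ x : ℝ → E, x 0 = x₀ →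
      (∀ t ∈ Set.Icc (-s) s, HasDerivWithinAt x (f t (x t)) (Set.Icc (-s) s) t) →
        ∀ t ∈ Set.Icc (-s) s, ‖x t‖ ≤ R) :
    ∃ x : ℝ → E, x 0 = x₀ ∧ ∀ t ∈ Set.Icc (-T) T,
      HasDerivWithinAt x (f t (x t)) (Set.Icc (-T) T) t ∧ ‖x t‖ ≤ R := by
  -- The a priori bound with `s = 0` applies to the constant curve, since any derivative is
  -- admissible within a single point.
  have hx₀ : ‖x₀‖ ≤ R := by
    refine hap 0 ⟨le_rfl, hT⟩ (fun _ => x₀) rfl (fun t ht => ?_) 0 (by simp)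
    refine HasFDerivWithinAt.of_subsingleton ?_
    simp
  have hR : 0 ≤ R := (norm_nonneg _).trans hx₀
  have hR1 : 0 < R + 1 := by linarith
  obtain ⟨L, hL, hb, hlip⟩ := hl (R + 1)
  obtain ⟨x, hx0, hx⟩ := exists_solution_of_bounded_lipschitz
    (g := fun t x => f t (radial (R + 1) x)) (L := L) (K := L * 2) hL (by positivity)
    (fun x => hc _) (fun t x => hb t _ (norm_radial_le hR1 x))
    (fun t x y => by
      refine (hlip t _ _ (norm_radial_le hR1 x) (norm_radial_le hR1 y)).trans ?_
      rw [mul_assoc]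
      exact mul_le_mul_of_nonneg_left (norm_radial_sub_le hR1 x y) hL) x₀ hT
  have hxc : ContinuousOn x (Set.Icc (-T) T) := fun t ht => (hx t ht).continuousWithinAt
  -- While the curve stays within R + 1, the truncated and the true equation agree, and the bound
  -- improves to R.
  have hmain : ∀ s ∈ Set.Icc 0 T, (∀ t ∈ Set.Icc (-s) s, ‖x t‖ ≤ R + 1) →
      ∀ t ∈ Set.Icc (-s) s, ‖x t‖ ≤ R := by
    intro s hs hbd
    refine hap s hs x hx0 fun t ht => ?_
    have hsub : Set.Icc (-s) s ⊆ Set.Icc (-T) T :=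
      Set.Icc_subset_Icc (neg_le_neg hs.2) hs.2
    have := (hx t (hsub ht)).mono hsub
    rwa [radial_of_le hR1 (hbd t ht)] at this
  have hball : ∀ t ∈ Set.Icc (-T) T, ‖x t‖ ≤ R + 1 := by
    by_contra! hcon
    -- The half-lengths `s` at which the curve has norm at least R + 1 at `s` or at `-s`. The set is
    -- closed, and its least element leads to a contradiction; both signs occur because the a priori
    -- bound concerns symmetric intervals.
    set S : Set ℝ := {s ∈ Set.Icc 0 T | R + 1 ≤ max ‖x s‖ ‖x (-s)‖} with hS
    have hcont : ContinuousOn (fun s => max ‖x s‖ ‖x (-s)‖) (Set.Icc 0 T) := by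
      refine ContinuousOn.sup (hxc.mono (Set.Icc_subset_Icc (by linarith) le_rfl)).norm ?_
      refine (hxc.comp continuous_neg.continuousOn fun s hs => ?_).norm
      exact ⟨neg_le_neg hs.2, by linarith [hs.1]⟩
    have hSc : IsClosed S := hcont.preimage_isClosed_of_isClosed isClosed_Icc isClosed_Ici
    obtain ⟨t, ht, htR⟩ := hcon
    have hSn : S.Nonempty := by
      rcases le_total 0 t with h | h
      · exact ⟨t, ⟨h, ht.2⟩, htR.le.trans (le_max_left _ _)⟩
      · refine ⟨-t, ⟨by linarith, by linarith [ht.1]⟩, ?_⟩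
        rw [neg_neg]
        exact htR.le.trans (le_max_right _ _)
    have hbdd : BddBelow S := ⟨0, fun s hs => hs.1.1⟩
    set s₀ := sInf S with hs₀
    have hmem : s₀ ∈ S := hSc.csInf_mem hSn hbdd
    have hlt : ∀ t ∈ Set.Icc (-s₀) s₀, |t| < s₀ → ‖x t‖ ≤ R + 1 := by
      intro t ht htl
      by_contra! hgt
      have h1 : |t| ∈ S := by
        refine ⟨⟨abs_nonneg t, htl.le.trans hmem.1.2⟩, ?_⟩
        rcases abs_cases t with h | h
        · rw [h.1]; exact hgt.le.trans (le_max_left _ _)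
        · rw [h.1, neg_neg]; exact hgt.le.trans (le_max_right _ _)
      exact absurd (csInf_le hbdd h1) (not_le.2 htl)
    -- Minimality of `s₀` covers the open interval, and continuity adds the endpoints. The case `s₀
    -- = 0` is separate because the open interval is then empty.
    have hle : ∀ t ∈ Set.Icc (-s₀) s₀, ‖x t‖ ≤ R + 1 := by
      rcases hmem.1.1.eq_or_lt with h0 | h0
      · intro t ht
        rw [← h0] at ht
        have : t = 0 := le_antisymm ht.2 (by simpa using ht.1)
        rw [this, hx0]; linarith
      · have hcl : closure (Set.Ioo (-s₀) s₀) = Set.Icc (-s₀) s₀ :=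
          closure_Ioo (by linarith : -s₀ ≠ s₀)
        intro t ht
        have hsub : Set.Icc (-s₀) s₀ ⊆ Set.Icc (-T) T :=
          Set.Icc_subset_Icc (neg_le_neg hmem.1.2) hmem.1.2
        have hcl' : ContinuousOn (fun t => ‖x t‖) (closure (Set.Ioo (-s₀) s₀)) := by
          rw [hcl]; exact (hxc.mono hsub).norm
        have := le_on_closure (s := Set.Ioo (-s₀) s₀) (f := fun t => ‖x t‖) (g := fun _ => R + 1)
          (fun t ht => hlt t ⟨ht.1.le, ht.2.le⟩ (abs_lt.2 ht)) hcl' continuousOn_const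
        exact this (hcl ▸ ht)
    have hfin := hmain s₀ hmem.1 hle
    have h1 := hfin s₀ ⟨by linarith [hmem.1.1], le_rfl⟩
    have h2 := hfin (-s₀) ⟨le_rfl, by linarith [hmem.1.1]⟩
    have h3 := hmem.2.trans (max_le h1 h2)
    linarith
  have hfin := hmain T ⟨hT, le_rfl⟩ hball
  refine ⟨x, hx0, fun t ht => ⟨?_, hfin t ht⟩⟩
  have := hx t ht
  rwa [radial_of_le hR1 (hball t ht)] at this

/-- Solutions on the intervals (-(n+1), n+1) agree where both are defined, so they can be glued; at
time `t` the one with index ⌊|t|⌋ is used. -/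
theorem exists_global_solution [CompleteSpace E] {f : ℝ → E → E} (hl : LipOnBalls f)
    (hc : ∀ x, Continuous fun t => f t x) (x₀ : E)
    (hap : ∀ T, 0 ≤ T → ∃ R, ∀ s ∈ Set.Icc 0 T, ∀ x : ℝ → E, x 0 = x₀ →
      (∀ t ∈ Set.Icc (-s) s, HasDerivWithinAt x (f t (x t)) (Set.Icc (-s) s) t) →
        ∀ t ∈ Set.Icc (-s) s, ‖x t‖ ≤ R) :
    ∃ x : ℝ → E, x 0 = x₀ ∧ ∀ t, HasDerivAt x (f t (x t)) t := by
  have h1 : ∀ n : ℕ, ∃ (x : ℝ → E) (R : ℝ), x 0 = x₀ ∧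
      ∀ t ∈ Set.Ioo (-(n + 1 : ℝ)) (n + 1), HasDerivAt x (f t (x t)) t ∧ ‖x t‖ ≤ R := by
    intro n
    obtain ⟨R, hR⟩ := hap (n + 1) (by positivity)
    obtain ⟨x, hx0, hx⟩ := exists_solution_Icc hl hc x₀ (by positivity) hR
    refine ⟨x, R, hx0, fun t ht => ?_⟩
    have h2 := hx t ⟨ht.1.le, ht.2.le⟩
    exact ⟨h2.1.hasDerivAt (Icc_mem_nhds ht.1 ht.2), h2.2⟩
  choose x R hx0 hx using h1
  have heq : ∀ m n : ℕ, m ≤ n → ∀ t : ℝ, |t| < m + 1 → x m t = x n t := by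
    intro m n hmn t ht
    have hmn' : (m : ℝ) ≤ n := by exact_mod_cast hmn
    refine eqOn_of_lipOnBalls hl (T := m + 1) (R := max (R m) (R n)) (by positivity)
      (fun s hs => ⟨(hx m s hs).1, (hx m s hs).2.trans (le_max_left _ _)⟩)
      (fun s hs => ?_) ((hx0 m).trans (hx0 n).symm) (abs_lt.1 ht)
    have hs' : s ∈ Set.Ioo (-(n + 1 : ℝ)) (n + 1) := ⟨by linarith [hs.1], by linarith [hs.2]⟩
    exact ⟨(hx n s hs').1, (hx n s hs').2.trans (le_max_right _ _)⟩
  refine ⟨fun t => x ⌊|t|⌋₊ t, hx0 _, fun t => ?_⟩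
  -- One more than the index used at `t`: then |s| < n for all `s` near `t`, and there the glued
  -- curve coincides with the single solution `x n`.
  set n := ⌊|t|⌋₊ + 1 with hn
  have htn : |t| < n := by rw [hn]; push_cast; exact Nat.lt_floor_add_one _
  have hloc : ∀ s : ℝ, |s| < n → x ⌊|s|⌋₊ s = x n s := fun s hs =>
    heq _ _ (Nat.floor_le_of_le hs.le) s (Nat.lt_floor_add_one _)
  have hd := (hx n t (abs_lt.1 (by linarith : |t| < n + 1))).1
  rw [← hloc t htn] at hd
  refine hd.congr_of_eventuallyEq ?_
  filter_upwards [(continuous_abs.tendsto t).eventually (gt_mem_nhds htn)] with s hs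
  exact hloc s hs

end Ode

/-! ### Weak differentiation of an isometric evolution against moving test vectors -/

section Abstract

variable {E : Type*} [NormedAddCommGroup E] [NormedSpace ℝ E] (B G : E →L[ℝ] E →L[ℝ] ℝ)
  (U : ℝ → E →ₗᵢ[ℝ] E) (J : E →L[ℝ] E)

/-- Mean value inequality. The Lipschitz constant is proportional to ‖η‖, which is what allows the
test vector to vary with time. -/
lemma abs_form_sub_le (hd : ∀ η φ t, HasDerivAt (fun s => B η (U s φ)) (G η (J (U t φ))) t)
    (η φ : E) (s t : ℝ) :
    |B η (U s φ) - B η (U t φ)| ≤ ‖G‖ * ‖η‖ * (‖J‖ * ‖φ‖) * |s - t| := by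
  refine convex_univ.norm_image_sub_le_of_norm_hasDerivWithin_le
    (f := fun s => B η (U s φ)) (fun s _ => (hd η φ s).hasDerivWithinAt) (fun s _ => ?_)
    (Set.mem_univ _) (Set.mem_univ _)
  refine (G.le_opNorm₂ η _).trans (mul_le_mul_of_nonneg_left ?_ (by positivity))
  refine (J.le_opNorm _).trans_eq ?_
  rw [LinearIsometry.norm_map]

lemma tendsto_form_slope
    (hU : ∀ {l : Filter ℝ} {f : ℝ → ℝ} {g : ℝ → E} {t : ℝ} {φ : E}, Tendsto f l (𝓝 t) →
      Tendsto g l (𝓝 φ) → Tendsto (fun x => U (f x) (g x)) l (𝓝 (U t φ)))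
    (hd : ∀ η φ t, HasDerivAt (fun s => B η (U s φ)) (G η (J (U t φ))) t)
    {v : ℝ → E} {v' : E} {S : Set ℝ} {t : ℝ} (hv : HasDerivWithinAt v v' S t) {η : ℝ → E} {η₀ : E}
    (hη : Tendsto η (𝓝[S \ {t}] t) (𝓝 η₀)) :
    Tendsto (fun s => (s - t)⁻¹ * B (η s) (U s (v s) - U t (v t))) (𝓝[S \ {t}] t)
      (𝓝 (B η₀ (U t v') + G η₀ (J (U t (v t))))) := by
  have hs := hasDerivWithinAt_iff_tendsto_slope.1 hv
  have hid : Tendsto (fun s : ℝ => s) (𝓝[S \ {t}] t) (𝓝 t) :=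
    tendsto_nhdsWithin_of_tendsto_nhds tendsto_id
  have h1 : Tendsto (fun s => B (η s) (U s (slope v t s))) (𝓝[S \ {t}] t)
      (𝓝 (B η₀ (U t v'))) :=
    (B.continuous₂.tendsto (η₀, U t v')).comp (hη.prodMk_nhds (hU hid hs))
  have h2 : Tendsto (fun s => (s - t)⁻¹ * (B η₀ (U s (v t)) - B η₀ (U t (v t)))) (𝓝[S \ {t}] t)
      (𝓝 (G η₀ (J (U t (v t))))) :=
    hasDerivWithinAt_iff_tendsto_slope.1 ((hd η₀ (v t) t).hasDerivWithinAt (s := S))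
  have h3 : Tendsto (fun s => (s - t)⁻¹ *
      (B (η s - η₀) (U s (v t)) - B (η s - η₀) (U t (v t)))) (𝓝[S \ {t}] t) (𝓝 0) := by
    have h4 : Tendsto (fun s => ‖G‖ * ‖η s - η₀‖ * (‖J‖ * ‖v t‖)) (𝓝[S \ {t}] t) (𝓝 0) := by
      have := ((tendsto_iff_norm_sub_tendsto_zero.1 hη).const_mul ‖G‖).mul_const (‖J‖ * ‖v t‖)
      simpa using this
    refine squeeze_zero_norm' ?_ h4
    filter_upwards [self_mem_nhdsWithin] with s hst
    have hne : 0 < |s - t| := abs_pos.2 (sub_ne_zero.2 hst.2)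
    rw [norm_mul, norm_inv, Real.norm_eq_abs, Real.norm_eq_abs, inv_mul_le_iff₀ hne, mul_comm]
    exact abs_form_sub_le B G U J hd _ _ _ _
  have h5 := (h1.add h2).add h3
  rw [add_zero] at h5
  refine h5.congr fun s => ?_
  rw [slope_def_module, map_smul, map_smul, smul_eq_mul]
  simp only [map_sub, sub_apply]
  ring

end Abstract

/-! ### The L² and gradient forms under the free evolution -/

section Forms

variable {N : ℕ} [NeZero N]

/-- The real scalar product of `L²` on `ℱ`. -/
def l2Form (N : ℕ) [NeZero N] : Fermion N →L[ℝ] Fermion N →L[ℝ] ℝ :=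
  (reInner (L2 N)).bilinearComp ((waveL N).restrictScalars ℝ) ((waveL N).restrictScalars ℝ)

lemma l2Form_symm (ψ φ : Fermion N) : l2Form N ψ φ = l2Form N φ ψ :=
  reInner_symm (waveFn ψ) (waveFn φ)

lemma l2Form_self (ψ : Fermion N) : l2Form N ψ ψ = ‖waveFn ψ‖ ^ 2 := reInner_self (waveFn ψ)

lemma hasSum_l2Form (ψ φ : Fermion N) :
    HasSum (fun K => (starRingEnd ℂ (fc ψ K) * fc φ K).re) (l2Form N ψ φ) :=
  Complex.hasSum_re (hasSum_coef_mul (waveFn ψ) (waveFn φ))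

lemma hasSum_gradForm (ψ φ : Fermion N) :
    HasSum (fun K => (((weight K - 1 : ℝ) : ℂ) * (starRingEnd ℂ (fc ψ K) * fc φ K)).re)
      (gradForm N ψ φ) := by
  have h := (Complex.hasSum_re (hasSum_inner_fermion ψ φ)).sub (hasSum_l2Form ψ φ)
  refine h.congr_fun fun K => ?_
  rw [Complex.ofReal_sub, sub_mul, Complex.ofReal_one, one_mul, Complex.sub_re]

omit [NeZero N] in
lemma conj_phase_mul (t : ℝ) (K : Freq N) (a b : ℂ) :
    starRingEnd ℂ (phase t K * a) * (phase t K * b) = starRingEnd ℂ a * b := by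
  have h : starRingEnd ℂ (phase t K) * phase t K = 1 := by
    rw [mul_comm, Complex.mul_conj', norm_phase]; simp
  rw [map_mul]
  linear_combination (starRingEnd ℂ a * b) * h

lemma l2Form_freeEvol (t : ℝ) (ψ φ : Fermion N) :
    l2Form N (freeEvol t ψ) (freeEvol t φ) = l2Form N ψ φ := by
  refine (hasSum_l2Form (freeEvol t ψ) (freeEvol t φ)).unique
    ((hasSum_l2Form ψ φ).congr_fun fun K => ?_)
  rw [fc_freeEvol, fc_freeEvol, conj_phase_mul]

lemma gradForm_freeEvol (t : ℝ) (ψ φ : Fermion N) :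
    gradForm N (freeEvol t ψ) (freeEvol t φ) = gradForm N ψ φ := by
  refine (hasSum_gradForm (freeEvol t ψ) (freeEvol t φ)).unique
    ((hasSum_gradForm ψ φ).congr_fun fun K => ?_)
  rw [fc_freeEvol, fc_freeEvol, conj_phase_mul]

lemma fc_mulIe (a : ℝ) (ψ : Fermion N) (K : Freq N) :
    fc (mulIe N a ψ) K = Complex.I * a * fc ψ K := fc_smul _ _ _

/-- Multiplication by i is skew for the real part of a Hermitian form. Two independent real factors
are kept because the interaction carries `e` and the kinetic term carries `-1/2`. -/
lemma gradForm_mulIe (a b : ℝ) (ψ φ : Fermion N) :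
    b * gradForm N ψ (mulIe N a φ) = -(a * gradForm N φ (mulIe N b ψ)) := by
  refine ((hasSum_gradForm ψ (mulIe N a φ)).mul_left b).unique
    (((hasSum_gradForm φ (mulIe N b ψ)).mul_left a).neg.congr_fun fun K => ?_)
  rw [fc_mulIe, fc_mulIe]
  simp
  ring

lemma l2Form_mulIe_self (a : ℝ) (ψ : Fermion N) : l2Form N ψ (mulIe N a ψ) = 0 := by
  refine (hasSum_l2Form ψ (mulIe N a ψ)).unique (hasSum_zero.congr_fun fun K => ?_)
  rw [fc_mulIe]
  simp
  ring

lemma l2Form_mulIe (a : ℝ) (ψ φ : Fermion N) :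
    l2Form N ψ (mulIe N a φ) = -(a * (inner ℂ (waveFn ψ) (waveFn φ)).im) := by
  refine (hasSum_l2Form ψ (mulIe N a φ)).unique
    (((Complex.hasSum_im (hasSum_coef_mul (waveFn ψ) (waveFn φ))).mul_left a).neg.congr_fun
      fun K => ?_)
  rw [fc_mulIe]
  change _ = -(a * (starRingEnd ℂ (fc ψ K) * fc φ K).im)
  simp
  ring

lemma l2Form_mulIe_potential {r : Seq} (hr : IsRealSeq r) (a : ℝ) (ψ : Fermion N) :
    l2Form N ψ (mulIe N a (potential N r ψ)) = 0 := by
  refine (l2Form_mulIe a ψ (potential N r ψ)).trans ?_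
  rw [im_inner_potential_self hr ψ, mul_zero, neg_zero]

/-- Termwise differentiation produces |ξ|², which is shared between η and φ: the derivative series
is dominated by the two H¹ norm series, so Δ is never applied to an element of ℱ. -/
lemma hasDerivAt_l2Form_freeEvol (η φ : Fermion N) (t : ℝ) :
    HasDerivAt (fun s => l2Form N η (freeEvol s φ))
      (gradForm N η (mulIe N (-1 / 2) (freeEvol t φ))) t := by
  have h1 : (fun s => l2Form N η (freeEvol s φ)) =
      fun s => ∑' K, (starRingEnd ℂ (fc η K) * (phase s K * fc φ K)).re := by
    funext s
    rw [← (hasSum_l2Form η (freeEvol s φ)).tsum_eq]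
    simp only [fc_freeEvol]
  have h2 : gradForm N η (mulIe N (-1 / 2) (freeEvol t φ)) =
      ∑' K, (starRingEnd ℂ (fc η K) *
        ((-(Complex.I / 2) * (weight K - 1) * phase t K) * fc φ K)).re := by
    refine (hasSum_gradForm η (mulIe N (-1 / 2) (freeEvol t φ))).tsum_eq.symm.trans ?_
    refine tsum_congr fun K => ?_
    rw [fc_mulIe, fc_freeEvol]
    generalize fc η K = a, fc φ K = b, phase t K = c, weight K = m
    congr 1
    push_cast
    ring
  suffices key : HasDerivAt
      (fun s => ∑' K, (starRingEnd ℂ (fc η K) * (phase s K * fc φ K)).re)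
      (∑' K, (starRingEnd ℂ (fc η K) *
        ((-(Complex.I / 2) * (weight K - 1) * phase t K) * fc φ K)).re) t from
    (key.congr_deriv h2.symm).congr_of_eventuallyEq (Eventually.of_forall fun s => congrFun h1 s)
  refine hasDerivAt_tsum (𝕜 := ℝ) (F := ℝ)
    (g := fun K s => (starRingEnd ℂ (fc η K) * (phase s K * fc φ K)).re)
    (g' := fun K t => (starRingEnd ℂ (fc η K) *
      ((-(Complex.I / 2) * (weight K - 1) * phase t K) * fc φ K)).re) (u := fun K => weight K * ‖fc η K‖ ^ 2 + weight K * ‖fc φ K‖ ^ 2)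
    ((hasSum_fc_sq η).summable.add (hasSum_fc_sq φ).summable) (fun K s => ?_) (fun K s => ?_)
    (y₀ := 0) ?_ t
  · exact Complex.reCLM.hasFDerivAt.comp_hasDerivAt s
      (((hasDerivAt_phase s K).mul_const (fc φ K)).const_mul (starRingEnd ℂ (fc η K)))
  · refine (Complex.abs_re_le_norm _).trans ?_
    rw [norm_mul, norm_mul, norm_mul, norm_mul, norm_neg, norm_phase, RCLike.norm_conj]
    have h3 := one_le_weight K
    have h4 : ‖(weight K : ℂ) - 1‖ = weight K - 1 := by
      rw [← Complex.ofReal_one, ← Complex.ofReal_sub, Complex.norm_real,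
        Real.norm_of_nonneg (by linarith)]
    have h5 : ‖Complex.I / 2‖ = 1 / 2 := by simp
    rw [h4, h5]
    have h6 : 0 ≤ ‖fc η K‖ * ‖fc φ K‖ := by positivity
    have h7 := sq_nonneg (‖fc η K‖ - ‖fc φ K‖)
    have h8 : ‖fc η K‖ * ‖fc φ K‖ ≤ ‖fc η K‖ ^ 2 + ‖fc φ K‖ ^ 2 := by nlinarith
    have h9 : weight K * (‖fc η K‖ * ‖fc φ K‖) ≤ weight K * (‖fc η K‖ ^ 2 + ‖fc φ K‖ ^ 2) :=
      mul_le_mul_of_nonneg_left h8 (by linarith)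
    nlinarith
  · have := (hasSum_l2Form η (freeEvol 0 φ)).summable
    simpa only [fc_freeEvol] using this

/-- Weak differentiability of `t ↦ e^{itΔ/2} v(t)`, tested with converging functions. -/
lemma tendsto_l2Form_slope {v : ℝ → Fermion N} {v' : Fermion N} {S : Set ℝ} {t : ℝ}
    (hv : HasDerivWithinAt v v' S t) {η : ℝ → Fermion N} {η₀ : Fermion N}
    (hη : Tendsto η (𝓝[S \ {t}] t) (𝓝 η₀)) :
    Tendsto (fun s => (s - t)⁻¹ * l2Form N (η s) (freeEvol s (v s) - freeEvol t (v t)))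
      (𝓝[S \ {t}] t)
      (𝓝 (l2Form N η₀ (freeEvol t v') + gradForm N η₀ (mulIe N (-1 / 2) (freeEvol t (v t))))) :=
  tendsto_form_slope (l2Form N) (gradForm N) freeEvol (mulIe N (-1 / 2))
    (fun hf hg => tendsto_freeEvol hf hg) hasDerivAt_l2Form_freeEvol hv hη

end Forms

/-! ### The derivative of an interaction energy along a weakly differentiable path -/

section Abstract

lemma hasDerivWithinAt_half_bilinear_self {E : Type*} [NormedAddCommGroup E] [NormedSpace ℝ E]
    (B : E →L[ℝ] E →L[ℝ] ℝ) (hB : ∀ u v, B u v = B v u) {f : ℝ → E} {f' : E} {S : Set ℝ} {t : ℝ}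
    (hf : HasDerivWithinAt f f' S t) :
    HasDerivWithinAt (fun s => (1 / 2) * B (f s) (f s)) (B (f t) f') S t :=
  (hasFDerivAt_half_bilinear_self_comp B hB (hasFDerivAt_id (f t))).comp_hasDerivWithinAt t hf

lemma half_form_self_sub {R : Type*} [NormedAddCommGroup R] [NormedSpace ℝ R]
    (C : R →L[ℝ] R →L[ℝ] ℝ) (hC : ∀ u v, C u v = C v u) (u v : R) :
    (1 / 2) * C u u - (1 / 2) * C v v = (1 / 2) * C (u + v) (u - v) := by
  simp only [map_add, map_sub, add_apply]
  rw [hC v u]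
  ring

/-- The difference of squares for a density that is not symmetric in its arguments; it holds once a
form blind to their order is applied. -/
lemma form_density_sub {E R : Type*} [NormedAddCommGroup E] [NormedSpace ℝ E]
    [NormedAddCommGroup R] [NormedSpace ℝ R] (C : R →L[ℝ] ℝ) (n : E →L[ℝ] E →L[ℝ] R)
    (hn : ∀ ψ φ, C (n ψ φ) = C (n φ ψ)) (ψ φ : E) :
    C (n ψ ψ - n φ φ) = C (n (ψ - φ) (ψ + φ)) := by
  simp only [map_add, map_sub, sub_apply]
  rw [hn φ ψ]
  ring

lemma tendsto_comp_of_hasDerivWithinAt {E F : Type*} [NormedAddCommGroup E] [NormedSpace ℝ E]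
    [TopologicalSpace F] {f : ℝ → E → F} (hf : Continuous fun p : ℝ × E => f p.1 p.2)
    {x : ℝ → E} {x' : E} {S : Set ℝ} {t : ℝ} (hx : HasDerivWithinAt x x' S t) :
    Tendsto (fun s => f s (x s)) (𝓝[S \ {t}] t) (𝓝 (f t (x t))) := by
  have h1 : Tendsto x (𝓝[S \ {t}] t) (𝓝 (x t)) :=
    hx.continuousWithinAt.tendsto.mono_left (nhdsWithin_mono t Set.sdiff_subset)
  have hid : Tendsto (fun s : ℝ => s) (𝓝[S \ {t}] t) (𝓝 t) :=
    tendsto_nhdsWithin_of_tendsto_nhds tendsto_id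
  exact Tendsto.comp (g := fun p : ℝ × E => f p.1 p.2) (f := fun s => (s, x s))
    (hf.tendsto (t, x t)) (hid.prodMk_nhds h1)

lemma tendsto_bilinear {E F G α : Type*} [NormedAddCommGroup E] [NormedSpace ℝ E]
    [NormedAddCommGroup F] [NormedSpace ℝ F] [NormedAddCommGroup G] [NormedSpace ℝ G]
    (B : E →L[ℝ] F →L[ℝ] G) {l : Filter α} {f : α → E} {g : α → F} {a : E} {b : F}
    (hf : Tendsto f l (𝓝 a)) (hg : Tendsto g l (𝓝 b)) :
    Tendsto (fun s => B (f s) (g s)) l (𝓝 (B a b)) := by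
  have h := B.continuous₂.tendsto (a, b)
  exact Tendsto.comp (g := fun p : E × F => B p.1 p.2) (f := fun s => (f s, g s)) h
    (hf.prodMk_nhds hg)

/-- The derivative of the interaction energy along a path whose first component is only weakly
differentiable. -/
lemma hasDerivWithinAt_half_interaction {E R : Type*} [NormedAddCommGroup E] [NormedSpace ℝ E]
    [NormedAddCommGroup R] [NormedSpace ℝ R] (C : R →L[ℝ] R →L[ℝ] ℝ) (n : E →L[ℝ] E →L[ℝ] R)
    (T : R →L[ℝ] E →L[ℝ] E) (B : E →L[ℝ] E →L[ℝ] ℝ) (hC : ∀ u v, C u v = C v u)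
    (hT : ∀ r ψ φ, B (T r ψ) φ = C r (n φ ψ)) (e : ℝ) {ψ : ℝ → E} {ι ρ : ℝ → R} {ι' : R}
    {S : Set ℝ} {t : ℝ} (hρ : ∀ s, ρ s = ι s + (-e) • n (ψ s) (ψ s))
    (hn : ∀ s ψ φ, C (ρ s + ρ t) (n ψ φ) = C (ρ s + ρ t) (n φ ψ))
    (hι : HasDerivWithinAt ι ι' S t) (hψ : Tendsto ψ (𝓝[S \ {t}] t) (𝓝 (ψ t)))
    (D : E →L[ℝ] ℝ)
    (hD : ∀ {η : ℝ → E} {η₀ : E}, Tendsto η (𝓝[S \ {t}] t) (𝓝 η₀) →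
      Tendsto (fun s => (s - t)⁻¹ * B (η s) (ψ s - ψ t)) (𝓝[S \ {t}] t) (𝓝 (D η₀))) :
    HasDerivWithinAt (fun s => (1 / 2) * C (ρ s) (ρ s))
      (C (ρ t) ι' - 2 * e * D (T (ρ t) (ψ t))) S t := by
  rw [hasDerivWithinAt_iff_tendsto_slope]
  have hιt : Tendsto ι (𝓝[S \ {t}] t) (𝓝 (ι t)) :=
    hι.continuousWithinAt.tendsto.mono_left (nhdsWithin_mono t Set.sdiff_subset)
  have hρt : Tendsto ρ (𝓝[S \ {t}] t) (𝓝 (ρ t)) := by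
    have h := hιt.add ((tendsto_bilinear n hψ hψ).const_smul (-e))
    rw [← hρ t] at h
    exact (tendsto_congr fun s => (hρ s).symm).1 h
  have hr : Tendsto (fun s => ρ s + ρ t) (𝓝[S \ {t}] t) (𝓝 (ρ t + ρ t)) :=
    hρt.add tendsto_const_nhds
  -- These test vectors lie in `E` and converge there because `T` is a bounded bilinear map into
  -- `E`. That is precisely what `hD` requires.
  have hη : Tendsto (fun s => T (ρ s + ρ t) (ψ s + ψ t)) (𝓝[S \ {t}] t)
      (𝓝 (T (ρ t + ρ t) (ψ t + ψ t))) :=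
    tendsto_bilinear T hr (hψ.add tendsto_const_nhds)
  have h2 : Tendsto (fun s => C (ρ s + ρ t) (slope ι t s)) (𝓝[S \ {t}] t)
      (𝓝 (C (ρ t + ρ t) ι')) :=
    tendsto_bilinear C hr (hasDerivWithinAt_iff_tendsto_slope.1 hι)
  have h3 := (h2.const_mul (1 / 2)).sub ((hD hη).const_mul (e / 2))
  -- In the limit every sum doubles its argument: 1/2 · 2 = 1 and e/2 · 2 · 2 = 2e.
  have e1 : 1 / 2 * C (ρ t + ρ t) ι' - e / 2 * D (T (ρ t + ρ t) (ψ t + ψ t)) =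
      C (ρ t) ι' - 2 * e * D (T (ρ t) (ψ t)) := by
    simp only [map_add, add_apply]
    ring
  rw [e1] at h3
  -- For each `s` this is an exact identity. Polarising `C` and then `n` leaves the increment of ψ
  -- alone in the second slot of `B`.
  suffices e3 : ∀ s, 1 / 2 * C (ρ s + ρ t) (slope ι t s) -
      e / 2 * ((s - t)⁻¹ * B (T (ρ s + ρ t) (ψ s + ψ t)) (ψ s - ψ t)) =
      slope (fun s => 1 / 2 * C (ρ s) (ρ s)) t s from (tendsto_congr e3).1 h3
  intro s
  have e2 : ρ s - ρ t = (ι s - ι t) + (-e) • (n (ψ s) (ψ s) - n (ψ t) (ψ t)) := by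
    rw [hρ, hρ, smul_sub]
    abel
  have e4 := half_form_self_sub C hC (ρ s) (ρ t)
  have e5 := form_density_sub (C (ρ s + ρ t)) n (hn s) (ψ s) (ψ t)
  rw [e2, (C (ρ s + ρ t)).map_add, (C (ρ s + ρ t)).map_smul, e5, smul_eq_mul] at e4
  rw [slope_def_module, slope_def_module, e4, hT, (C (ρ s + ρ t)).map_smul, smul_eq_mul,
    smul_eq_mul]
  ring

end Abstract

/-! ### Conservation of energy and charge -/

section Conservation

variable {N : ℕ} [NeZero N] {e M : ℝ} {w : Seq}

lemma freeEvol_field_fst (t : ℝ) (x : Tangent N) :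
    freeEvol t (field e M w t x).1 = interaction e w (evolve t x) :=
  freeEvol_freeEvol_neg t _

lemma hasDerivWithinAt_psi {x : ℝ → Tangent N} {x' : Tangent N} {S : Set ℝ} {t : ℝ}
    (hx : HasDerivWithinAt x x' S t) : HasDerivWithinAt (fun s => (x s).1) x'.1 S t :=
  (psiL N).hasFDerivAt.comp_hasDerivWithinAt t hx

lemma hasDerivWithinAt_pos {x : ℝ → Tangent N} {x' : Tangent N} {S : Set ℝ} {t : ℝ}
    (hx : HasDerivWithinAt x x' S t) : HasDerivWithinAt (fun s => (x s).2.1) x'.2.1 S t :=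
  (posL N).hasFDerivAt.comp_hasDerivWithinAt t hx

lemma hasDerivWithinAt_mom {x : ℝ → Tangent N} {x' : Tangent N} {S : Set ℝ} {t : ℝ}
    (hx : HasDerivWithinAt x x' S t) : HasDerivWithinAt (fun s => (x s).2.2) x'.2.2 S t :=
  (momL N).hasFDerivAt.comp_hasDerivWithinAt t hx

lemma l2Form_potential (r : Seq) (ψ φ : Fermion N) :
    l2Form N (potential N r ψ) φ = coulomb N r (pairDensity N φ ψ) :=
  (l2Form_symm _ _).trans (re_inner_potential r ψ φ)

lemma hasDerivWithinAt_coulomb (hw : IsRealSeq w) {x : ℝ → Tangent N} {x' : Tangent N} {S : Set ℝ}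
    {t : ℝ} (hx : HasDerivWithinAt x x' S t) :
    HasDerivWithinAt (fun s => (1 / 2) * coulomb N (rho e w (evolve s (x s)))
        (rho e w (evolve s (x s))))
      (coulomb N (rho e w (evolve t (x t))) (ionSeqDeriv w (toTorusL (x t).2.1) x'.2.1) -
        2 * e * (l2Form N (potential N (rho e w (evolve t (x t))) (evolve t (x t)).1)
            (freeEvol t x'.1) +
          gradForm N (potential N (rho e w (evolve t (x t))) (evolve t (x t)).1)
            (mulIe N (-1 / 2) (evolve t (x t)).1))) S t :=
by
  have hρ : ∀ s, rho e w (evolve s (x s)) = ionSeq w (toTorusL (x s).2.1) +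
      (-e) • pairDensity N (freeEvol s (x s).1) (freeEvol s (x s).1) := fun _ => rfl
  have hn : ∀ s (ψ φ : Fermion N),
      coulomb N (rho e w (evolve s (x s)) + rho e w (evolve t (x t))) (pairDensity N ψ φ) =
      coulomb N (rho e w (evolve s (x s)) + rho e w (evolve t (x t))) (pairDensity N φ ψ) :=
    fun s ψ φ => by
      have hr : IsRealSeq (rho e w (evolve s (x s)) + rho e w (evolve t (x t))) :=
        (isRealSeq_rhoSeq e hw (evolve s (x s)).1 _).add (isRealSeq_rhoSeq e hw (evolve t (x t)).1 _)
      exact coulomb_pairDensity_symm hr φ ψ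
  have hι : HasDerivWithinAt (fun s => ionSeq w (toTorusL (x s).2.1))
      (ionSeqDeriv w (toTorusL (x t).2.1) x'.2.1) S t :=
    HasFDerivAt.comp_hasDerivWithinAt (l := fun q : Lattice N → Space => ionSeq w (toTorusL q))
      (f := fun s => (x s).2.1) t (hasFDerivAt_ionSeq w (x t).2.1) (hasDerivWithinAt_pos hx)
  have hψ : Tendsto (fun s => freeEvol s (x s).1) (𝓝[S \ {t}] t) (𝓝 (freeEvol t (x t).1)) :=
    tendsto_comp_of_hasDerivWithinAt (E := Fermion N) (F := Fermion N)
      (f := fun s ψ => freeEvol s ψ) (continuous_freeEvol_comp continuous_fst continuous_snd)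
      (hasDerivWithinAt_psi hx)
  exact hasDerivWithinAt_half_interaction (E := Fermion N) (R := Seq) (coulomb N) (pairDensity N)
    (potential N) (l2Form N)
    coulomb_symm l2Form_potential e (ψ := fun s => freeEvol s (x s).1)
    (ρ := fun s => rho e w (evolve s (x s)))
    (ι := fun s => ionSeq w (toTorusL (x s).2.1)) hρ hn hι hψ
    ((l2Form N).flip (freeEvol t x'.1) + (gradForm N).flip (mulIe N (-1 / 2) (evolve t (x t)).1))
    (fun hη => tendsto_l2Form_slope (hasDerivWithinAt_psi hx) hη)

/-- The power of the force is minus the rate at which the motion of the ions changes the Coulomb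
energy. -/
lemma ionKineticDeriv_force (e : ℝ) (w : Seq) (x : Tangent N) :
    ionKineticDeriv M x.2.2 (force e w x) =
      -coulomb N (rho e w x) (ionSeqDeriv w (toTorusL x.2.1) (M⁻¹ • x.2.2)) := by
  have h5 := sum_inner_formVec ((coulomb N (rho e w x)).comp (ionSeqDeriv w (toTorusL x.2.1)))
    (M⁻¹ • x.2.2)
  refine Eq.trans ?_ (congrArg Neg.neg h5)
  rw [ionKineticDeriv_apply, ← Finset.sum_neg_distrib]
  refine Finset.sum_congr rfl fun n _ => ?_
  have h6 : force e w x n = -formVec N ((coulomb N (rho e w x)).comp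
    (ionSeqDeriv w (toTorusL x.2.1))) n := rfl
  rw [h6, inner_neg_right, Pi.smul_apply, inner_smul_right, real_inner_comm, mul_neg]

lemma gradForm_field (e M : ℝ) (w : Seq) (t : ℝ) (x : Tangent N) :
    gradForm N x.1 (field e M w t x).1 =
      gradForm N (evolve t x).1 (interaction e w (evolve t x)) := by
  have h := congrArg (gradForm N (freeEvol t x.1)) (freeEvol_field_fst (e := e) (M := M) (w := w) t x)
  exact (gradForm_freeEvol t x.1 (field e M w t x).1).symm.trans h

lemma l2Form_field (e M : ℝ) (w : Seq) (t : ℝ) (x : Tangent N) (ψ : Fermion N) :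
    l2Form N ψ (freeEvol t (field e M w t x).1) = l2Form N ψ (interaction e w (evolve t x)) :=
  congrArg (l2Form N ψ) (freeEvol_field_fst (e := e) (M := M) (w := w) t x)

lemma energyL_evolve (e M : ℝ) (w : Seq) (t : ℝ) (x : Tangent N) :
    energyL e M w (evolve t x) = (1 / 2) * gradForm N x.1 x.1 +
      (1 / 2) * coulomb N (rho e w (evolve t x)) (rho e w (evolve t x)) + ionKinetic M x.2.2 := by
  have h := gradForm_freeEvol t x.1 x.1
  exact congrArg (fun a => (1 / 2) * a + (1 / 2) * coulomb N (rho e w (evolve t x))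
    (rho e w (evolve t x)) + ionKinetic M x.2.2) h

/-- All terms cancel. The rate Re(∇ψ, ∇(ieΦψ)) of the kinetic energy is compensated by the free part
of ψ' in the interaction energy; the other part vanishes since Re⟨Φψ, ieΦψ⟩ = 0; the ion terms
cancel by `ionKineticDeriv_force`. -/
lemma hasDerivWithinAt_energyL (hw : IsRealSeq w) {x : ℝ → Tangent N} {S : Set ℝ} {t : ℝ}
    (hx : HasDerivWithinAt x (field e M w t (x t)) S t) :
    HasDerivWithinAt (fun s => energyL e M w (evolve s (x s))) 0 S t := by
  have h1 := hasDerivWithinAt_half_bilinear_self (E := Fermion N) (gradForm N) gradForm_symm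
    (hasDerivWithinAt_psi hx)
  have h2 := hasDerivWithinAt_coulomb (e := e) hw hx
  have h3 := HasFDerivAt.comp_hasDerivWithinAt (l := ionKinetic M) (f := fun s => (x s).2.2) t
    (hasFDerivAt_ionKinetic M (x t).2.2) (hasDerivWithinAt_mom hx)
  have h4 := (h1.add h2).add h3
  have e1 := gradForm_field e M w t (x t)
  have e2 := (l2Form_field e M w t (x t)
    (potential N (rho e w (evolve t (x t))) (evolve t (x t)).1)).trans
    (l2Form_mulIe_self e (potential N (rho e w (evolve t (x t))) (evolve t (x t)).1))
  have e3 := gradForm_mulIe e (-1 / 2) (evolve t (x t)).1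
    (potential N (rho e w (evolve t (x t))) (evolve t (x t)).1)
  have e4 := ionKineticDeriv_force (M := M) e w (evolve t (x t))
  have e5 : ∀ {a b c d f g h : ℝ}, a = b → c = 0 → -1 / 2 * b = -(e * d) → g = -h →
      a + (h - 2 * e * (c + d)) + g = 0 := by
    intro a b c d f g h h1 h2 h3 h4
    rw [h1, h2, h4]
    linarith
  have e6 := h4.congr_deriv (e5 (f := 0) e1 e2 e3 e4)
  exact e6.congr_of_eventuallyEq (Eventually.of_forall fun s => energyL_evolve e M w s (x s))
    (energyL_evolve e M w t (x t))

/-- The free flow preserves the L² norm, and ieΦ is skew because Φ is symmetric. -/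
lemma hasDerivWithinAt_charge (hw : IsRealSeq w) {x : ℝ → Tangent N} {S : Set ℝ} {t : ℝ}
    (hx : HasDerivWithinAt x (field e M w t (x t)) S t) :
    HasDerivWithinAt (fun s => (1 / 2) * ‖waveFn (evolve s (x s)).1‖ ^ 2) 0 S t := by
  have h1 := hasDerivWithinAt_half_bilinear_self (E := Fermion N) (l2Form N) l2Form_symm
    (hasDerivWithinAt_psi hx)
  have hr : IsRealSeq (rho e w (evolve t (x t))) := isRealSeq_rhoSeq e hw (evolve t (x t)).1 _
  have e1 : l2Form N (x t).1 (field e M w t (x t)).1 = 0 :=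
    ((l2Form_freeEvol t _ _).symm.trans (l2Form_field e M w t (x t) (evolve t (x t)).1)).trans
      (l2Form_mulIe_potential hr e (evolve t (x t)).1)
  have e2 : ∀ s, (1 / 2) * ‖waveFn (evolve s (x s)).1‖ ^ 2 = (1 / 2) * l2Form N (x s).1 (x s).1 :=
    fun s => congrArg ((1 / 2) * ·)
      ((l2Form_self (evolve s (x s)).1).symm.trans (l2Form_freeEvol s (x s).1 (x s).1))
  exact (h1.congr_deriv e1).congr_of_eventuallyEq (Eventually.of_forall e2) (e2 t)

end Conservation

/-! ### A priori bounds and global existence -/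

section Bounds

lemma eq_of_hasDerivWithinAt_zero {f : ℝ → ℝ} {a b : ℝ}
    (h : ∀ t ∈ Set.Icc a b, HasDerivWithinAt f 0 (Set.Icc a b) t) {s t : ℝ}
    (hs : s ∈ Set.Icc a b) (ht : t ∈ Set.Icc a b) : f t = f s := by
  have := (convex_Icc a b).norm_image_sub_le_of_norm_hasDerivWithin_le (C := 0) h
    (fun _ _ => by simp) hs ht
  rw [zero_mul, norm_le_zero_iff, sub_eq_zero] at this
  exact this

variable {N : ℕ} [NeZero N] {e M : ℝ} {w : Seq}

lemma ionKinetic_nonneg (hM : 0 < M) (p : Lattice N → Space) : 0 ≤ ionKinetic M p :=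
  Finset.sum_nonneg fun _ _ => by positivity

lemma norm_le_of_ionKinetic_le (hM : 0 < M) {p : Lattice N → Space} {E : ℝ}
    (h : ionKinetic M p ≤ E) : ‖p‖ ≤ Real.sqrt (2 * M * E) := by
  refine (pi_norm_le_iff_of_nonneg (Real.sqrt_nonneg _)).2 fun n => Real.le_sqrt_of_sq_le ?_
  have h1 : ‖p n‖ ^ 2 / (2 * M) ≤ ionKinetic M p :=
    Finset.single_le_sum (f := fun n => ‖p n‖ ^ 2 / (2 * M)) (fun _ _ => by positivity)
      (Finset.mem_univ n)
  have h2 := h1.trans h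
  rw [div_le_iff₀ (by positivity)] at h2
  linarith

lemma norm_psi_le_of_energyL_le (hM : 0 < M) {x : Tangent N} {E : ℝ} (h : energyL e M w x ≤ E) :
    ‖x.1‖ ≤ Real.sqrt (‖waveFn x.1‖ ^ 2 + 2 * E) := by
  refine Real.le_sqrt_of_sq_le ?_
  have h1 := coulomb_self_nonneg (N := N) (rho e w x)
  have h2 := ionKinetic_nonneg hM x.2.2
  have h3 := gradForm_self x.1
  have h4 : (1 / 2) * gradForm N x.1 x.1 + (1 / 2) * coulomb N (rho e w x) (rho e w x) +
    ionKinetic M x.2.2 ≤ E := h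
  rw [h3] at h4
  linarith

lemma norm_mom_le_of_energyL_le (hM : 0 < M) {x : Tangent N} {E : ℝ} (h : energyL e M w x ≤ E) :
    ‖x.2.2‖ ≤ Real.sqrt (2 * M * E) := by
  refine norm_le_of_ionKinetic_le hM ?_
  have h1 := coulomb_self_nonneg (N := N) (rho e w x)
  have h3 := gradForm_self x.1
  have h4 : (1 / 2) * gradForm N x.1 x.1 + (1 / 2) * coulomb N (rho e w x) (rho e w x) +
    ionKinetic M x.2.2 ≤ E := h
  have h5 := norm_waveFn_le x.1
  have h6 : ‖waveFn x.1‖ ^ 2 ≤ ‖x.1‖ ^ 2 := pow_le_pow_left₀ (norm_nonneg _) h5 2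
  rw [h3] at h4
  linarith

/-- The conservation laws bound the solutions on bounded time intervals. -/
lemma norm_le_of_hasDerivWithinAt_field (hw : IsRealSeq w) (hM : 0 < M) {x : ℝ → Tangent N}
    {s : ℝ} (hs : 0 ≤ s)
    (hx : ∀ t ∈ Set.Icc (-s) s, HasDerivWithinAt x (field e M w t (x t)) (Set.Icc (-s) s) t)
    {t : ℝ} (ht : t ∈ Set.Icc (-s) s) :
    ‖x t‖ ≤ Real.sqrt (‖waveFn (x 0).1‖ ^ 2 + 2 * energyL e M w (x 0)) +
      (‖(x 0).2.1‖ + M⁻¹ * Real.sqrt (2 * M * energyL e M w (x 0)) * s) +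
      Real.sqrt (2 * M * energyL e M w (x 0)) := by
  have h0 : (0 : ℝ) ∈ Set.Icc (-s) s := ⟨by linarith, hs⟩
  have hE : ∀ t ∈ Set.Icc (-s) s, energyL e M w (evolve t (x t)) = energyL e M w (x 0) := by
    intro t ht
    have h := eq_of_hasDerivWithinAt_zero (fun t ht => hasDerivWithinAt_energyL hw (hx t ht)) h0 ht
    exact h.trans (congrArg (energyL e M w) (evolve_zero (x 0)))
  have hQ : ∀ t ∈ Set.Icc (-s) s, ‖waveFn (evolve t (x t)).1‖ ^ 2 = ‖waveFn (x 0).1‖ ^ 2 := by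
    intro t ht
    have h := eq_of_hasDerivWithinAt_zero (fun t ht => hasDerivWithinAt_charge hw (hx t ht)) h0 ht
    have h' := congrArg (fun y : Tangent N => (1 / 2) * ‖waveFn y.1‖ ^ 2) (evolve_zero (x 0))
    have h2 := h.trans h'
    linarith
  have hp : ∀ t ∈ Set.Icc (-s) s, ‖(x t).2.2‖ ≤ Real.sqrt (2 * M * energyL e M w (x 0)) :=
    fun t ht => norm_mom_le_of_energyL_le hM (x := evolve t (x t)) (hE t ht).le
  have hψ : ‖(x t).1‖ ≤ Real.sqrt (‖waveFn (x 0).1‖ ^ 2 + 2 * energyL e M w (x 0)) := by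
    have h := norm_psi_le_of_energyL_le hM (x := evolve t (x t)) (hE t ht).le
    rw [hQ t ht] at h
    exact (norm_freeEvol t (x t).1).symm.trans_le h
  -- The conservation laws do not control the lifted positions themselves, but the bounded momentum
  -- makes them grow at most linearly.
  have hq : ‖(x t).2.1‖ ≤ ‖(x 0).2.1‖ + M⁻¹ * Real.sqrt (2 * M * energyL e M w (x 0)) * s := by
    have h := (convex_Icc (-s) s).norm_image_sub_le_of_norm_hasDerivWithin_le
      (f := fun t => (x t).2.1) (C := M⁻¹ * Real.sqrt (2 * M * energyL e M w (x 0)))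
      (fun t ht => hasDerivWithinAt_pos (hx t ht)) (fun t ht => ?_) h0 ht
    · have h2 : ‖t - 0‖ ≤ s := by
        rw [sub_zero]
        exact abs_le.2 ht
      have h3 : ‖(x t).2.1‖ ≤ ‖(x 0).2.1‖ + ‖(x t).2.1 - (x 0).2.1‖ := norm_le_insert' _ _
      have h4 : 0 ≤ M⁻¹ * Real.sqrt (2 * M * energyL e M w (x 0)) := by positivity
      exact h3.trans (add_le_add le_rfl (h.trans (mul_le_mul_of_nonneg_left h2 h4)))
    · have h2 : (field e M w t (x t)).2.1 = M⁻¹ • (x t).2.2 := rfl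
      rw [h2, norm_smul, Real.norm_of_nonneg (inv_nonneg.2 hM.le)]
      exact mul_le_mul_of_nonneg_left (hp t ht) (inv_nonneg.2 hM.le)
  have h5 : ‖x t‖ ≤ ‖(x t).1‖ + ‖(x t).2.1‖ + ‖(x t).2.2‖ := by
    refine max_le ?_ (max_le ?_ ?_)
    · linarith [norm_nonneg (x t).2.1, norm_nonneg (x t).2.2]
    · linarith [norm_nonneg (x t).1, norm_nonneg (x t).2.2]
    · linarith [norm_nonneg (x t).2.1, norm_nonneg (x t).1]
  exact h5.trans (add_le_add (add_le_add hψ hq) (hp t ht))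

lemma exists_solution_field (hw : IsRealSeq w) (hM : 0 < M) (x₀ : Tangent N) :
    ∃ x : ℝ → Tangent N, x 0 = x₀ ∧ ∀ t, HasDerivAt x (field e M w t (x t)) t := by
  refine exists_global_solution (lipOnBalls_field e M w) (fun x => ?_) x₀ fun T hT =>
    ⟨Real.sqrt (‖waveFn x₀.1‖ ^ 2 + 2 * energyL e M w x₀) +
      (‖x₀.2.1‖ + M⁻¹ * Real.sqrt (2 * M * energyL e M w x₀) * T) +
      Real.sqrt (2 * M * energyL e M w x₀), fun s hs x hx0 hx t ht => ?_⟩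
  · exact Continuous.comp (g := fun p : ℝ × Tangent N => field e M w p.1 p.2)
      (f := fun t : ℝ => (t, x)) (continuous_field e M w) (by fun_prop)
  · have h := norm_le_of_hasDerivWithinAt_field hw hM hs.1 hx ht
    rw [hx0] at h
    have h4 : 0 ≤ M⁻¹ * Real.sqrt (2 * M * energyL e M w x₀) := by positivity
    have h5 := mul_le_mul_of_nonneg_left hs.2 h4
    linarith

end Bounds

/-! ### Solutions of the ODE solve the Hamiltonian system -/

section Solution

lemma hasDerivAt_clm_of_tendsto_slope {E : Type*} [NormedAddCommGroup E] [NormedSpace ℝ E]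
    (l : E →L[ℝ] ℝ) {f : ℝ → E} {t a : ℝ}
    (h : Tendsto (fun s => (s - t)⁻¹ * l (f s - f t)) (𝓝[Set.univ \ {t}] t) (𝓝 a)) :
    HasDerivAt (fun s => l (f s)) a t := by
  rw [← hasDerivWithinAt_univ, hasDerivWithinAt_iff_tendsto_slope]
  refine (tendsto_congr fun s => ?_).1 h
  rw [slope_def_module, smul_eq_mul, map_sub]

lemma clm_add_smul_add {E : Type*} [NormedAddCommGroup E] [NormedSpace ℝ E]
    (l : E →L[ℝ] ℝ) (c : ℝ) (u v w : E) : l (u + c • (v + w)) = l u + c * (l v + l w) := by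
  simp [mul_add]

variable {N : ℕ} [NeZero N]

lemma pairing_eq (ψ : Fermion N) (u v : Lattice N → Space) (Y : Tangent N) :
    pairing (waveFn ψ) u v Y = l2Form N Y.1 ψ + ∑ n, inner ℝ (u n) (Y.2.1 n) +
      ∑ n, inner ℝ (v n) (Y.2.2 n) := by
  have h : inner ℂ (waveFn Y.1) (waveFn ψ) =
      ∫ x, waveFn ψ x * (starRingEnd ℂ) (waveFn Y.1 x) := by
    rw [L2.inner_def]
    simp only [RCLike.inner_apply]
  have h2 : (∫ x, waveFn ψ x * (starRingEnd ℂ) (waveFn Y.1 x)).re = l2Form N Y.1 ψ :=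
    congrArg Complex.re h.symm
  unfold pairing
  rw [h2]

lemma hasDerivAt_l2Form_freeEvol_comp (η : Fermion N) {v : ℝ → Fermion N} {v' : Fermion N} {t : ℝ}
    (hv : HasDerivAt v v' t) :
    HasDerivAt (fun s => l2Form N η (freeEvol s (v s)))
      (l2Form N η (freeEvol t v') + gradForm N η (mulIe N (-1 / 2) (freeEvol t (v t)))) t := by
  have h := tendsto_l2Form_slope (S := Set.univ) (t := t) (η := fun _ => η) (η₀ := η)
    hv.hasDerivWithinAt tendsto_const_nhds
  exact hasDerivAt_clm_of_tendsto_slope (E := Fermion N) (l2Form N η)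
    (f := fun s => freeEvol s (v s)) h

lemma l2Form_mulIe_swap (a b : ℝ) (ψ φ : Fermion N) :
    b * l2Form N ψ (mulIe N a φ) = -(a * l2Form N φ (mulIe N b ψ)) := by
  refine ((hasSum_l2Form ψ (mulIe N a φ)).mul_left b).unique
    (((hasSum_l2Form φ (mulIe N b ψ)).mul_left a).neg.congr_fun fun K => ?_)
  rw [fc_mulIe, fc_mulIe]
  simp
  ring

lemma sympl_eq (Y : Tangent N) : sympl Y = (mulIe N (-1 / 2) Y.1, Y.2.2, -Y.2.1) := by
  have h : -(Complex.I / 2) • Y.1 = mulIe N (-1 / 2) Y.1 := by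
    rw [mulIe_apply]
    congr 1
    push_cast
    ring
  exact Prod.ext h rfl

lemma coulomb_rhoDeriv (e : ℝ) {w : Seq} (hw : IsRealSeq w) (y : Tangent N) (φ : Fermion N)
    (u v : Lattice N → Space) :
    coulomb N (rho e w y) (rhoDeriv e w y (φ, u, v)) =
      coulomb N (rho e w y) (ionSeqDeriv w (toTorusL y.2.1) u) -
        2 * (e * l2Form N (potential N (rho e w y) y.1) φ) := by
  have hr : IsRealSeq (rho e w y) := isRealSeq_rhoSeq e hw y.1 _
  have h1 := l2Form_potential (rho e w y) y.1 φ
  have h2 := coulomb_pairDensity_symm hr y.1 φ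
  have h3 := clm_add_smul_add (coulomb N (rho e w y)) (-e)
    (ionSeqDeriv w (toTorusL y.2.1) u) (pairDensity N y.1 φ) (pairDensity N φ y.1)
  have h4 : ∀ a b c l e : ℝ, l = b → b = c → a + (-e) * (c + b) = a - 2 * (e * l) := by
    intro a b c l e h h'
    rw [← h', ← h]
    ring
  exact h3.trans (h4 _ _ _ _ _ h1 h2)

lemma ionKineticDeriv_neg (M : ℝ) (p u : Lattice N → Space) :
    ionKineticDeriv M p (-u) = -∑ n, inner ℝ ((M⁻¹ • p) n) (u n) := by
  rw [ionKineticDeriv_apply, ← Finset.sum_neg_distrib]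
  refine Finset.sum_congr rfl fun n _ => ?_
  rw [Pi.smul_apply, Pi.neg_apply, real_inner_smul_left, inner_neg_right, mul_neg]

lemma sum_inner_force (e : ℝ) (w : Seq) (y : Tangent N) (u : Lattice N → Space) :
    ∑ n, inner ℝ (force e w y n) (u n) =
      -coulomb N (rho e w y) (ionSeqDeriv w (toTorusL y.2.1) u) := by
  have h := sum_inner_formVec ((coulomb N (rho e w y)).comp (ionSeqDeriv w (toTorusL y.2.1))) u
  refine Eq.trans ?_ (congrArg Neg.neg h)
  rw [← Finset.sum_neg_distrib]
  exact Finset.sum_congr rfl fun n _ => inner_neg_left _ _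

/-- The right-hand side `⟨J E'(y), Y⟩` of the equations of motion. -/
lemma neg_energyDeriv_sympl (e M : ℝ) {w : Seq} (hw : IsRealSeq w) (y Y : Tangent N) :
    -energyDeriv e M w y (sympl Y) = l2Form N Y.1 (interaction e w y) +
      gradForm N Y.1 (mulIe N (-1 / 2) y.1) + ∑ n, inner ℝ ((M⁻¹ • y.2.2) n) (Y.2.1 n) +
      ∑ n, inner ℝ (force e w y n) (Y.2.2 n) := by
  have e1 := gradForm_mulIe (-1 / 2) (-1 / 2) y.1 Y.1
  have e2 := coulomb_rhoDeriv e hw y (mulIe N (-1 / 2) Y.1) Y.2.2 (-Y.2.1)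
  have e3 := l2Form_mulIe_swap (-1 / 2) e (potential N (rho e w y) y.1) Y.1
  have e4 := ionKineticDeriv_neg M y.2.2 Y.2.1
  have e5 := sum_inner_force e w y Y.2.2
  have e6 := energyDeriv_apply e M w y (mulIe N (-1 / 2) Y.1, Y.2.2, -Y.2.1)
  have e7 := congrArg (fun Z => -energyDeriv e M w y Z) (sympl_eq Y)
  have e8 : ∀ {g g' c l k f ci li m : ℝ}, -1 / 2 * g = -(-1 / 2 * g') → c = ci - 2 * (e * l) →
      e * l = -(-1 / 2 * li) → m = -k → f = -ci → -(g + c + m) = li + g' + k + f := by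
    intros
    linarith
  exact e7.trans ((congrArg Neg.neg e6).trans (e8 e1 e2 e3 e4 e5))

omit [NeZero N] in
lemma continuous_toTorusL : Continuous (toTorusL (N := N)) :=
  continuous_pi fun n => continuous_pi fun a =>
    (AddCircle.continuous_mk' (N : ℝ)).comp
      ((EuclideanSpace.proj (𝕜 := ℝ) a).continuous.comp (continuous_apply n))

lemma continuous_project : Continuous (project (N := N)) := by
  have h : Continuous fun x : Tangent N => toTorusL x.2.1 :=
    Continuous.comp (g := fun q : Lattice N → Space => toTorusL q) continuous_toTorusL
      (posL N).continuous
  exact (psiL N).continuous.prodMk (h.prodMk (momL N).continuous)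

/-- The lifted positions serve as one global lift. Returning from the interaction picture leaves ψ
only weakly differentiable, which is all that the notion of solution demands. -/
lemma isSolution_of_hasDerivAt (e M : ℝ) {σ : Torus N → ℝ}
    (hσ : ContDiff ℝ 2 fun y => σ (toTorus N y)) {x : ℝ → Tangent N}
    (hx : ∀ t, HasDerivAt x (field e M (sigmaSeq hσ) t (x t)) t) :
    IsSolution e M σ fun t => project (evolve t (x t)) := by
  have hxc : Continuous x := continuous_iff_continuousAt.2 fun t => (hx t).continuousAt
  refine ⟨?_, fun t => ⟨energyDeriv e M (sigmaSeq hσ) (evolve t (x t)),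
    hasFDerivAt_energy_displace e M hσ (evolve t (x t)), fun s => (x s).2.1,
    Eventually.of_forall fun s n => rfl, fun Y => ?_⟩⟩
  · exact continuous_project.comp (Continuous.comp (g := fun p : ℝ × Tangent N => evolve p.1 p.2)
      (f := fun t => (t, x t)) continuous_evolve (continuous_id.prodMk hxc))
  · have hxt := (hx t).hasDerivWithinAt (s := Set.univ)
    have h1 := hasDerivAt_l2Form_freeEvol_comp Y.1
      (hasDerivWithinAt_univ.1 (hasDerivWithinAt_psi hxt))
    have h2 := hasDerivWithinAt_univ.1 (hasDerivWithinAt_pos hxt)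
    have h3 := hasDerivWithinAt_univ.1 (hasDerivWithinAt_mom hxt)
    have key : ∀ {q : ℝ → Lattice N → Space} {q' : Lattice N → Space} (u : Lattice N → Space),
        HasDerivAt q q' t →
        HasDerivAt (fun s => ∑ n, inner ℝ (q s n) (u n)) (∑ n, inner ℝ (q' n) (u n)) t := by
      intro q q' u hq
      refine HasDerivAt.fun_sum fun n _ => ?_
      have h := (hasDerivAt_pi.1 hq n).inner ℝ (hasDerivAt_const t (u n))
      simpa using h
    have h4 := (h1.add (key Y.2.1 h2)).add (key Y.2.2 h3)
    refine (h4.congr_deriv ?_).congr_of_eventuallyEq (Eventually.of_forall fun s =>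
      pairing_eq (freeEvol s (x s).1) (x s).2.1 (x s).2.2 Y)
    have h5 := l2Form_field e M (sigmaSeq hσ) t (x t) Y.1
    have h6 := neg_energyDeriv_sympl e M (isRealSeq_sigmaSeq hσ) (evolve t (x t)) Y
    refine Eq.trans ?_ h6.symm
    exact congrArg (fun a => a + gradForm N Y.1 (mulIe N (-1 / 2) (freeEvol t (x t).1)) +
      (∑ n, inner ℝ ((M⁻¹ • (x t).2.2) n) (Y.2.1 n)) +
      ∑ n, inner ℝ (force e (sigmaSeq hσ) (evolve t (x t)) n) (Y.2.2 n)) h5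

end Solution

/-! ### Chain rules and uniqueness for weakly differentiable paths -/

section WeakDerivatives

variable {E : Type*} [NormedAddCommGroup E] [NormedSpace ℝ E]

/-- Pointwise convergent functionals are uniformly bounded by Banach–Steinhaus, so a convergent
argument may be inserted. -/
lemma tendsto_clm_apply_of_forall [CompleteSpace E] {L : ℕ → E →L[ℝ] ℝ} {D : E → ℝ}
    (hL : ∀ η, Tendsto (fun n => L n η) atTop (𝓝 (D η))) {g : ℕ → E} {η : E}
    (hg : Tendsto g atTop (𝓝 η)) : Tendsto (fun n => L n (g n)) atTop (𝓝 (D η)) := by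
  obtain ⟨C, hC⟩ := banach_steinhaus (g := L) fun η => by
    obtain ⟨C, hC⟩ := (hL η).norm.bddAbove_range
    exact ⟨C, fun n => hC ⟨n, rfl⟩⟩
  have h1 : Tendsto (fun n => L n (g n - η)) atTop (𝓝 0) := by
    have h2 := (tendsto_iff_norm_sub_tendsto_zero.1 hg).const_mul C
    rw [mul_zero] at h2
    exact squeeze_zero_norm (fun n => (L n).le_of_opNorm_le (hC n) _) h2
  have h3 := (hL η).add h1
  rw [add_zero] at h3
  refine h3.congr fun n => ?_
  rw [map_sub]
  ring

/-- The chain rule for a quadratic form along a continuous path that is only weakly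
differentiable. -/
lemma hasDerivAt_half_form_of_weak [CompleteSpace E] (B : E →L[ℝ] E →L[ℝ] ℝ)
    (hB : ∀ u v, B u v = B v u) {f : ℝ → E} {t : ℝ} (hf : ContinuousAt f t) {D : E → ℝ}
    (hD : ∀ η, HasDerivAt (fun s => B η (f s)) (D η) t) :
    HasDerivAt (fun s => (1 / 2) * B (f s) (f s)) (D (f t)) t := by
  -- Sequences are used because Banach–Steinhaus needs a pointwise bounded family, and a convergent
  -- sequence is bounded from its first term on.
  rw [hasDerivAt_iff_tendsto_slope, tendsto_iff_seq_tendsto]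
  intro u hu
  have hfu : Tendsto (fun n => f (u n)) atTop (𝓝 (f t)) :=
    hf.tendsto.comp (hu.mono_right nhdsWithin_le_nhds)
  -- Midpoints serve as test vectors: half the increment of B(f, f) is B applied to the midpoint and
  -- the increment of f.
  have hg : Tendsto (fun n => (1 / 2 : ℝ) • (f (u n) + f t)) atTop (𝓝 (f t)) := by
    have h := (hfu.add (tendsto_const_nhds (x := f t))).const_smul (1 / 2 : ℝ)
    rw [← two_smul ℝ (f t), smul_smul, one_div, inv_mul_cancel₀ two_ne_zero, one_smul] at h
    simpa only [one_div] using h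
  have hL : ∀ η, Tendsto (fun n => ((u n - t)⁻¹ • B.flip (f (u n) - f t)) η) atTop
      (𝓝 (D η)) := by
    intro η
    refine ((hasDerivAt_iff_tendsto_slope.1 (hD η)).comp hu).congr fun n => ?_
    rw [Function.comp_apply, slope_def_module, smul_apply, ContinuousLinearMap.flip_apply, map_sub]
  refine (tendsto_clm_apply_of_forall hL hg).congr fun n => ?_
  rw [Function.comp_apply, slope_def_module, half_form_self_sub B hB, smul_apply,
    ContinuousLinearMap.flip_apply, map_smul, smul_apply, smul_eq_mul, smul_eq_mul, smul_eq_mul]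

/-- Uniqueness for a weakly formulated linear equation whose generator is skew. -/
lemma eq_of_weak_solutions [CompleteSpace E] (B G : E →L[ℝ] E →L[ℝ] ℝ) (J : E →L[ℝ] E)
    (hB : ∀ u v, B u v = B v u) (hB0 : ∀ u, B u u = 0 → u = 0) (hGJ : ∀ u, G u (J u) = 0)
    {b : E → ℝ → ℝ} {f g : ℝ → E} (hf : Continuous f) (hg : Continuous g)
    (hf' : ∀ η t, HasDerivAt (fun s => B η (f s)) (b η t + G η (J (f t))) t)
    (hg' : ∀ η t, HasDerivAt (fun s => B η (g s)) (b η t + G η (J (g t))) t)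
    (h0 : f 0 = g 0) : f = g := by
  -- The inhomogeneous terms cancel in the difference d of the solutions, and what remains is G(d,
  -- Jd) = 0.
  have h1 : ∀ t, HasDerivAt (fun s => (1 / 2) * B (f s - g s) (f s - g s)) 0 t := by
    intro t
    have h2 := hasDerivAt_half_form_of_weak B hB (f := fun s => f s - g s) (t := t)
      (hf.sub hg).continuousAt (D := fun η => G η (J (f t - g t))) fun η => by
        refine (((hf' η t).sub (hg' η t)).congr_deriv ?_).congr_of_eventuallyEq
          (Eventually.of_forall fun s => map_sub _ _ _)
        rw [map_sub, map_sub]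
        ring
    exact h2.congr_deriv (hGJ _)
  funext t
  have h2 := is_const_of_deriv_eq_zero (fun t => (h1 t).differentiableAt) (fun t => (h1 t).deriv) t 0
  have h3 : B (f 0 - g 0) (f 0 - g 0) = 0 := by
    rw [h0, sub_self, map_zero]
  rw [h3] at h2
  exact sub_eq_zero.1 (hB0 _ (by linarith))

/-- A function whose increments are `o(|s - t|)` at every point is constant. -/
lemma eq_of_norm_sub_isLittleO {F : Type*} [SeminormedAddCommGroup F] {d : ℝ → F}
    (h : ∀ t, (fun s => ‖d s - d t‖) =o[𝓝 t] fun s => s - t) (t : ℝ) : ‖d t - d 0‖ = 0 := by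
  have h1 : ∀ t, HasDerivAt (fun s => ‖d s - d 0‖) 0 t := by
    intro t
    rw [hasDerivAt_iff_isLittleO]
    refine Asymptotics.IsBigO.trans_isLittleO (Asymptotics.isBigO_of_le _ fun s => ?_) (h t)
    rw [smul_zero, sub_zero, norm_norm, Real.norm_eq_abs]
    refine (abs_norm_sub_norm_le _ _).trans_eq ?_
    rw [sub_sub_sub_cancel_right]
  have h2 := is_const_of_deriv_eq_zero (fun t => (h1 t).differentiableAt) (fun t => (h1 t).deriv) t 0
  rwa [sub_self, norm_zero] at h2

lemma hasDerivAt_integral_zero [CompleteSpace E] {F : ℝ → E} (hF : Continuous F) (t : ℝ) :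
    HasDerivAt (fun t => ∫ s in (0 : ℝ)..t, F s) (F t) t :=
  intervalIntegral.integral_hasDerivAt_right (hF.intervalIntegrable _ _)
    hF.aestronglyMeasurable.stronglyMeasurableAtFilter hF.continuousAt

lemma hasDerivAt_of_sum_inner {Γ : Type*} [Fintype Γ] {r : ℝ → Γ → Space} {r' : Γ → Space}
    {t : ℝ} (h : ∀ κ : Γ → Space,
      HasDerivAt (fun s => ∑ n, inner ℝ (r s n) (κ n)) (∑ n, inner ℝ (r' n) (κ n)) t) :
    HasDerivAt r r' t := by
  classical
  have key : ∀ (u : Γ → Space) (n : Γ) (a : Fin 3),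
      ∑ m, inner ℝ (u m) ((Pi.single n (EuclideanSpace.single a 1) : Γ → Space) m) = u n a := by
    intro u n a
    rw [Finset.sum_eq_single n]
    · rw [Pi.single_eq_same, EuclideanSpace.inner_single_right]
      simp
    · intro m _ hm
      rw [Pi.single_eq_of_ne hm, inner_zero_right]
    · simp
  rw [hasDerivAt_pi]
  intro n
  have h2 : ∀ a, HasDerivAt (fun s => r s n a) (r' n a) t := by
    intro a
    have := h (Pi.single n (EuclideanSpace.single a 1))
    simpa only [key] using this
  have h3 := (hasDerivAt_pi (φ := fun s a => r s n a) (φ' := fun a => r' n a)).2 h2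
  exact (PiLp.continuousLinearEquiv 2 ℝ (fun _ : Fin 3 => ℝ)).symm.hasFDerivAt.comp_hasDerivAt t h3

end WeakDerivatives

/-! ### The component equations of an arbitrary solution -/

section Lift

variable {N : ℕ} [NeZero N] {e M : ℝ} {σ : Torus N → ℝ}

lemma clm_zero_apply {E : Type*} [NormedAddCommGroup E] [NormedSpace ℝ E]
    (B : E →L[ℝ] E →L[ℝ] ℝ) (u : E) : B 0 u = 0 := by
  rw [map_zero, zero_apply]

/-- A solution comes only with some Fréchet derivative of the energy; uniqueness of derivatives
makes it explicit. -/
lemma eq_energyDeriv (hσ : ContDiff ℝ 2 fun y => σ (toTorus N y)) {X : State N}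
    {dE : Tangent N →L[ℝ] ℝ} (hdE : HasFDerivAt (fun Y => energy e M σ (displace X Y)) dE 0)
    {y : Tangent N} (hy : project y = X) : dE = energyDeriv e M (sigmaSeq hσ) y := by
  subst hy
  exact HasFDerivAt.unique (E := Tangent N) hdE (hasFDerivAt_energy_displace e M hσ y)

/-- The equations of motion, tested with the tangent vectors. -/
lemma IsSolution.hasDerivAt_pairing (hσ : ContDiff ℝ 2 fun y => σ (toTorus N y))
    {X : ℝ → State N} (hX : IsSolution e M σ X) {t : ℝ} {y : Tangent N} (hy : project y = X t) :
    ∃ r : ℝ → Lattice N → Space, (∀ᶠ s in 𝓝 t, ∀ n, (X s).2.1 n = toTorus N (r s n)) ∧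
      ∀ Y : Tangent N, HasDerivAt (fun s => l2Form N Y.1 (X s).1 +
          ∑ n, inner ℝ (r s n) (Y.2.1 n) + ∑ n, inner ℝ ((X s).2.2 n) (Y.2.2 n))
        (l2Form N Y.1 (interaction e (sigmaSeq hσ) y) + gradForm N Y.1 (mulIe N (-1 / 2) y.1) +
          ∑ n, inner ℝ ((M⁻¹ • y.2.2) n) (Y.2.1 n) +
          ∑ n, inner ℝ (force e (sigmaSeq hσ) y n) (Y.2.2 n)) t := by
  refine (hX.2 t).elim fun dE hd => hd.2.elim fun r hr => ⟨r, hr.1, fun Y => ?_⟩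
  have h2 := eq_energyDeriv hσ hd.1 hy
  have h3 := neg_energyDeriv_sympl e M (isRealSeq_sigmaSeq hσ) y Y
  have h4 : -dE (sympl Y) = -energyDeriv e M (sigmaSeq hσ) y (sympl Y) :=
    congrArg (fun l : Tangent N →L[ℝ] ℝ => -l (sympl Y)) h2
  exact ((hr.2 Y).congr_deriv (h4.trans h3)).congr_of_eventuallyEq
    (Eventually.of_forall fun s => (pairing_eq (X s).1 (r s) (X s).2.2 Y).symm)

lemma sum_inner_zero_right (u : Lattice N → Space) :
    ∑ n, inner ℝ (u n) ((0 : Lattice N → Space) n) = 0 := by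
  simp

/-- Testing with tangent vectors having a single nonzero component decouples the weak equation into
its three components. -/
lemma IsSolution.hasDerivAt_l2Form (hσ : ContDiff ℝ 2 fun y => σ (toTorus N y))
    {X : ℝ → State N} (hX : IsSolution e M σ X) {t : ℝ} {y : Tangent N} (hy : project y = X t)
    (η : Fermion N) : HasDerivAt (fun s => l2Form N η (X s).1)
      (l2Form N η (interaction e (sigmaSeq hσ) y) + gradForm N η (mulIe N (-1 / 2) y.1)) t := by
  refine (hX.hasDerivAt_pairing hσ hy).elim fun r hr => ?_
  have h1 := hr.2 (η, 0, 0)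
  have e3 : ∀ {a b c d : ℝ}, c = 0 → d = 0 → a + b + c + d = a + b := by
    intros; linarith
  have e4 : ∀ {a c d : ℝ}, c = 0 → d = 0 → a = a + c + d := by
    intros; linarith
  exact (h1.congr_deriv (e3 (sum_inner_zero_right _) (sum_inner_zero_right _))).congr_of_eventuallyEq
    (Eventually.of_forall fun s => e4 (sum_inner_zero_right _) (sum_inner_zero_right _))

lemma IsSolution.exists_lift_hasDerivAt (hσ : ContDiff ℝ 2 fun y => σ (toTorus N y))
    {X : ℝ → State N} (hX : IsSolution e M σ X) {t : ℝ} {y : Tangent N} (hy : project y = X t) :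
    ∃ r : ℝ → Lattice N → Space, (∀ᶠ s in 𝓝 t, ∀ n, (X s).2.1 n = toTorus N (r s n)) ∧
      HasDerivAt r (M⁻¹ • y.2.2) t := by
  refine (hX.hasDerivAt_pairing hσ hy).elim fun r hr => ⟨r, hr.1, hasDerivAt_of_sum_inner fun κ => ?_⟩
  have h1 := hr.2 (0, κ, 0)
  have e3 : ∀ {a b c d : ℝ}, a = 0 → b = 0 → d = 0 → a + b + c + d = c := by
    intros; linarith
  have e4 : ∀ {a c d : ℝ}, a = 0 → d = 0 → c = a + c + d := by
    intros; linarith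
  exact (h1.congr_deriv (e3 (clm_zero_apply (l2Form N) _) (clm_zero_apply (gradForm N) _)
    (sum_inner_zero_right _))).congr_of_eventuallyEq
    (Eventually.of_forall fun s => e4 (clm_zero_apply (l2Form N) _) (sum_inner_zero_right _))

lemma IsSolution.hasDerivAt_mom (hσ : ContDiff ℝ 2 fun y => σ (toTorus N y))
    {X : ℝ → State N} (hX : IsSolution e M σ X) {t : ℝ} {y : Tangent N} (hy : project y = X t) :
    HasDerivAt (fun s => (X s).2.2) (force e (sigmaSeq hσ) y) t := by
  refine (hX.hasDerivAt_pairing hσ hy).elim fun r hr => hasDerivAt_of_sum_inner fun κ => ?_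
  have h1 := hr.2 (0, 0, κ)
  have e3 : ∀ {a b c d : ℝ}, a = 0 → b = 0 → c = 0 → a + b + c + d = d := by
    intros; linarith
  have e4 : ∀ {a c d : ℝ}, a = 0 → c = 0 → d = a + c + d := by
    intros; linarith
  exact (h1.congr_deriv (e3 (clm_zero_apply (l2Form N) _) (clm_zero_apply (gradForm N) _)
    (sum_inner_zero_right _))).congr_of_eventuallyEq
    (Eventually.of_forall fun s => e4 (clm_zero_apply (l2Form N) _) (sum_inner_zero_right _))

lemma norm_toTorusL_le (u : Lattice N → Space) : ‖toTorusL u‖ ≤ ‖u‖ := by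
  refine (pi_norm_le_iff_of_nonneg (norm_nonneg _)).2 fun n =>
    (pi_norm_le_iff_of_nonneg (norm_nonneg _)).2 fun a => ?_
  have h1 : ‖toTorusL u n a‖ ≤ ‖u n a‖ := QuotientAddGroup.norm_mk_le_norm
  exact h1.trans ((PiLp.norm_apply_le (u n) a).trans (norm_le_pi_norm u n))

omit [NeZero N] in
lemma toTorusL_sub (u v : Lattice N → Space) : toTorusL (u - v) = toTorusL u - toTorusL v := rfl

/-- Paths on the torus whose local lifts have the derivative `Q'` are projections of `Q`. -/
lemma toTorusL_eq_of_local_lifts {q : ℝ → Lattice N → Torus N} {Q Q' : ℝ → Lattice N → Space}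
    (hQ : ∀ t, HasDerivAt Q (Q' t) t) (h0 : toTorusL (Q 0) = q 0)
    (hq : ∀ t, ∃ r : ℝ → Lattice N → Space, (∀ᶠ s in 𝓝 t, ∀ n, q s n = toTorus N (r s n)) ∧
      HasDerivAt r (Q' t) t) (t : ℝ) : toTorusL (Q t) = q t := by
  have h := eq_of_norm_sub_isLittleO (d := fun s => q s - toTorusL (Q s)) (fun t => ?_) t
  · rw [h0, sub_self, sub_zero, norm_eq_zero, sub_eq_zero] at h
    exact h.symm
  · obtain ⟨r, hr, hr'⟩ := hq t
    have h1 := hasDerivAt_iff_isLittleO.1 (hr'.sub (hQ t))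
    refine Asymptotics.IsBigO.trans_isLittleO (Asymptotics.IsBigO.of_bound 1 ?_) h1
    have ht : q t = toTorusL (r t) := funext hr.self_of_nhds
    filter_upwards [hr] with s hs
    have hs' : q s = toTorusL (r s) := funext hs
    rw [sub_self, smul_zero, sub_zero, one_mul, norm_norm, ht, hs', ← toTorusL_sub, ← toTorusL_sub,
      ← toTorusL_sub]
    exact norm_toTorusL_le _

end Lift

/-! ### Reduction of arbitrary solutions to the ODE, and well-posedness -/

section WellPosed

variable {N : ℕ} [NeZero N] {e M : ℝ} {σ : Torus N → ℝ}

lemma eq_zero_of_l2Form_self {ψ : Fermion N} (h : l2Form N ψ ψ = 0) : ψ = 0 := by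
  have h1 : ‖waveFn ψ‖ ^ 2 = 0 := (l2Form_self ψ).symm.trans h
  have h2 : waveFn ψ = waveFn (0 : Fermion N) := norm_eq_zero.1 (pow_eq_zero_iff two_ne_zero |>.1 h1)
  exact ext_fc fun K => congrArg (fun u => coef u K) h2

lemma gradForm_mulIe_self (ψ : Fermion N) : gradForm N ψ (mulIe N (-1 / 2) ψ) = 0 := by
  have h := gradForm_mulIe (-1 / 2) (-1 / 2) ψ ψ
  linarith

lemma continuous_psi {X : ℝ → State N} (hX : Continuous X) : Continuous fun t => (X t).1 :=
  continuous_fst.comp hX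

lemma continuous_mom {X : ℝ → State N} (hX : Continuous X) : Continuous fun t => (X t).2.2 :=
  continuous_snd.comp (continuous_snd.comp hX)

/-- The wave function of a solution in the interaction picture. -/
lemma exists_interaction_picture {ψ F I : ℝ → Fermion N} {ψ₀ : Fermion N} (hψ : Continuous ψ)
    (hF : Continuous F) (hFI : ∀ t, freeEvol t (F t) = I t) (h0 : ψ 0 = ψ₀)
    (h : ∀ η t, HasDerivAt (fun s => l2Form N η (ψ s))
      (l2Form N η (I t) + gradForm N η (mulIe N (-1 / 2) (ψ t))) t) :
    ∃ v : ℝ → Fermion N, v 0 = ψ₀ ∧ (∀ t, HasDerivAt v (F t) t) ∧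
      ∀ t, freeEvol t (v t) = ψ t := by
  have hv : ∀ t, HasDerivAt (fun t => ψ₀ + ∫ s in (0 : ℝ)..t, F s) (F t) t :=
    fun t => (hasDerivAt_integral_zero hF t).const_add ψ₀
  have hv0 : ψ₀ + ∫ s in (0 : ℝ)..0, F s = ψ₀ := by
    rw [intervalIntegral.integral_same]
    exact add_zero _
  refine ⟨fun t => ψ₀ + ∫ s in (0 : ℝ)..t, F s, hv0, hv, ?_⟩
  have hvc : Continuous fun t => ψ₀ + ∫ s in (0 : ℝ)..t, F s :=
    continuous_iff_continuousAt.2 fun t => (hv t).continuousAt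
  -- Both ψ and the freely evolved Duhamel integral solve one linear equation with the source `I`
  -- regarded as given, so the uniqueness needed here is only that of a skew linear problem.
  have h1 := eq_of_weak_solutions (E := Fermion N) (l2Form N) (gradForm N) (mulIe N (-1 / 2))
    l2Form_symm (fun _ => eq_zero_of_l2Form_self) gradForm_mulIe_self
    (b := fun η t => l2Form N η (I t)) (f := ψ)
    (g := fun t => freeEvol t (ψ₀ + ∫ s in (0 : ℝ)..t, F s)) hψ
    (continuous_freeEvol_comp continuous_id hvc) h
    (fun η t => (hasDerivAt_l2Form_freeEvol_comp η (hv t)).congr_deriv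
      (congrArg (fun u => l2Form N η u +
        gradForm N η (mulIe N (-1 / 2) (freeEvol t (ψ₀ + ∫ s in (0 : ℝ)..t, F s)))) (hFI t)))
    (h0.trans ((freeEvol_zero _).trans hv0).symm)
  exact fun t => (congrFun h1 t).symm

/-- The local lifts supplied at different times are unrelated, so a global lift is defined by
integrating the velocity and then compared with q on the torus. -/
lemma IsSolution.exists_lift_pos (hσ : ContDiff ℝ 2 fun y => σ (toTorus N y))
    {X : ℝ → State N} (hX : IsSolution e M σ X) {q₀ : Lattice N → Space}
    (h0 : toTorusL q₀ = (X 0).2.1) :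
    ∃ Q : ℝ → Lattice N → Space, Q 0 = q₀ ∧ (∀ t, HasDerivAt Q (M⁻¹ • (X t).2.2) t) ∧
      ∀ t, toTorusL (Q t) = (X t).2.1 := by
  have hF : Continuous fun t => M⁻¹ • (X t).2.2 := (continuous_mom hX.1).const_smul M⁻¹
  have hQ : ∀ t, HasDerivAt (fun t => q₀ + ∫ s in (0 : ℝ)..t, M⁻¹ • (X s).2.2)
      (M⁻¹ • (X t).2.2) t :=
    fun t => (hasDerivAt_integral_zero hF t).const_add q₀
  have hQ0 : q₀ + ∫ s in (0 : ℝ)..0, M⁻¹ • (X s).2.2 = q₀ := by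
    rw [intervalIntegral.integral_same, add_zero]
  refine ⟨_, hQ0, hQ, toTorusL_eq_of_local_lifts hQ ((congrArg toTorusL hQ0).trans h0) fun t => ?_⟩
  refine (exists_project_eq (X t)).elim fun y hy => ?_
  refine (hX.exists_lift_hasDerivAt hσ hy).elim fun r hr => ⟨r, hr.1, ?_⟩
  exact hr.2.congr_deriv (congrArg (fun x : State N => M⁻¹ • x.2.2) hy)

/-- Every solution is the projection of a solution of the equation in the interaction picture. -/
theorem IsSolution.exists_lift (hσ : ContDiff ℝ 2 fun y => σ (toTorus N y))
    {X : ℝ → State N} (hX : IsSolution e M σ X) {x₀ : Tangent N} (h0 : project x₀ = X 0) :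
    ∃ x : ℝ → Tangent N, x 0 = x₀ ∧ (∀ t, HasDerivAt x (field e M (sigmaSeq hσ) t (x t)) t) ∧
      ∀ t, project (evolve t (x t)) = X t := by
  refine (hX.exists_lift_pos hσ (q₀ := x₀.2.1)
    (congrArg (fun x : State N => x.2.1) h0)).elim fun Q hQ => ?_
  have hQc : Continuous Q := continuous_iff_continuousAt.2 fun t => (hQ.2.1 t).continuousAt
  let Y : ℝ → Tangent N := fun t => ((X t).1, Q t, (X t).2.2)
  have hY : ∀ t, project (Y t) = X t := fun t => Prod.ext rfl (Prod.ext (hQ.2.2 t) rfl)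
  have hYc : Continuous Y := (continuous_psi hX.1).prodMk (hQc.prodMk (continuous_mom hX.1))
  have hIc : Continuous fun t => interaction e (sigmaSeq hσ) (Y t) :=
    (continuous_interaction e (sigmaSeq hσ)).comp hYc
  refine (exists_interaction_picture (ψ := fun t => (X t).1)
    (F := fun t => freeEvol (-t) (interaction e (sigmaSeq hσ) (Y t)))
    (I := fun t => interaction e (sigmaSeq hσ) (Y t)) (ψ₀ := x₀.1) (continuous_psi hX.1)
    (continuous_freeEvol_comp continuous_neg hIc)
    (fun t => freeEvol_freeEvol_neg t _) (congrArg Prod.fst h0).symm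
    (fun η t => hX.hasDerivAt_l2Form hσ (hY t) η)).elim fun v hv => ?_
  have hev : ∀ t, evolve t (v t, Q t, (X t).2.2) = Y t := fun t => Prod.ext (hv.2.2 t) rfl
  refine ⟨fun t => (v t, Q t, (X t).2.2), ?_, fun t => ?_, fun t => ?_⟩
  · exact Prod.ext hv.1 (Prod.ext hQ.1 (congrArg (fun x : State N => x.2.2) h0).symm)
  · have h1 := (hv.2.1 t).prodMk ((hQ.2.1 t).prodMk (hX.hasDerivAt_mom hσ (hY t)))
    have h2 := congrArg (fun y : Tangent N => (freeEvol (-t) (interaction e (sigmaSeq hσ) y),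
      M⁻¹ • (X t).2.2, force e (sigmaSeq hσ) y)) (hev t)
    exact h1.congr_deriv h2.symm
  · exact (congrArg project (hev t)).trans (hY t)

lemma IsSolution.unique (hσ : ContDiff ℝ 2 fun y => σ (toTorus N y)) {X X' : ℝ → State N}
    (hX : IsSolution e M σ X) (hX' : IsSolution e M σ X') (h0 : X 0 = X' 0) : X = X' := by
  refine (exists_project_eq (X 0)).elim fun x₀ hx₀ => ?_
  refine (hX.exists_lift hσ hx₀).elim fun x hx => ?_
  refine (hX'.exists_lift hσ (hx₀.trans h0)).elim fun x' hx' => ?_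
  have h1 : x = x' := eq_of_hasDerivAt_of_lipOnBalls (E := Tangent N)
    (lipOnBalls_field e M (sigmaSeq hσ)) hx.2.1 hx'.2.1 (hx.1.trans hx'.1.symm)
  funext t
  exact ((hx.2.2 t).symm.trans (congrArg (fun y : ℝ → Tangent N => project (evolve t (y t))) h1)).trans
    (hx'.2.2 t)

/-- Since every solution lifts to the ODE, conservation along ODE solutions covers all of them, not
only the constructed one. -/
lemma IsSolution.conservation (hσ : ContDiff ℝ 2 fun y => σ (toTorus N y)) {X : ℝ → State N}
    (hX : IsSolution e M σ X) (t : ℝ) :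
    energy e M σ (X t) = energy e M σ (X 0) ∧ charge (X t) = charge (X 0) := by
  have hw := isRealSeq_sigmaSeq hσ
  refine (exists_project_eq (X 0)).elim fun x₀ hx₀ => ?_
  refine (hX.exists_lift hσ hx₀).elim fun x hx => ?_
  have h0 : (0 : ℝ) ∈ Set.Icc (-|t|) |t| := ⟨by simp, abs_nonneg t⟩
  have ht : t ∈ Set.Icc (-|t|) |t| := abs_le.1 le_rfl
  have hE : ∀ s, energy e M σ (X s) = energyL e M (sigmaSeq hσ) (evolve s (x s)) := fun s =>
    (congrArg (energy e M σ) (hx.2.2 s).symm).trans (energy_project e M hσ _)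
  have hQ : ∀ s, charge (X s) = ‖waveFn (evolve s (x s)).1‖ ^ 2 := fun s =>
    (congrArg charge (hx.2.2 s).symm).trans (charge_eq (project (evolve s (x s))))
  have h1 := eq_of_hasDerivWithinAt_zero
    (fun s _ => hasDerivWithinAt_energyL hw (hx.2.1 s).hasDerivWithinAt) h0 ht
  have h2 := eq_of_hasDerivWithinAt_zero
    (fun s _ => hasDerivWithinAt_charge hw (hx.2.1 s).hasDerivWithinAt) h0 ht
  have h3 := hQ t
  have h4 := hQ 0
  exact ⟨(hE t).trans (h1.trans (hE 0).symm), by linarith⟩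

lemma exists_isSolution (hσ : ContDiff ℝ 2 fun y => σ (toTorus N y)) (hM : 0 < M)
    (X₀ : State N) : ∃ X : ℝ → State N, IsSolution e M σ X ∧ X 0 = X₀ := by
  refine (exists_project_eq X₀).elim fun x₀ hx₀ => ?_
  refine (exists_solution_field (e := e) (isRealSeq_sigmaSeq hσ) hM x₀).elim fun x hx => ?_
  exact ⟨_, isSolution_of_hasDerivAt e M hσ hx.2, (congrArg project
    ((evolve_zero (x 0)).trans hx.1)).trans hx₀⟩

end WellPosed

end Crystal

end

theorem mainTheorem4 (N : ℕ) [NeZero N] (hN : 1 < N)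
    (e Z M : ℝ) (he : 0 < e) (hZ : 0 < Z) (hM : 0 < M)
    (σ : Crystal.Torus N → ℝ)
    (hσ : ContDiff ℝ 2 fun y : Fin 3 → ℝ => σ (Crystal.toTorus N y))
    (hσZ : ∫ x, σ x = e * Z)
    (X₀ : Crystal.State N) (hX₀ : Crystal.charge X₀ = Z) :
    (∃! X : ℝ → Crystal.State N, Crystal.IsSolution e M σ X ∧ X 0 = X₀) ∧
    ∀ X : ℝ → Crystal.State N, Crystal.IsSolution e M σ X → X 0 = X₀ →
      ∀ t, Crystal.energy e M σ (X t) = Crystal.energy e M σ (X 0) ∧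
        Crystal.charge (X t) = Crystal.charge (X 0) := by
  obtain ⟨X, hX, h0⟩ := Crystal.exists_isSolution (e := e) hσ hM X₀
  refine ⟨⟨X, ⟨hX, h0⟩, fun X' hX' => ?_⟩, fun X hX _ t => hX.conservation hσ t⟩
  exact hX'.1.unique hσ hX (hX'.2.trans h0.symm)
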